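/- Let $m\ge 1$ and $N\ge K\ge 2m$ be integers, write $x=(y,z)\in\mathbb{R}^K\times\mathbb{R}^{N-K}$, and let $\mu\in\mathbb{R}$ satisfy $$\mu>-\left(\frac{2^m\,\Gamma\left(\frac{K+2m}{4}\right)}{\Gamma\left(\frac{K-2m}{4}\right)}\right)^2\ \text{ if } K>2m,\qquad \mu\ge 0\ \text{ if } K=2m.$$ Let $X^m_{\mathcal{G}(K)}$ be the space of all real functions $u\in H^m(\mathbb{R}^N)$ that are invariant under $\mathcal{O}(K)\times\mathrm{id}_{N-K}$ and satisfy $|\mu|\int_{\mathbb{R}^N}\frac{u^2}{|y|^{2m}}\,dx<+\infty$. Put $\nabla^m u=\Delta^{m/2}u$ for even $m$, $\nabla^m u=\nabla\Delta^{(m-1)/2}u$ for odd $m$, and $$[u]_\mu^2=\int_{\mathbb{R}^N}|\nabla^m u|^2+\frac{\mu}{|y|^{2m}}u^2\,dx,\qquad \|u\|_\mu^2=[u]_\mu^2+\int_{\mathbb{R}^N}u^2\,dx;$$ $X^m_{\mathcal{G}(K)}$ carries the norm $\|\cdot\|_\mu$. Let $H:\mathbb{R}\to\mathbb{R}$ be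 continuous with $\lim_{t\to0}H(t)/t^2=0$ and, as $|t|\to\infty$, $H(t)/|t|^{2N/(N-2m)}\to0$ if $N>2m$, respectively $H(t)/e^{\alpha t^2}\to0$ for every $\alpha>0$ if $N=2m$. **Theorem 4.1.** Let $(u_n)\subset X^m_{\mathcal{G}(K)}$ be bounded. (a) If $N>K$, then there are $(\widetilde u_i)_{i\ge0}\subset X^m_{\mathcal{G}(K)}$ and sequences $(z_n^i)_n\subset\mathbb{R}^{N-K}$, $i\ge0$, such that $z_n^0=0$ for all $n$, $|z_n^i-z_n^j|\to+\infty$ as $n\to+\infty$ for $i\ne j$, and, after passing to a subsequence (the same for all $i$), the following holds. For every $i\ge0$, $$u_n(\cdot+(0,z_n^i))\rightharpoonup\widetilde u_i\quad\text{in }X^m_{\mathcal{G}(K)},$$ $$\lim_{n\to+\infty}[u_n]_\mu^2=\sum_{j=0}^i[\widetilde u_j]_\mu^2+\lim_{n\to+\infty}[v_n^i]_\mu^2,\qquad v_n^i:=u_n-\sum_{j=0}^i\widetilde u_j(\cdot-(0,z_n^j)),$$ where both limits exist and are finite; and $$\limsup_{n\to+\infty}\int_{\mathbb{R}^N}H(u_n)\,dx=\sum_{j=0}^{+\infty}\int_{\mathbb{R}^N}H(\widetilde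 u_j)\,dx,$$ where all integrals exist and the series converges absolutely. (b) If $N=K$, then there is $\widetilde u_0\in X^m_{\mathcal{G}(K)}$ such that, after passing to a subsequence, $u_n\rightharpoonup\widetilde u_0$ in $X^m_{\mathcal{G}(K)}$, $$\lim_{n\to+\infty}[u_n]_\mu^2=[\widetilde u_0]_\mu^2+\lim_{n\to+\infty}[u_n-\widetilde u_0]_\mu^2\quad\text{and}\quad\limsup_{n\to+\infty}\int_{\mathbb{R}^N}H(u_n)\,dx=\int_{\mathbb{R}^N}H(\widetilde u_0)\,dx,$$ where both limits exist and are finite and all integrals exist. -/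

import Mathlib

open MeasureTheory Filter Topology
open scoped ContDiff

namespace SingularPolyharmonic

noncomputable section

/-- `ℝ^N = ℝ^K × ℝ^L` with its Euclidean structure and Lebesgue measure, where `N = K + L`. The
coordinates indexed by `Sum.inl` form the variable `y`, the others the variable `z`. -/
abbrev Space (K L : ℕ) : Type := EuclideanSpace ℝ (Fin K ⊕ Fin L)

variable {K L : ℕ}

/-- The component `y` of `x = (y, z)`. -/
def yPart (x : Space K L) : EuclideanSpace ℝ (Fin K) := WithLp.toLp 2 (fun i => x (Sum.inl i))

/-- The component `z` of `x = (y, z)`. -/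
def zPart (x : Space K L) : EuclideanSpace ℝ (Fin L) := WithLp.toLp 2 (fun i => x (Sum.inr i))

/-- The point `(y, z)`. -/
def pair (y : EuclideanSpace ℝ (Fin K)) (z : EuclideanSpace ℝ (Fin L)) : Space K L :=
  WithLp.toLp 2 (Sum.elim (fun i => y i) (fun i => z i))

/-- `x ↦ u (x + (0, z))`. -/
def shift (z : EuclideanSpace ℝ (Fin L)) (u : Space K L → ℝ) : Space K L → ℝ :=
  fun x => u (x + pair 0 z)

/-- `v` is the weak partial derivative of `u` in the coordinate direction `i`. -/
def HasWeakPartial (i : Fin K ⊕ Fin L) (u v : Space K L → ℝ) : Prop :=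
  ∀ φ : Space K L → ℝ, ContDiff ℝ ∞ φ → HasCompactSupport φ →
    ∫ x, u x * fderiv ℝ φ x (EuclideanSpace.single i 1) = -∫ x, v x * φ x

/-- The Sobolev space `H^m(ℝ^N)`: all weak partial derivatives of order at most `m` are in `L²`.
As usual, functions that agree almost everywhere are not distinguished. -/
def MemSob : ℕ → (Space K L → ℝ) → Prop
  | 0, u => MemLp u 2 volume
  | m + 1, u => MemLp u 2 volume ∧ ∀ i, ∃ v, MemSob m v ∧ HasWeakPartial i u v

open Classical in
/-- The weak partial derivative `∂ᵢ u`, a function in `L²` that is unique almost everywhere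
(and `0` if `u` has no weak partial derivative in `L²`). -/
def weakPartial (i : Fin K ⊕ Fin L) (u : Space K L → ℝ) : Space K L → ℝ :=
  if h : ∃ v, MemLp v 2 volume ∧ HasWeakPartial i u v then h.choose else 0

/-- The weak Laplacian `Δ u`. -/
def weakLaplacian (u : Space K L → ℝ) : Space K L → ℝ :=
  fun x => ∑ i, weakPartial i (weakPartial i u) x

/-- `|∇^m u|²`, where `∇^m u` is `Δ^(m/2) u` for even `m` and `∇ Δ^((m-1)/2) u` for odd `m`. -/
def nablaPowSq (m : ℕ) (u : Space K L → ℝ) : Space K L → ℝ :=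
  fun x => if Even m then (weakLaplacian^[m / 2] u x) ^ 2
    else ∑ i, (weakPartial i (weakLaplacian^[m / 2] u) x) ^ 2

/-- Invariance under `O(K) × id`, almost everywhere. -/
def IsCylindrical (u : Space K L → ℝ) : Prop :=
  ∀ A : EuclideanSpace ℝ (Fin K) ≃ₗᵢ[ℝ] EuclideanSpace ℝ (Fin K),
    ∀ᵐ x : Space K L, u (pair (A (yPart x)) (zPart x)) = u x

/-- The space `X^m_{G(K)}`: the functions of `H^m(ℝ^N)` that are invariant under `O(K) × id` and
satisfy `|μ| ∫ u² / |y|^(2m) < ∞`, with the convention `0 * ∞ = 0`. -/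
def MemX (m : ℕ) (μ : ℝ) (u : Space K L → ℝ) : Prop :=
  MemSob m u ∧ IsCylindrical u ∧
    ENNReal.ofReal |μ| * ∫⁻ x, ENNReal.ofReal (u x ^ 2 / ‖yPart x‖ ^ (2 * m)) < ⊤

/-- The quadratic form `[u]_μ² = ∫ |∇^m u|² + μ ∫ u² / |y|^(2m)`. -/
def formSq (m : ℕ) (μ : ℝ) (u : Space K L → ℝ) : ℝ :=
  (∫ x, nablaPowSq m u x) + μ * ∫ x, u x ^ 2 / ‖yPart x‖ ^ (2 * m)

/-- The norm `‖u‖_μ = ([u]_μ² + ∫ u²)^(1/2)` of `X^m_{G(K)}`. -/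
def normX (m : ℕ) (μ : ℝ) (u : Space K L → ℝ) : ℝ :=
  Real.sqrt (formSq m μ u + ∫ x, u x ^ 2)

/-- Weak convergence in the normed space `X^m_{G(K)}`: convergence under every bounded linear
functional. A linear functional on the subspace is written as the restriction of a linear
functional on the space of all functions, which only has to be bounded on the subspace. -/
def WeakConvX (m : ℕ) (μ : ℝ) (w : ℕ → Space K L → ℝ) (w₀ : Space K L → ℝ) : Prop :=
  ∀ l : (Space K L → ℝ) →ₗ[ℝ] ℝ, (∃ C : ℝ, ∀ v, MemX m μ v → |l v| ≤ C * normX m μ v) →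
    Tendsto (fun n => l (w n)) atTop (𝓝 (l w₀))

/-- The condition on `μ` under which `‖·‖_μ` is a norm on `X^m_{G(K)}`. -/
def AdmissiblePotential (K m : ℕ) (μ : ℝ) : Prop :=
  (2 * m < K ∧
    -((2 ^ m * Real.Gamma (((K : ℝ) + 2 * m) / 4) / Real.Gamma (((K : ℝ) - 2 * m) / 4)) ^ 2) < μ) ∨
  (K = 2 * m ∧ 0 ≤ μ)

/-- `H(t) = o(t²)` as `t → 0`. -/
def SuperquadraticAtZero (H : ℝ → ℝ) : Prop :=
  Tendsto (fun t => H t / t ^ 2) (𝓝[≠] 0) (𝓝 0)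

/-- Subcritical growth at infinity for `H^m(ℝ^N)`: `H(t) = o(|t|^(2N/(N-2m)))` if `N > 2m`, and
`H(t) = o(exp(α t²))` for every `α > 0` if `N = 2m`. -/
def SubcriticalAtInfinity (N m : ℕ) (H : ℝ → ℝ) : Prop :=
  (2 * m < N →
    Tendsto (fun t : ℝ => H t / |t| ^ (2 * (N : ℝ) / ((N : ℝ) - 2 * m))) (cocompact ℝ) (𝓝 0)) ∧
  (N = 2 * m → ∀ α : ℝ, 0 < α →
    Tendsto (fun t : ℝ => H t / Real.exp (α * t ^ 2)) (cocompact ℝ) (𝓝 0))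

end

end SingularPolyharmonic

open SingularPolyharmonic

/-! The Fourier transform turns the statement into Hilbert space geometry. `toModel` sends `u` to
the triple consisting of `û`, `(2π|ξ|)^m û` and the transform of `|μ|^(1/2) u / |y|^m`, in three
copies of `L²`. Weak derivatives are Fourier multipliers (`hasWeakPartial_iff`, `memSob_iff`), so
`[u]_μ²` is the squared norm of the second component plus `sign μ` times that of the third
(`formSq_eq`). The Hardy–Rellich inequality with the Gamma-function constant
(`lintegral_hardy_rellich`) makes `‖·‖_μ` equivalent to the model norm (`exists_norm_toModel_le`),
the image of the space is closed (`isClosed_range_embX`), and translations in `z` become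
multiplications by phases.

Profiles are extracted greedily along a free ultrafilter, along which every bounded sequence has a
weak limit. Among the position sequences that drift away from all earlier ones,
`exists_profileSystem` picks one whose weak limit has at least half the largest possible norm.
Translates that drift apart are asymptotically orthogonal, so energies split component by component
(`IsProfileSystem.tendsto_energy`). Hence the squared norms of the profiles are summable, and the
weak limits of arbitrary translates of the `i`-th remainder are small uniformly, as `i` grows.

To pass from small weak limits to small `∫ |H|`, functions are cut in frequency. The low frequency
part at a point is the inner product with a translate of one fixed vector (`lowPass_eq_inner`), so
weak limits control it as long as `|y|` stays bounded. When `|y| → ∞` the symmetry enters: the same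
value is repeated at many points far from each other, whose evaluation vectors are almost
orthogonal, so the value must be small (`eventually_norm_lowPass_le_of_yPart`). The high frequency
part is small in measure by Chebyshev. Very small and very large values of `u` contribute little to
`∫ |H(u)|` by the growth conditions (`exists_tail_bound`), which rests on a critical Sobolev or
Trudinger type bound proved by dyadic frequency cuts (`exists_critical_growth`). Together this gives
the vanishing lemma `exists_eventually_lintegral_le`.

A Brezis–Lieb splitting (`tendsto_integral_add_sub`) removes the profiles from `∫ H(u_n)` one at a
time, and the vanishing lemma disposes of the rest; the same splitting for `|H|` gives absolute
convergence. All limits asserted amount to countably many conditions, since weak convergence can be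
tested on a dense sequence, so one subsequence realises the limits along the ultrafilter
(`exists_strictMono_tendsto`). -/

namespace SingularPolyharmonic

open FourierTransform RealInnerProductSpace ComplexConjugate

/-! ### The Fourier transform on `L²`: translations, rotations, inversion. -/

section FourierL2

variable {E : Type*} [NormedAddCommGroup E] [InnerProductSpace ℝ E] [FiniteDimensional ℝ E]
  [MeasurableSpace E] [BorelSpace E]

/-- Complex-valued square-integrable functions. -/
abbrev L2C (E : Type*) [NormedAddCommGroup E] [InnerProductSpace ℝ E] [FiniteDimensional ℝ E]
    [MeasurableSpace E] [BorelSpace E] : Type _ := Lp (α := E) ℂ 2 volume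

theorem L2C.norm_sq (f : L2C E) : ‖f‖ ^ 2 = ∫ x, ‖f x‖ ^ 2 := by
  have h := L2.inner_def (𝕜 := ℝ) f f
  rw [real_inner_self_eq_norm_sq] at h
  rw [h]
  exact integral_congr_ae (.of_forall fun x => real_inner_self_eq_norm_sq _)

theorem L2C.integrable_norm_sq (f : L2C E) : Integrable (fun x => ‖f x‖ ^ 2) :=
  (Lp.memLp f).integrable_norm_pow two_ne_zero

theorem L2C.real_inner_eq_re (f g : L2C E) : inner ℝ f g = (inner ℂ f g).re := by
  rw [L2.inner_def, L2.inner_def, ← RCLike.re_eq_complex_re, ← integral_re (L2.integrable_inner f g)]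
  rfl

theorem memLp_phase_smul (x : E) (f : L2C E) :
    MemLp (fun ξ => 𝐞 ⟪x, ξ⟫ • f ξ) 2 := by
  refine (Lp.memLp f).of_le ?_ (.of_forall fun ξ => by simp)
  have : Continuous fun ξ : E => (𝐞 ⟪x, ξ⟫ : ℂ) := by fun_prop
  exact (this.aestronglyMeasurable.mul (Lp.memLp f).1)

/-- Multiplication by the character `ξ ↦ exp (2πi x·ξ)`. -/
noncomputable def mulPhase (x : E) : L2C E →ₗᵢ[ℂ] L2C E where
  toFun f := (memLp_phase_smul x f).toLp
  map_add' f g := by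
    ext1
    filter_upwards [MemLp.coeFn_toLp (memLp_phase_smul x (f + g)), Lp.coeFn_add f g,
      MemLp.coeFn_toLp (memLp_phase_smul x f), MemLp.coeFn_toLp (memLp_phase_smul x g),
      Lp.coeFn_add (memLp_phase_smul x f).toLp (memLp_phase_smul x g).toLp] with ξ h1 h2 h3 h4 h5
    rw [h1, h5, Pi.add_apply, h3, h4, h2, Pi.add_apply, smul_add]
  map_smul' c f := by
    ext1
    filter_upwards [MemLp.coeFn_toLp (memLp_phase_smul x (c • f)), Lp.coeFn_smul c f,
      MemLp.coeFn_toLp (memLp_phase_smul x f),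
      Lp.coeFn_smul c (memLp_phase_smul x f).toLp] with ξ h1 h2 h3 h5
    rw [h1, RingHom.id_apply, h5, Pi.smul_apply, h3, h2, Pi.smul_apply, smul_comm]
  norm_map' f := by
    rw [Lp.norm_def, Lp.norm_def]
    congr 1
    refine eLpNorm_congr_norm_ae ?_
    filter_upwards [MemLp.coeFn_toLp (memLp_phase_smul x f)] with ξ h
    simp only [LinearMap.coe_mk, AddHom.coe_mk]
    rw [h]
    simp

theorem coeFn_mulPhase (x : E) (f : L2C E) :
    mulPhase x f =ᵐ[volume] fun ξ => 𝐞 ⟪x, ξ⟫ • f ξ :=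
  MemLp.coeFn_toLp (memLp_phase_smul x f)

theorem mulPhase_zero (f : L2C E) : mulPhase 0 f = f := by
  ext1
  filter_upwards [coeFn_mulPhase 0 f] with ξ h
  simp [h]

theorem mulPhase_add (x y : E) (f : L2C E) : mulPhase (x + y) f = mulPhase x (mulPhase y f) := by
  ext1
  filter_upwards [coeFn_mulPhase (x + y) f, coeFn_mulPhase y f,
    coeFn_mulPhase x (mulPhase y f)] with ξ h1 h2 h3
  rw [h1, h3, h2, inner_add_left, AddChar.map_add_eq_mul, mul_smul]

theorem inner_mulPhase (x : E) (f g : L2C E) :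
    inner ℂ (mulPhase x f) g = ∫ ξ, 𝐞 (-⟪ξ, x⟫) • inner ℂ (f ξ) (g ξ) := by
  rw [L2.inner_def]
  refine integral_congr_ae ?_
  filter_upwards [coeFn_mulPhase x f] with ξ h
  rw [h, real_inner_comm, Circle.smul_def, Circle.smul_def, inner_smul_left, smul_eq_mul]
  congr 1
  rw [AddChar.map_neg_eq_inv, Circle.coe_inv_eq_conj]

/-- Riemann–Lebesgue for the integrable function `ξ ↦ ⟨f ξ, g ξ⟩`. On the physical side: translates
that run off to infinity are weakly null. -/
theorem tendsto_inner_mulPhase_cocompact (f g : L2C E) :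
    Tendsto (fun x => inner ℂ (mulPhase x f) g) (cocompact E) (𝓝 0) := by
  simp_rw [inner_mulPhase]
  exact tendsto_integral_exp_inner_smul_cocompact fun ξ => inner ℂ (f ξ) (g ξ)

theorem continuous_inner_mulPhase (f g : L2C E) :
    Continuous fun x => inner ℂ (mulPhase x f) g := by
  simp_rw [inner_mulPhase]
  have hi : Integrable (fun ξ => inner ℂ (f ξ) (g ξ)) := L2.integrable_inner f g
  refine continuous_of_dominated (bound := fun ξ => ‖inner ℂ (f ξ) (g ξ)‖) (fun x => ?_)
    (fun x => .of_forall fun ξ => by simp) hi.norm (.of_forall fun ξ => ?_)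
  · have : Continuous fun ξ : E => (𝐞 (-⟪ξ, x⟫) : ℂ) := by fun_prop
    exact this.aestronglyMeasurable.mul hi.1
  · have : Continuous fun x : E => (𝐞 (-⟪ξ, x⟫) : ℂ) := by fun_prop
    exact this.mul continuous_const

/-- Weak continuity together with constancy of the norm gives strong continuity, by expanding `‖a -
b‖²`. -/
theorem continuous_mulPhase (f : L2C E) : Continuous fun x => mulPhase x f := by
  rw [continuous_iff_continuousAt]
  intro x₀
  rw [ContinuousAt, tendsto_iff_norm_sub_tendsto_zero]
  have h : ∀ x, ‖mulPhase x f - mulPhase x₀ f‖ =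
      √(2 * ‖f‖ ^ 2 - 2 * (inner ℂ (mulPhase x f) (mulPhase x₀ f)).re) := by
    intro x
    rw [← Real.sqrt_sq (norm_nonneg (mulPhase x f - mulPhase x₀ f)), @norm_sub_sq ℂ]
    simp only [LinearIsometry.norm_map, RCLike.re_eq_complex_re]
    ring_nf
  have hc : Continuous fun x =>
      √(2 * ‖f‖ ^ 2 - 2 * (inner ℂ (mulPhase x f) (mulPhase x₀ f)).re) := by
    have := continuous_inner_mulPhase f (mulPhase x₀ f)
    fun_prop
  have h0 := hc.tendsto x₀
  simp only [← h, sub_self, norm_zero] at h0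
  exact h0

/-- The translation `f ↦ f (· + a)`. -/
noncomputable def translateL2 (a : E) : L2C E →ₗᵢ[ℂ] L2C E :=
  Lp.compMeasurePreservingₗᵢ ℂ (· + a) (measurePreserving_add_right volume a)

theorem coeFn_translateL2 (a : E) (f : L2C E) :
    translateL2 a f =ᵐ[volume] fun x => f (x + a) :=
  Lp.coeFn_compMeasurePreserving f (measurePreserving_add_right volume a)

/-- The composition with a linear isometry. -/
noncomputable def rotateL2 (A : E ≃ₗᵢ[ℝ] E) : L2C E →ₗᵢ[ℂ] L2C E :=
  Lp.compMeasurePreservingₗᵢ ℂ A A.measurePreserving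

theorem coeFn_rotateL2 (A : E ≃ₗᵢ[ℝ] E) (f : L2C E) :
    rotateL2 A f =ᵐ[volume] fun x => f (A x) :=
  Lp.coeFn_compMeasurePreserving f A.measurePreserving

/-- Density of Schwartz functions: identities for the `L²` transform reduce to those for the
integral formula. -/
theorem ext_on_schwartz {F G : L2C E → L2C E} (hF : Continuous F) (hG : Continuous G)
    (h : ∀ φ : SchwartzMap E ℂ, F (φ.toLp 2) = G (φ.toLp 2)) : F = G :=
  (SchwartzMap.denseRange_toLpCLM (E := E) (F := ℂ) (p := 2) (μ := volume)
    ENNReal.ofNat_ne_top).equalizer hF hG (funext h)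

theorem fourier_translateL2 (a : E) (f : L2C E) :
    𝓕 (translateL2 a f) = mulPhase a (𝓕 f) := by
  have hc : Continuous fun f : L2C E => 𝓕 f := (Lp.fourierTransformₗᵢ E ℂ).continuous
  refine congrFun (ext_on_schwartz (F := fun f => 𝓕 (translateL2 a f))
    (G := fun f => mulPhase a (𝓕 f)) (hc.comp (translateL2 a).continuous)
    ((mulPhase a).continuous.comp hc) fun φ => ?_) f
  have h1 : translateL2 a (φ.toLp 2) = (φ.compSubConstCLM ℂ (-a)).toLp 2 := by
    ext1
    have hq := (measurePreserving_add_right volume a).quasiMeasurePreserving.ae_eq_comp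
      (φ.coeFn_toLp 2 volume)
    filter_upwards [coeFn_translateL2 a (φ.toLp 2), hq,
      (φ.compSubConstCLM ℂ (-a)).coeFn_toLp 2 volume] with x h1 h2 h3
    simp only [Function.comp_apply] at h2
    rw [h1, h2, h3]
    simp
  rw [h1, SchwartzMap.toLp_fourier_eq, SchwartzMap.toLp_fourier_eq]
  ext1
  filter_upwards [(𝓕 (φ.compSubConstCLM ℂ (-a))).coeFn_toLp 2 volume,
    coeFn_mulPhase a ((𝓕 φ).toLp 2), (𝓕 φ).coeFn_toLp 2 volume] with ξ h1 h2 h3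
  rw [h1, h2, h3, SchwartzMap.fourier_coe, SchwartzMap.fourier_coe]
  have := congrFun (VectorFourier.fourierIntegral_comp_add_right 𝐞 volume (innerₗ E) φ a) ξ
  have h4 : (φ.compSubConstCLM ℂ (-a) : E → ℂ) = φ ∘ fun v => v + a := by
    ext v; simp
  rw [h4]
  exact this

theorem fourier_rotateL2 (A : E ≃ₗᵢ[ℝ] E) (f : L2C E) :
    𝓕 (rotateL2 A f) = rotateL2 A (𝓕 f) := by
  have hc : Continuous fun f : L2C E => 𝓕 f := (Lp.fourierTransformₗᵢ E ℂ).continuous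
  refine congrFun (ext_on_schwartz (F := fun f => 𝓕 (rotateL2 A f))
    (G := fun f => rotateL2 A (𝓕 f)) (hc.comp (rotateL2 A).continuous)
    ((rotateL2 A).continuous.comp hc) fun φ => ?_) f
  have h0 : ∀ ψ : SchwartzMap E ℂ, rotateL2 A (ψ.toLp 2) =
      (SchwartzMap.compCLMOfContinuousLinearEquiv ℂ A.toContinuousLinearEquiv ψ).toLp 2 := by
    intro ψ
    ext1
    have hq := A.measurePreserving.quasiMeasurePreserving.ae_eq_comp (ψ.coeFn_toLp 2 volume)
    filter_upwards [coeFn_rotateL2 A (ψ.toLp 2), hq,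
      (SchwartzMap.compCLMOfContinuousLinearEquiv ℂ A.toContinuousLinearEquiv ψ).coeFn_toLp 2
        volume] with x h1 h2 h3
    simp only [Function.comp_apply] at h2
    rw [h1, h2, h3]
    simp
  rw [h0, SchwartzMap.toLp_fourier_eq, SchwartzMap.toLp_fourier_eq, h0]
  congr 1
  ext ξ
  simp only [SchwartzMap.fourier_coe, SchwartzMap.compCLMOfContinuousLinearEquiv_apply]
  exact Real.fourier_comp_linearIsometry A φ ξ

/-- The part of the Fourier inversion integral of `F` with frequencies in the ball of
radius `R`. -/
noncomputable def lowPass (R : ℝ) (F : E → ℂ) (x : E) : ℂ :=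
  ∫ ξ in Metric.ball 0 R, 𝐞 ⟪x, ξ⟫ • F ξ

/-- The abstract inverse and the absolutely convergent integral define the same distribution, by
duality against test functions. This is what lets a band-limited function be evaluated at individual
points. -/
theorem fourierInv_toLp_ae_eq {g : E → ℂ} (h1 : Integrable g) (h2 : MemLp g 2) :
    (𝓕⁻ h2.toLp : L2C E) =ᵐ[volume] fun x => ∫ ξ, 𝐞 ⟪x, ξ⟫ • g ξ := by
  have hcont : Continuous fun x => ∫ ξ, 𝐞 ⟪x, ξ⟫ • g ξ := by
    refine continuous_of_dominated (bound := fun ξ => ‖g ξ‖) (fun x => ?_)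
      (fun x => .of_forall fun ξ => by simp) h1.norm (.of_forall fun ξ => ?_)
    · have : Continuous fun ξ : E => (𝐞 (⟪x, ξ⟫) : ℂ) := by fun_prop
      exact this.aestronglyMeasurable.mul h1.1
    · have : Continuous fun x : E => (𝐞 (⟪x, ξ⟫) : ℂ) := by fun_prop
      exact this.mul continuous_const
  refine ae_eq_of_integral_contDiff_smul_eq
    ((Lp.memLp _).locallyIntegrable (by norm_num)) hcont.locallyIntegrable fun φ hφ hφc => ?_
  have hφ' : ContDiff ℝ ∞ (fun x => (φ x : ℂ)) := Complex.ofRealCLM.contDiff.comp hφ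
  have hφc' : HasCompactSupport (fun x => (φ x : ℂ)) := hφc.comp_left (g := Complex.ofReal) rfl
  set ψ : SchwartzMap E ℂ := hφc'.toSchwartzMap hφ'
  have hψ : ∀ x, ψ x = φ x := fun x => rfl
  have h := congrArg (fun T : TemperedDistribution E ℂ => T ψ)
    (Lp.fourierInv_toTemperedDistribution_eq (h2.toLp : L2C E))
  simp only [TemperedDistribution.fourierInv_apply, Lp.toTemperedDistribution_apply] at h
  have e1 : ∫ x, φ x • (𝓕⁻ h2.toLp : L2C E) x = ∫ x, ψ x • (𝓕⁻ h2.toLp : L2C E) x := by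
    refine integral_congr_ae (.of_forall fun x => ?_)
    simp [hψ]
  rw [e1, ← h]
  have e2 : ∫ x, (𝓕⁻ ψ) x • (h2.toLp : L2C E) x = ∫ x, (𝓕⁻ ψ) x • g x := by
    refine integral_congr_ae ?_
    filter_upwards [h2.coeFn_toLp] with x hx
    rw [hx]
  rw [e2]
  have h3 := VectorFourier.integral_fourierIntegral_smul_eq_flip (e := 𝐞) (μ := (volume : Measure E))
    (ν := (volume : Measure E)) (L := -innerₗ E) (f := ψ) (g := g) Real.continuous_fourierChar
    (by simp only [LinearMap.neg_apply, innerₗ_apply_apply]; fun_prop) ψ.integrable h1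
  have e3 : ∀ ξ, VectorFourier.fourierIntegral 𝐞 volume (-innerₗ E) ψ ξ = (𝓕⁻ ψ) ξ := by
    intro ξ
    rw [SchwartzMap.fourierInv_coe, Real.fourierInv_eq]
    simp [VectorFourier.fourierIntegral]
  simp_rw [e3] at h3
  rw [h3]
  refine integral_congr_ae (.of_forall fun x => ?_)
  simp only [hψ, VectorFourier.fourierIntegral]
  rw [Complex.real_smul, smul_eq_mul]
  congr 1
  refine integral_congr_ae (.of_forall fun ξ => ?_)
  simp

end FourierL2

end SingularPolyharmonic

namespace SingularPolyharmonic

open FourierTransform RealInnerProductSpace ComplexConjugate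

/-! ### Frequency truncation. -/

section LowPass

variable {E : Type*} [NormedAddCommGroup E] [InnerProductSpace ℝ E] [FiniteDimensional ℝ E]
  [MeasurableSpace E] [BorelSpace E]

theorem L2C.lintegral_norm_sq (f : L2C E) :
    ∫⁻ x, ENNReal.ofReal (‖f x‖ ^ 2) = ENNReal.ofReal (‖f‖ ^ 2) := by
  rw [L2C.norm_sq, ofReal_integral_eq_lintegral_ofReal (L2C.integrable_norm_sq f)
    (.of_forall fun _ => by positivity)]

theorem memLp_indicator_ball (R : ℝ) (F : L2C E) :
    MemLp ((Metric.ball (0 : E) R).indicator F) 2 :=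
  (Lp.memLp F).indicator measurableSet_ball

theorem integrable_indicator_ball (R : ℝ) (F : L2C E) :
    Integrable ((Metric.ball (0 : E) R).indicator F) := by
  rw [integrable_indicator_iff measurableSet_ball]
  exact ((Lp.memLp F).locallyIntegrable (by norm_num)).integrableOn_isCompact
    (isCompact_closedBall (0 : E) R) |>.mono_set Metric.ball_subset_closedBall

theorem lowPass_eq_integral_indicator (R : ℝ) (F : E → ℂ) (x : E) :
    lowPass R F x = ∫ ξ, 𝐞 ⟪x, ξ⟫ • (Metric.ball (0 : E) R).indicator F ξ := by
  rw [lowPass, ← integral_indicator measurableSet_ball]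
  refine integral_congr_ae (.of_forall fun ξ => ?_)
  by_cases h : ξ ∈ Metric.ball (0 : E) R <;> simp [h]

/-- Plancherel for `f` minus its truncation, whose transform is that of `f` set to zero on the ball.
-/
theorem lintegral_norm_sub_lowPass_sq (R : ℝ) (f : L2C E) :
    ∫⁻ x, ENNReal.ofReal (‖f x - lowPass R (𝓕 f : L2C E) x‖ ^ 2) =
      ∫⁻ ξ in (Metric.ball (0 : E) R)ᶜ, ENNReal.ofReal (‖(𝓕 f : L2C E) ξ‖ ^ 2) := by
  set F : L2C E := 𝓕 f with hF
  have hg2 := memLp_indicator_ball R F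
  set h : L2C E := f - 𝓕⁻ (hg2.toLp : L2C E) with hh
  have e1 : ∫⁻ x, ENNReal.ofReal (‖f x - lowPass R F x‖ ^ 2) =
      ∫⁻ x, ENNReal.ofReal (‖h x‖ ^ 2) := by
    refine lintegral_congr_ae ?_
    filter_upwards [fourierInv_toLp_ae_eq (integrable_indicator_ball R F) hg2,
      Lp.coeFn_sub f (𝓕⁻ (hg2.toLp : L2C E))] with x h1 h2
    rw [h2, Pi.sub_apply, h1, lowPass_eq_integral_indicator]
  have e2 : (𝓕 h : L2C E) = F - hg2.toLp := by
    have hsub : ∀ a b : L2C E, (𝓕 (a - b) : L2C E) = 𝓕 a - 𝓕 b :=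
      (Lp.fourierTransformₗᵢ E ℂ).map_sub
    rw [hh, hsub, FourierTransform.fourier_fourierInv_eq]
  rw [e1, L2C.lintegral_norm_sq, ← Lp.norm_fourier_eq h, ← L2C.lintegral_norm_sq,
    ← lintegral_indicator measurableSet_ball.compl, e2]
  refine lintegral_congr_ae ?_
  filter_upwards [Lp.coeFn_sub F hg2.toLp, hg2.coeFn_toLp] with ξ h1 h2
  rw [h1, Pi.sub_apply, h2]
  by_cases h : ξ ∈ Metric.ball (0 : E) R
  · rw [Set.indicator_of_mem h, Set.indicator_of_notMem (by simpa using h)]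
    simp
  · rw [Set.indicator_of_notMem h, Set.indicator_of_mem (by simpa using h)]
    simp

/-- The indicator function of the ball of radius `R`. -/
noncomputable def ballIndicator (E : Type*) [NormedAddCommGroup E] [InnerProductSpace ℝ E]
    [FiniteDimensional ℝ E] [MeasurableSpace E] [BorelSpace E] (R : ℝ) : L2C E :=
  indicatorConstLp 2 (measurableSet_ball (x := (0 : E)) (ε := R)) measure_ball_lt_top.ne 1

/-- Evaluation of the truncated function is a bounded functional, represented by a modulated ball
indicator. Weak convergence therefore yields pointwise convergence of low frequency parts. -/
theorem lowPass_eq_inner (R : ℝ) (F : L2C E) (x : E) :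
    lowPass R F x = inner ℂ (mulPhase (-x) (ballIndicator E R)) F := by
  rw [lowPass_eq_integral_indicator, inner_mulPhase]
  refine integral_congr_ae ?_
  filter_upwards [indicatorConstLp_coeFn (p := 2) (c := (1 : ℂ))
    (hs := measurableSet_ball (x := (0 : E)) (ε := R)) (hμs := measure_ball_lt_top.ne)] with ξ h
  rw [ballIndicator, h, inner_neg_right, neg_neg, real_inner_comm]
  by_cases hm : ξ ∈ Metric.ball (0 : E) R <;> simp [hm]

theorem lowPass_add (R : ℝ) (F : L2C E) (x a : E) :
    lowPass R F (x + a) = lowPass R (mulPhase a F) x := by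
  rw [lowPass_eq_inner, lowPass_eq_inner,
    ← (mulPhase a).inner_map_map (mulPhase (-(x + a)) _) F, ← mulPhase_add]
  congr 2
  abel_nf

theorem lowPass_rotate (R : ℝ) (F : L2C E) (A : E ≃ₗᵢ[ℝ] E) (hF : rotateL2 A F = F) (x : E) :
    lowPass R F (A x) = lowPass R F x := by
  rw [lowPass_eq_integral_indicator, lowPass_eq_integral_indicator,
    ← A.measurePreserving.integral_comp A.toHomeomorph.measurableEmbedding]
  refine integral_congr_ae ?_
  have h1 := coeFn_rotateL2 A F
  rw [hF] at h1
  filter_upwards [h1] with ξ h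
  rw [A.inner_map_map]
  congr 1
  by_cases hm : ξ ∈ Metric.ball (0 : E) R
  · have hm' : A ξ ∈ Metric.ball (0 : E) R := by simpa using hm
    simp only [Set.indicator_of_mem hm, Set.indicator_of_mem hm', h]
  · have hm' : A ξ ∉ Metric.ball (0 : E) R := by simpa using hm
    simp only [Set.indicator_of_notMem hm, Set.indicator_of_notMem hm']

end LowPass

/-! ### The Fourier transform of real-valued functions. -/

section RealFourier

variable {E : Type*} [NormedAddCommGroup E] [InnerProductSpace ℝ E] [FiniteDimensional ℝ E]
  [MeasurableSpace E] [BorelSpace E]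

theorem memLp_ofReal {u : E → ℝ} (h : MemLp u 2) : MemLp (fun x => (u x : ℂ)) 2 :=
  h.ofReal (K := ℂ)

open Classical in
/-- The Fourier transform of a real function in `L²` (and `0` for other functions). -/
noncomputable def ft (u : E → ℝ) : L2C E :=
  if h : MemLp u 2 then 𝓕 (memLp_ofReal h).toLp else 0

theorem ft_of_memLp {u : E → ℝ} (h : MemLp u 2) :
    ft u = 𝓕 ((memLp_ofReal h).toLp : L2C E) := dif_pos h

theorem coeFn_toLp_ofReal {u : E → ℝ} (h : MemLp u 2) :
    ((memLp_ofReal h).toLp : L2C E) =ᵐ[volume] fun x => (u x : ℂ) :=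
  (memLp_ofReal h).coeFn_toLp

theorem ft_congr {u v : E → ℝ} (h : u =ᵐ[volume] v) : ft u = ft v := by
  by_cases hu : MemLp u 2
  · have hv : MemLp v 2 := hu.ae_eq h
    rw [ft_of_memLp hu, ft_of_memLp hv]
    congr 1
    ext1
    filter_upwards [coeFn_toLp_ofReal hu, coeFn_toLp_ofReal hv, h] with x h1 h2 h3
    rw [h1, h2, h3]
  · have hv : ¬ MemLp v 2 := fun hv => hu (hv.ae_eq h.symm)
    rw [ft, ft, dif_neg hu, dif_neg hv]

theorem ft_add {u v : E → ℝ} (hu : MemLp u 2) (hv : MemLp v 2) : ft (u + v) = ft u + ft v := by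
  rw [ft_of_memLp hu, ft_of_memLp hv, ft_of_memLp (hu.add hv)]
  have : ∀ a b : L2C E, (𝓕 (a + b) : L2C E) = 𝓕 a + 𝓕 b :=
    (Lp.fourierTransformₗᵢ E ℂ).map_add
  rw [← this]
  congr 1
  ext1
  filter_upwards [coeFn_toLp_ofReal hu, coeFn_toLp_ofReal hv, coeFn_toLp_ofReal (hu.add hv),
    Lp.coeFn_add ((memLp_ofReal hu).toLp : L2C E) (memLp_ofReal hv).toLp] with x h1 h2 h3 h4
  rw [h3, h4]
  simp only [Pi.add_apply, Complex.ofReal_add]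
  exact congrArg₂ (· + ·) h1.symm h2.symm

theorem ft_smul (c : ℝ) {u : E → ℝ} (hu : MemLp u 2) : ft (c • u) = (c : ℂ) • ft u := by
  rw [ft_of_memLp hu, ft_of_memLp (hu.const_smul c)]
  have : ∀ a : L2C E, (𝓕 ((c : ℂ) • a) : L2C E) = (c : ℂ) • 𝓕 a :=
    (Lp.fourierTransformₗᵢ E ℂ).map_smul (c : ℂ)
  rw [← this]
  congr 1
  ext1
  filter_upwards [coeFn_toLp_ofReal hu, coeFn_toLp_ofReal (hu.const_smul c),
    Lp.coeFn_smul (c : ℂ) ((memLp_ofReal hu).toLp : L2C E)] with x h1 h3 h4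
  rw [h3, h4]
  simp only [Pi.smul_apply, smul_eq_mul, Complex.ofReal_mul]
  exact congrArg _ h1.symm

theorem inner_ft {u v : E → ℝ} (hu : MemLp u 2) (hv : MemLp v 2) :
    inner ℂ (ft u) (ft v) = ((∫ x, u x * v x : ℝ) : ℂ) := by
  rw [ft_of_memLp hu, ft_of_memLp hv, Lp.inner_fourier_eq, L2.inner_def, ← integral_complex_ofReal]
  refine integral_congr_ae ?_
  filter_upwards [coeFn_toLp_ofReal hu, coeFn_toLp_ofReal hv] with x h1 h2
  rw [h1, h2]
  simp [mul_comm]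

theorem norm_ft_sq {u : E → ℝ} (hu : MemLp u 2) : ‖ft u‖ ^ 2 = ∫ x, u x ^ 2 := by
  have h := inner_ft hu hu
  rw [inner_self_eq_norm_sq_to_K] at h
  simp only [← pow_two] at h
  exact Complex.ofReal_injective (by rw [← h]; simp)

theorem ae_eq_of_ft_eq {u v : E → ℝ} (hu : MemLp u 2) (hv : MemLp v 2) (h : ft u = ft v) :
    u =ᵐ[volume] v := by
  rw [ft_of_memLp hu, ft_of_memLp hv] at h
  have h' := (Lp.fourierTransformₗᵢ E ℂ).injective h
  have h1 := coeFn_toLp_ofReal hu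
  rw [h'] at h1
  filter_upwards [h1, coeFn_toLp_ofReal hv] with x h1 h2
  rw [h1] at h2
  exact_mod_cast h2

/-- Transforms of real functions form a closed set, because the imaginary part is a continuous
operator on `L²` and vanishes along the sequence. -/
theorem exists_ft_eq_of_tendsto {u : ℕ → E → ℝ} (hu : ∀ n, MemLp (u n) 2) {h : L2C E}
    (hlim : Tendsto (fun n => ft (u n)) atTop (𝓝 h)) : ∃ v : E → ℝ, MemLp v 2 ∧ ft v = h := by
  set g : L2C E := 𝓕⁻ h with hg
  have hlim' : Tendsto (fun n => (memLp_ofReal (hu n)).toLp) atTop (𝓝 g) := by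
    have := ((Lp.fourierTransformₗᵢ E ℂ).symm.continuous.tendsto h).comp hlim
    refine this.congr fun n => ?_
    simp only [Function.comp_apply]
    rw [ft_of_memLp (hu n)]
    exact (Lp.fourierTransformₗᵢ E ℂ).symm_apply_apply _
  have him : Complex.imCLM.compLp g = 0 := by
    have hc := ((Complex.imCLM.compLpL 2 (volume : Measure E)).continuous.tendsto g).comp hlim'
    have h0 : ∀ n, Complex.imCLM.compLp ((memLp_ofReal (hu n)).toLp : L2C E) = 0 := by
      intro n
      ext1
      filter_upwards [Complex.imCLM.coeFn_compLp ((memLp_ofReal (hu n)).toLp : L2C E),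
        coeFn_toLp_ofReal (hu n), Lp.coeFn_zero ℝ 2 (volume : Measure E)] with x h1 h2 h3
      rw [h1, h2, h3]
      simp
    refine tendsto_nhds_unique hc ?_
    refine tendsto_const_nhds.congr fun n => ?_
    exact (h0 n).symm
  have hre : MemLp (fun x => (g x).re) 2 := (Lp.memLp g).re
  refine ⟨fun x => (g x).re, hre, ?_⟩
  rw [ft_of_memLp hre]
  have : ((memLp_ofReal hre).toLp : L2C E) = g := by
    ext1
    have h1 := Complex.imCLM.coeFn_compLp g
    rw [him] at h1
    filter_upwards [h1, coeFn_toLp_ofReal hre,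
      Lp.coeFn_zero ℝ 2 (volume : Measure E)] with x h1 h2 h3
    rw [h3] at h1
    rw [h2]
    apply Complex.ext
    · simp
    · simpa using h1
  rw [this]
  exact (Lp.fourierTransformₗᵢ E ℂ).apply_symm_apply h

theorem ft_translate {u : E → ℝ} (hu : MemLp u 2) (a : E) :
    ft (fun x => u (x + a)) = mulPhase a (ft u) := by
  have hm := measurePreserving_add_right (volume : Measure E) a
  have hv : MemLp (fun x => u (x + a)) 2 := hu.comp_measurePreserving hm
  rw [ft_of_memLp hu, ft_of_memLp hv, ← fourier_translateL2]
  refine congrArg _ ?_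
  ext1
  filter_upwards [coeFn_toLp_ofReal hv, coeFn_translateL2 a ((memLp_ofReal hu).toLp : L2C E),
    hm.quasiMeasurePreserving.ae_eq_comp (coeFn_toLp_ofReal hu)] with x h1 h2 h3
  rw [h1, h2]
  exact h3.symm

theorem ft_rotate {u : E → ℝ} (hu : MemLp u 2) (A : E ≃ₗᵢ[ℝ] E) :
    ft (fun x => u (A x)) = rotateL2 A (ft u) := by
  have hm := A.measurePreserving
  have hv : MemLp (fun x => u (A x)) 2 := hu.comp_measurePreserving hm
  rw [ft_of_memLp hu, ft_of_memLp hv, ← fourier_rotateL2]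
  refine congrArg _ ?_
  ext1
  filter_upwards [coeFn_toLp_ofReal hv, coeFn_rotateL2 A ((memLp_ofReal hu).toLp : L2C E),
    hm.quasiMeasurePreserving.ae_eq_comp (coeFn_toLp_ofReal hu)] with x h1 h2 h3
  rw [h1, h2]
  exact h3.symm

theorem lintegral_sub_lowPass_sq (R : ℝ) {u : E → ℝ} (hu : MemLp u 2) :
    ∫⁻ x, ENNReal.ofReal (‖(u x : ℂ) - lowPass R (ft u) x‖ ^ 2) =
      ∫⁻ ξ in (Metric.ball (0 : E) R)ᶜ, ENNReal.ofReal (‖ft u ξ‖ ^ 2) := by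
  rw [ft_of_memLp hu, ← lintegral_norm_sub_lowPass_sq]
  refine lintegral_congr_ae ?_
  filter_upwards [coeFn_toLp_ofReal hu] with x h
  rw [h]

end RealFourier

end SingularPolyharmonic

namespace SingularPolyharmonic

open FourierTransform RealInnerProductSpace ComplexConjugate

/-! ### Weak derivatives as Fourier multipliers. -/

section WeakDerivatives

variable {K L : ℕ}

theorem contDiff_partial {φ : Space K L → ℝ} (hφ : ContDiff ℝ ∞ φ) (i : Fin K ⊕ Fin L) :
    ContDiff ℝ ∞ fun x => fderiv ℝ φ x (EuclideanSpace.single i 1) :=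
  (hφ.fderiv_right (m := ∞) (by simp)).clm_apply contDiff_const

/-- Test functions need not have compact support: multiply by cutoffs dilated by `n + 1`, whose
derivatives are `O(1/n)`, and use dominated convergence. Needed because inverse transforms of bump
functions are only Schwartz. -/
theorem HasWeakPartial.integral_eq {i : Fin K ⊕ Fin L} {u v : Space K L → ℝ}
    (h : HasWeakPartial i u v) (hu : MemLp u 2) (hv : MemLp v 2) {φ : Space K L → ℝ}
    (hφ : ContDiff ℝ ∞ φ) (h1 : MemLp φ 2)
    (h2 : MemLp (fun x => fderiv ℝ φ x (EuclideanSpace.single i 1)) 2) :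
    ∫ x, u x * fderiv ℝ φ x (EuclideanSpace.single i 1) = -∫ x, v x * φ x := by
  set e : Space K L := EuclideanSpace.single i 1
  let f : ContDiffBump (0 : Space K L) := ⟨1, 2, one_pos, one_lt_two⟩
  let χ : ℕ → Space K L → ℝ := fun n x => f ((1 / ((n : ℝ) + 1)) • x)
  have hf : ContDiff ℝ ∞ f := f.contDiff
  have hχ : ∀ n, ContDiff ℝ ∞ (χ n) := fun n => hf.comp (contDiff_const_smul _)
  have hχc : ∀ n, HasCompactSupport (χ n) := fun n => f.hasCompactSupport.comp_smul (by positivity)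
  have hχ1 : ∀ n x, |χ n x| ≤ 1 := fun n x => by
    rw [abs_of_nonneg f.nonneg]; exact f.le_one
  have hχlim : ∀ x, ∀ᶠ n in atTop, χ n x = 1 := by
    intro x
    have : ∀ᶠ n : ℕ in atTop, ‖x‖ ≤ n := by
      filter_upwards [eventually_ge_atTop ⌈‖x‖⌉₊] with n hn using Nat.ceil_le.1 hn
    filter_upwards [this] with n hn
    refine f.one_of_mem_closedBall ?_
    rw [mem_closedBall_zero_iff, norm_smul, Real.norm_of_nonneg (by positivity)]
    change 1 / ((n : ℝ) + 1) * ‖x‖ ≤ 1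
    rw [one_div_mul_eq_div, div_le_one (by positivity)]
    linarith
  obtain ⟨C, hC⟩ : ∃ C, ∀ x, |fderiv ℝ f x e| ≤ C := by
    have hcs : HasCompactSupport fun x => fderiv ℝ f x e :=
      (f.hasCompactSupport.fderiv_apply (𝕜 := ℝ) e)
    have hcont : Continuous fun x => fderiv ℝ f x e := (contDiff_partial hf i).continuous
    obtain ⟨C, hC⟩ := hcs.exists_bound_of_continuous hcont
    exact ⟨C, hC⟩
  have hχ' : ∀ n x, fderiv ℝ (χ n) x e =
      1 / ((n : ℝ) + 1) * fderiv ℝ f ((1 / ((n : ℝ) + 1)) • x) e := by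
    intro n x
    have := fderiv_comp_smul (𝕜 := ℝ) (f := f) (x := x) (1 / ((n : ℝ) + 1))
    change fderiv ℝ (fun x => f ((1 / ((n : ℝ) + 1)) • x)) x e = _
    rw [this]
    simp
  have hC0 : 0 ≤ C := (abs_nonneg _).trans (hC 0)
  have key : ∀ n, ∫ x, u x * (χ n x * fderiv ℝ φ x e + φ x * fderiv ℝ (χ n) x e) =
      -∫ x, v x * (χ n x * φ x) := by
    intro n
    rw [← h (fun x => χ n x * φ x) ((hχ n).mul hφ) ((hχc n).mul_right)]
    refine integral_congr_ae (.of_forall fun x => ?_)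
    have d1 : DifferentiableAt ℝ (χ n) x := ((hχ n).differentiable (by simp)).differentiableAt
    have d2 : DifferentiableAt ℝ φ x := (hφ.differentiable (by simp)).differentiableAt
    simp only
    rw [fderiv_fun_mul d1 d2]
    simp [e]
  have cφ' : Continuous fun x => fderiv ℝ φ x e := (contDiff_partial hφ i).continuous
  have lim1 : Tendsto (fun n => ∫ x, u x * (χ n x * fderiv ℝ φ x e + φ x * fderiv ℝ (χ n) x e))
      atTop (𝓝 (∫ x, u x * fderiv ℝ φ x e)) := by
    refine tendsto_integral_of_dominated_convergence
      (fun x => |u x * fderiv ℝ φ x e| + C * |u x * φ x|) (fun n => ?_) ?_ (fun n => ?_) ?_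
    · refine hu.1.mul (Continuous.aestronglyMeasurable ?_)
      have := (hχ n).continuous
      have := (contDiff_partial (hχ n) i).continuous
      have := hφ.continuous
      fun_prop
    · exact (hu.integrable_mul h2).abs.add ((hu.integrable_mul h1).abs.const_mul C)
    · refine .of_forall fun x => ?_
      rw [Real.norm_eq_abs, mul_add]
      refine (abs_add_le _ _).trans (add_le_add ?_ ?_)
      · rw [show u x * (χ n x * fderiv ℝ φ x e) = χ n x * (u x * fderiv ℝ φ x e) by ring, abs_mul]
        exact mul_le_of_le_one_left (abs_nonneg _) (hχ1 n x)
      · rw [show u x * (φ x * fderiv ℝ (χ n) x e) = fderiv ℝ (χ n) x e * (u x * φ x) by ring,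
          abs_mul]
        refine mul_le_mul_of_nonneg_right ?_ (abs_nonneg _)
        rw [hχ', abs_mul, abs_of_nonneg (by positivity : (0 : ℝ) ≤ 1 / ((n : ℝ) + 1))]
        have : 1 / ((n : ℝ) + 1) ≤ 1 := by
          rw [div_le_one (by positivity)]; linarith [n.cast_nonneg (α := ℝ)]
        calc _ ≤ 1 * C := mul_le_mul this (hC _) (abs_nonneg _) zero_le_one
          _ = C := one_mul C
    · refine .of_forall fun x => ?_
      have t1 : Tendsto (fun n => χ n x) atTop (𝓝 1) :=
        tendsto_const_nhds.congr' ((hχlim x).mono fun n hn => hn.symm)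
      have t2 : Tendsto (fun n => fderiv ℝ (χ n) x e) atTop (𝓝 0) := by
        refine squeeze_zero_norm (a := fun n : ℕ => 1 / ((n : ℝ) + 1) * C) (fun n => ?_) ?_
        · rw [hχ', Real.norm_eq_abs, abs_mul, abs_of_nonneg (by positivity : (0 : ℝ) ≤ 1 / ((n : ℝ) + 1))]
          exact mul_le_mul_of_nonneg_left (hC _) (by positivity)
        · simpa using (tendsto_one_div_add_atTop_nhds_zero_nat (𝕜 := ℝ)).mul_const C
      have := (tendsto_const_nhds (x := u x)).mul
        ((t1.mul_const (fderiv ℝ φ x e)).add (t2.const_mul (φ x)))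
      simpa using this
  have lim2 : Tendsto (fun n => -∫ x, v x * (χ n x * φ x)) atTop (𝓝 (-∫ x, v x * φ x)) := by
    refine Tendsto.neg (tendsto_integral_of_dominated_convergence
      (fun x => |v x * φ x|) (fun n => ?_) ?_ (fun n => ?_) ?_)
    · refine hv.1.mul (Continuous.aestronglyMeasurable ?_)
      have := (hχ n).continuous
      have := hφ.continuous
      fun_prop
    · exact (hv.integrable_mul h1).abs
    · refine .of_forall fun x => ?_
      rw [Real.norm_eq_abs, show v x * (χ n x * φ x) = χ n x * (v x * φ x) by ring, abs_mul]
      exact mul_le_of_le_one_left (abs_nonneg _) (hχ1 n x)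
    · refine .of_forall fun x => ?_
      have t1 : Tendsto (fun n => χ n x) atTop (𝓝 1) :=
        tendsto_const_nhds.congr' ((hχlim x).mono fun n hn => hn.symm)
      simpa using (tendsto_const_nhds (x := v x)).mul (t1.mul_const (φ x))
  refine tendsto_nhds_unique lim1 (lim2.congr fun n => (key n).symm)

theorem inner_single_one (ξ : Space K L) (i : Fin K ⊕ Fin L) :
    ⟪ξ, EuclideanSpace.single i (1 : ℝ)⟫ = ξ i := by
  simp [EuclideanSpace.inner_single_right]

theorem fourier_partial_ae (φ : SchwartzMap (Space K L) ℂ) (i : Fin K ⊕ Fin L) (ξ : Space K L) :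
    (𝓕 (LineDeriv.lineDerivOp (EuclideanSpace.single i (1 : ℝ)) φ)) ξ =
      (2 * Real.pi * Complex.I) * (ξ i * (𝓕 φ) ξ) := by
  rw [SchwartzMap.fourier_lineDerivOp_eq, smul_apply, smul_eq_mul]
  congr 1
  rw [SchwartzMap.smulLeftCLM_apply_apply (by fun_prop)]
  rw [inner_single_one]
  simp

theorem integral_conj_mul_schwartz (f : L2C (Space K L)) (ψ : SchwartzMap (Space K L) ℂ) :
    ∫ x, conj (f x) * ψ x = ∫ ξ, conj ((𝓕 f : L2C (Space K L)) ξ) * (𝓕 ψ) ξ := by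
  have e1 : inner ℂ (𝓕 f : L2C (Space K L)) ((𝓕 ψ).toLp 2 : L2C (Space K L)) =
      ∫ x, conj (f x) * ψ x := by
    rw [← SchwartzMap.toLp_fourier_eq, Lp.inner_fourier_eq, L2.inner_def]
    refine integral_congr_ae ?_
    filter_upwards [ψ.coeFn_toLp 2 volume] with x h2
    rw [h2]
    simp [mul_comm]
  rw [← e1, L2.inner_def]
  refine integral_congr_ae ?_
  filter_upwards [(𝓕 ψ).coeFn_toLp 2 volume] with x h2
  rw [h2]
  simp [mul_comm]

theorem integral_mul_schwartz {w : Space K L → ℝ} (hw : MemLp w 2)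
    (ψ : SchwartzMap (Space K L) ℂ) :
    ∫ x, (w x : ℂ) * ψ x = ∫ ξ, conj (ft w ξ) * (𝓕 ψ) ξ := by
  rw [ft_of_memLp hw, ← integral_conj_mul_schwartz]
  refine integral_congr_ae ?_
  filter_upwards [coeFn_toLp_ofReal hw] with x h1
  rw [h1, Complex.conj_ofReal]

/-- Parseval moves the derivative of the test function onto `û`. As `u` and the test function are
real, the real part of the resulting identity involves only `Re g`, so there is no need to show that
`g` is real. -/
theorem hasWeakPartial_re_of_fourier {i : Fin K ⊕ Fin L} {u : Space K L → ℝ}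
    (hu : MemLp u 2) (g : L2C (Space K L))
    (h : ∀ᵐ ξ, (𝓕 g : L2C (Space K L)) ξ = (2 * Real.pi * Complex.I) * (ξ i * ft u ξ)) :
    HasWeakPartial i u fun x => (g x).re := by
  intro φ hφ hφc
  have hφ' : ContDiff ℝ ∞ (fun x => (φ x : ℂ)) := Complex.ofRealCLM.contDiff.comp hφ
  have hφc' : HasCompactSupport (fun x => (φ x : ℂ)) := hφc.comp_left (g := Complex.ofReal) rfl
  set ψ : SchwartzMap (Space K L) ℂ := hφc'.toSchwartzMap hφ'
  have hψ : ∀ x, ψ x = φ x := fun x => rfl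
  have hdψ : ∀ x, LineDeriv.lineDerivOp (EuclideanSpace.single i (1 : ℝ)) ψ x =
      (fderiv ℝ φ x (EuclideanSpace.single i 1) : ℝ) := by
    intro x
    rw [show LineDeriv.lineDerivOp (EuclideanSpace.single i (1 : ℝ)) ψ x =
        fderiv ℝ ψ x (EuclideanSpace.single i 1) from SchwartzMap.lineDerivOp_apply_eq_fderiv _ ψ x]
    have := Complex.ofRealCLM.hasFDerivAt.comp x
      ((hφ.differentiable (by simp)).differentiableAt (x := x)).hasFDerivAt
    rw [show (ψ : Space K L → ℂ) = Complex.ofRealCLM ∘ φ from rfl, this.fderiv]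
    rfl
  have h3 := integral_mul_schwartz hu (LineDeriv.lineDerivOp (EuclideanSpace.single i (1 : ℝ)) ψ)
  have h4 := integral_conj_mul_schwartz g ψ
  simp_rw [fourier_partial_ae] at h3
  have h5 : ∫ ξ, conj (ft u ξ) * (2 * Real.pi * Complex.I * (ξ i * (𝓕 ψ) ξ)) =
      -∫ ξ, conj ((𝓕 g : L2C (Space K L)) ξ) * (𝓕 ψ) ξ := by
    rw [← integral_neg]
    refine integral_congr_ae ?_
    filter_upwards [h] with ξ hξ
    rw [hξ]
    simp only [map_mul, Complex.conj_I, Complex.conj_ofReal, Complex.conj_ofNat]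
    ring
  rw [h5, ← h4] at h3
  simp_rw [hdψ, hψ, ← Complex.ofReal_mul] at h3
  rw [integral_complex_ofReal] at h3
  have h6 := congrArg Complex.re h3
  have hint : Integrable fun x => conj (g x) * (φ x : ℂ) :=
    (Lp.memLp g).star.integrable_mul (show MemLp (fun x => (φ x : ℂ)) 2 volume from ψ.memLp 2 volume)
  have h7 : (∫ x, conj (g x) * (φ x : ℂ)).re = ∫ x, (conj (g x) * (φ x : ℂ)).re :=
    (integral_re hint).symm
  rw [Complex.ofReal_re, Complex.neg_re, h7] at h6
  simpa using h6

theorem HasWeakPartial.congr_right {i : Fin K ⊕ Fin L} {u v w : Space K L → ℝ}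
    (h : HasWeakPartial i u v) (hvw : v =ᵐ[volume] w) : HasWeakPartial i u w := by
  intro φ hφ hφc
  rw [h φ hφ hφc]
  congr 1
  refine integral_congr_ae ?_
  filter_upwards [hvw] with x hx
  rw [hx]

theorem hasWeakPartial_iff {i : Fin K ⊕ Fin L} {u v : Space K L → ℝ}
    (hu : MemLp u 2) (hv : MemLp v 2) : HasWeakPartial i u v ↔
      ∀ᵐ ξ, ft v ξ = (2 * Real.pi * Complex.I) * (ξ i * ft u ξ) := by
  have lineDeriv_eq : ∀ (ψ : SchwartzMap (Space K L) ℂ) x,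
      LineDeriv.lineDerivOp (EuclideanSpace.single i (1 : ℝ)) ψ x =
        fderiv ℝ ψ x (EuclideanSpace.single i 1) := fun ψ x =>
    SchwartzMap.lineDerivOp_apply_eq_fderiv _ ψ x
  constructor
  · intro h
    have h1 : ∀ ψ : SchwartzMap (Space K L) ℂ,
        ∫ x, (u x : ℂ) * LineDeriv.lineDerivOp (EuclideanSpace.single i (1 : ℝ)) ψ x =
          -∫ x, (v x : ℂ) * ψ x := by
      intro ψ
      set dψ := LineDeriv.lineDerivOp (EuclideanSpace.single i (1 : ℝ)) ψ with hdψ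
      have hψd : ∀ x, DifferentiableAt ℝ ψ x := fun x => ψ.differentiableAt
      have hmul : ∀ (w : Space K L → ℝ) (_ : MemLp w 2) (χ : SchwartzMap (Space K L) ℂ),
          Integrable fun x => (w x : ℂ) * χ x := fun w hw χ =>
        (memLp_ofReal hw).integrable_mul (χ.memLp 2)
      have dre : ∀ x, fderiv ℝ (fun x => (ψ x).re) x (EuclideanSpace.single i 1) = (dψ x).re := by
        intro x
        rw [hdψ, lineDeriv_eq]
        have := Complex.reCLM.hasFDerivAt.comp x (hψd x).hasFDerivAt
        rw [show (fun x => (ψ x).re) = Complex.reCLM ∘ ψ from rfl, this.fderiv]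
        rfl
      have dim : ∀ x, fderiv ℝ (fun x => (ψ x).im) x (EuclideanSpace.single i 1) = (dψ x).im := by
        intro x
        rw [hdψ, lineDeriv_eq]
        have := Complex.imCLM.hasFDerivAt.comp x (hψd x).hasFDerivAt
        rw [show (fun x => (ψ x).im) = Complex.imCLM ∘ ψ from rfl, this.fderiv]
        rfl
      have hre := h.integral_eq hu hv (φ := fun x => (ψ x).re)
        (Complex.reCLM.contDiff.comp (ψ.smooth ⊤)) (ψ.memLp 2).re
        (by simp_rw [dre]; exact (dψ.memLp 2).re)
      have him := h.integral_eq hu hv (φ := fun x => (ψ x).im)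
        (Complex.imCLM.contDiff.comp (ψ.smooth ⊤)) (ψ.memLp 2).im
        (by simp_rw [dim]; exact (dψ.memLp 2).im)
      simp_rw [dre] at hre
      simp_rw [dim] at him
      have re_int : ∀ F : Space K L → ℂ, Integrable F → (∫ x, F x).re = ∫ x, (F x).re :=
        fun F hF => (integral_re hF).symm
      have im_int : ∀ F : Space K L → ℂ, Integrable F → (∫ x, F x).im = ∫ x, (F x).im :=
        fun F hF => (integral_im hF).symm
      apply Complex.ext
      · rw [Complex.neg_re, re_int _ (hmul u hu dψ), re_int _ (hmul v hv ψ)]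
        simpa using hre
      · rw [Complex.neg_im, im_int _ (hmul u hu dψ), im_int _ (hmul v hv ψ)]
        simpa using him
    have h2 : ∀ᵐ ξ : Space K L,
        conj (ft u ξ) * ((2 * Real.pi * Complex.I) * ξ i) + conj (ft v ξ) = 0 := by
      have l1 : LocallyIntegrable (fun ξ : Space K L =>
          conj (ft u ξ) * ((2 * Real.pi * Complex.I) * ξ i)) := by
        have hcu : LocallyIntegrable (fun ξ : Space K L => conj (ft u ξ)) :=
          (Lp.memLp (ft u)).star.locallyIntegrable (by norm_num)
        have := hcu.continuous_smul (𝕜 := ℂ)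
          (g := fun ξ : Space K L => (2 * Real.pi * Complex.I) * (ξ i : ℂ)) (by fun_prop)
        refine this.congr (.of_forall fun ξ => ?_)
        simp only [smul_eq_mul, mul_comm]
      have l2 : LocallyIntegrable (fun ξ : Space K L => conj (ft v ξ)) :=
        (Lp.memLp (ft v)).star.locallyIntegrable (by norm_num)
      refine ae_eq_zero_of_integral_contDiff_smul_eq_zero (l1.add l2) fun φ hφ hφc => ?_
      have hφ' : ContDiff ℝ ∞ (fun x => (φ x : ℂ)) := Complex.ofRealCLM.contDiff.comp hφ
      have hφc' : HasCompactSupport (fun x => (φ x : ℂ)) :=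
        hφc.comp_left (g := Complex.ofReal) rfl
      set χ : SchwartzMap (Space K L) ℂ := hφc'.toSchwartzMap hφ'
      -- Testing with `𝓕⁻ χ` puts the arbitrary bump function `χ` on the frequency side, where the
      -- fundamental lemma of the calculus of variations applies.
      have hχ : 𝓕 (𝓕⁻ χ) = χ := FourierTransform.fourier_fourierInv_eq χ
      have h3 := h1 (𝓕⁻ χ)
      rw [integral_mul_schwartz hu, integral_mul_schwartz hv, hχ] at h3
      simp_rw [fourier_partial_ae, hχ] at h3
      have i1 : Integrable fun ξ => φ ξ • (conj (ft u ξ) * ((2 * Real.pi * Complex.I) * ξ i)) :=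
        l1.integrable_smul_left_of_hasCompactSupport hφ.continuous hφc
      have i2 : Integrable fun ξ => φ ξ • conj (ft v ξ) :=
        l2.integrable_smul_left_of_hasCompactSupport hφ.continuous hφc
      simp_rw [smul_add]
      rw [integral_add i1 i2, ← sub_neg_eq_add, sub_eq_zero]
      convert h3 using 1
      · refine integral_congr_ae (.of_forall fun ξ => ?_)
        change φ ξ • _ = conj (ft u ξ) * (2 * Real.pi * Complex.I * (ξ i * (φ ξ : ℂ)))
        rw [Complex.real_smul]
        ring
      · congr 1
        refine integral_congr_ae (.of_forall fun ξ => ?_)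
        change φ ξ • _ = conj (ft v ξ) * (φ ξ : ℂ)
        rw [Complex.real_smul]
        ring
    filter_upwards [h2] with ξ hξ
    have := congrArg conj hξ
    simp only [map_add, map_mul, Complex.conj_conj, Complex.conj_I, Complex.conj_ofReal,
      map_zero, Complex.conj_ofNat] at this
    linear_combination this
  · intro h
    refine (hasWeakPartial_re_of_fourier hu ((memLp_ofReal hv).toLp : L2C (Space K L))
      (by rwa [← ft_of_memLp hv])).congr_right ?_
    filter_upwards [coeFn_toLp_ofReal hv] with x hx
    rw [hx, Complex.ofReal_re]

/-- By Parseval this is the antisymmetry of the multiplier `2πi ξᵢ`: conjugation changes its sign.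
-/
theorem integral_mul_partial {i : Fin K ⊕ Fin L} {f g f' g' : Space K L → ℝ}
    (hf : MemLp f 2) (hg : MemLp g 2) (hf' : MemLp f' 2) (hg' : MemLp g' 2)
    (h1 : HasWeakPartial i f f') (h2 : HasWeakPartial i g g') :
    ∫ x, f x * g' x = -∫ x, f' x * g x := by
  rw [hasWeakPartial_iff hf hf'] at h1
  rw [hasWeakPartial_iff hg hg'] at h2
  apply Complex.ofReal_injective
  rw [← inner_ft hf hg', Complex.ofReal_neg, ← inner_ft hf' hg, L2.inner_def, L2.inner_def,
    ← integral_neg]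
  refine integral_congr_ae ?_
  filter_upwards [h1, h2] with ξ e1 e2
  rw [e1, e2]
  simp only [RCLike.inner_apply, map_mul, Complex.conj_I, Complex.conj_ofReal, Complex.conj_ofNat]
  ring

end WeakDerivatives

end SingularPolyharmonic

namespace SingularPolyharmonic

open FourierTransform RealInnerProductSpace ComplexConjugate

/-! ### Sobolev spaces and the operators `∇^m` on the Fourier side. -/

section Sobolev

variable {K L : ℕ}

theorem memLp_norm_pow_mul_of_le {F : L2C (Space K L)} {k : ℕ} {g : Space K L → ℝ}
    (hg : MemLp g 2) (h : ∀ᵐ ξ, ‖ξ‖ ^ k * ‖F ξ‖ ≤ g ξ) :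
    MemLp (fun ξ => ‖ξ‖ ^ k • F ξ) 2 := by
  refine hg.of_le ?_ ?_
  · have : Continuous fun ξ : Space K L => ‖ξ‖ ^ k := by fun_prop
    exact this.aestronglyMeasurable.smul (Lp.memLp F).1
  · filter_upwards [h] with ξ hξ
    rw [norm_smul, norm_pow, norm_norm]
    exact hξ.trans (le_abs_self _)

theorem pow_le_one_add_pow {r : ℝ} (hr : 0 ≤ r) {k m : ℕ} (h : k ≤ m) : r ^ k ≤ 1 + r ^ m := by
  rcases le_total r 1 with h1 | h1
  · have := pow_le_one₀ (n := k) hr h1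
    have := pow_nonneg hr m
    linarith
  · have := pow_le_pow_right₀ h1 h
    linarith

theorem memLp_norm_pow_smul_mono {F : L2C (Space K L)} {k m : ℕ} (hkm : k ≤ m)
    (h : MemLp (fun ξ => ‖ξ‖ ^ m • F ξ) 2) : MemLp (fun ξ => ‖ξ‖ ^ k • F ξ) 2 := by
  refine memLp_norm_pow_mul_of_le ((Lp.memLp F).norm.add h.norm) (.of_forall fun ξ => ?_)
  have := mul_le_mul_of_nonneg_right (pow_le_one_add_pow (norm_nonneg ξ) hkm) (norm_nonneg (F ξ))
  simp only [Pi.add_apply, norm_smul, norm_pow, norm_norm]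
  linarith

theorem norm_coord_le (ξ : Space K L) (i : Fin K ⊕ Fin L) : |ξ i| ≤ ‖ξ‖ := by
  simpa using PiLp.norm_apply_le ξ i

theorem norm_le_sum_coord (ξ : Space K L) : ‖ξ‖ ≤ ∑ i, |ξ i| := by
  rw [EuclideanSpace.norm_eq]
  refine Real.sqrt_le_iff.2 ⟨Finset.sum_nonneg fun _ _ => abs_nonneg _, ?_⟩
  simp only [Real.norm_eq_abs]
  exact Finset.sum_sq_le_sq_sum_of_nonneg fun _ _ => abs_nonneg _

theorem norm_two_pi_I_mul (ξ : Space K L) (i : Fin K ⊕ Fin L) (z : ℂ) :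
    ‖(2 * Real.pi * Complex.I) * (ξ i * z)‖ = 2 * Real.pi * (|ξ i| * ‖z‖) := by
  simp [abs_of_pos Real.pi_pos]

theorem exists_weakPartial_of_memLp {u : Space K L → ℝ} (hu : MemLp u 2)
    (h : MemLp (fun ξ => ‖ξ‖ ^ 1 • ft u ξ) 2) (i : Fin K ⊕ Fin L) :
    ∃ v, MemLp v 2 ∧ HasWeakPartial i u v := by
  have hF : MemLp (fun ξ => (2 * Real.pi * Complex.I) * (ξ i * ft u ξ)) 2 := by
    refine (h.norm.const_mul (2 * Real.pi)).of_le ?_ (.of_forall fun ξ => ?_)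
    · have : Continuous fun ξ : Space K L => (ξ i : ℂ) := by fun_prop
      exact (this.aestronglyMeasurable.mul (Lp.memLp (ft u)).1).const_mul _
    · rw [norm_two_pi_I_mul, Real.norm_of_nonneg (by positivity), norm_smul, pow_one, norm_norm]
      gcongr
      exact norm_coord_le ξ i
  set g : L2C (Space K L) := 𝓕⁻ (hF.toLp : L2C (Space K L))
  refine ⟨fun x => (g x).re, (Lp.memLp g).re, hasWeakPartial_re_of_fourier hu g ?_⟩
  rw [FourierTransform.fourier_fourierInv_eq]
  exact hF.coeFn_toLp

/-- Induction on the order, with `|ξ| ≤ ∑ |ξᵢ|` in one direction and `|ξᵢ| ≤ |ξ|` in the other.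
Intermediate powers of `|ξ|` are controlled by `1 + |ξ|^m`. -/
theorem memSob_iff {m : ℕ} {u : Space K L → ℝ} :
    MemSob m u ↔ MemLp u 2 ∧ MemLp (fun ξ => ‖ξ‖ ^ m • ft u ξ) 2 := by
  induction m generalizing u with
  | zero => simpa [MemSob] using fun _ => Lp.memLp (ft u)
  | succ m ih =>
    simp only [MemSob]
    constructor
    · rintro ⟨hu, h⟩
      refine ⟨hu, ?_⟩
      choose v hv hw using h
      have hv2 : ∀ i, MemLp (v i) 2 := fun i => (ih.1 (hv i)).1
      have hsum : MemLp (fun ξ => ∑ i, ‖‖ξ‖ ^ m • ft (v i) ξ‖) 2 :=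
        memLp_finsetSum _ fun i _ => ((ih.1 (hv i)).2).norm
      refine memLp_norm_pow_mul_of_le hsum ?_
      have hall := ae_all_iff.2 fun i => (hasWeakPartial_iff hu (hv2 i)).1 (hw i)
      filter_upwards [hall] with ξ hξ
      simp_rw [hξ, norm_smul, norm_two_pi_I_mul, norm_pow, norm_norm]
      have h1 : ‖ξ‖ ^ (m + 1) * ‖ft u ξ‖ ≤ ∑ i, ‖ξ‖ ^ m * (|ξ i| * ‖ft u ξ‖) := by
        rw [← Finset.mul_sum, ← Finset.sum_mul, pow_succ, mul_assoc]
        gcongr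
        exact norm_le_sum_coord ξ
      refine h1.trans (Finset.sum_le_sum fun i _ => mul_le_mul_of_nonneg_left ?_ (by positivity))
      have : 1 ≤ 2 * Real.pi := by linarith [Real.pi_gt_three]
      exact le_mul_of_one_le_left (by positivity) this
    · rintro ⟨hu, h⟩
      refine ⟨hu, fun i => ?_⟩
      obtain ⟨v, hv, hw⟩ := exists_weakPartial_of_memLp hu
        (memLp_norm_pow_smul_mono (by omega) h) i
      refine ⟨v, ih.2 ⟨hv, ?_⟩, hw⟩
      refine memLp_norm_pow_mul_of_le (h.norm.const_mul (2 * Real.pi)) ?_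
      filter_upwards [(hasWeakPartial_iff hu hv).1 hw] with ξ hξ
      rw [hξ, norm_two_pi_I_mul, norm_smul, norm_pow, norm_norm, pow_succ]
      have := mul_le_mul_of_nonneg_left (norm_coord_le ξ i)
        (by positivity : 0 ≤ ‖ξ‖ ^ m * (2 * Real.pi * ‖ft u ξ‖))
      linarith

theorem MemSob.memLp {m : ℕ} {u : Space K L → ℝ} (h : MemSob m u) : MemLp u 2 :=
  (memSob_iff.1 h).1

theorem MemSob.mono {k m : ℕ} (hkm : k ≤ m) {u : Space K L → ℝ} (h : MemSob m u) : MemSob k u :=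
  memSob_iff.2 ⟨h.memLp, memLp_norm_pow_smul_mono hkm (memSob_iff.1 h).2⟩

theorem weakPartial_spec {m : ℕ} {u : Space K L → ℝ} (h : MemSob (m + 1) u)
    (i : Fin K ⊕ Fin L) : MemLp (weakPartial i u) 2 ∧ HasWeakPartial i u (weakPartial i u) := by
  have hex := exists_weakPartial_of_memLp h.memLp
    (memSob_iff.1 (h.mono (show 1 ≤ m + 1 by omega))).2 i
  rw [weakPartial, dif_pos hex]
  exact hex.choose_spec

theorem ft_weakPartial {m : ℕ} {u : Space K L → ℝ} (h : MemSob (m + 1) u) (i : Fin K ⊕ Fin L) :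
    ∀ᵐ ξ, ft (weakPartial i u) ξ = (2 * Real.pi * Complex.I) * (ξ i * ft u ξ) :=
  (hasWeakPartial_iff h.memLp (weakPartial_spec h i).1).1 (weakPartial_spec h i).2

theorem MemSob.weakPartial {m : ℕ} {u : Space K L → ℝ} (h : MemSob (m + 1) u)
    (i : Fin K ⊕ Fin L) : MemSob m (weakPartial i u) := by
  refine memSob_iff.2 ⟨(weakPartial_spec h i).1, ?_⟩
  refine memLp_norm_pow_mul_of_le ((memSob_iff.1 h).2.norm.const_mul (2 * Real.pi)) ?_
  filter_upwards [ft_weakPartial h i] with ξ hξ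
  rw [hξ, norm_two_pi_I_mul, norm_smul, norm_pow, norm_norm, pow_succ]
  have := mul_le_mul_of_nonneg_left (norm_coord_le ξ i)
    (by positivity : 0 ≤ ‖ξ‖ ^ m * (2 * Real.pi * ‖ft u ξ‖))
  linarith

theorem ft_sum {ι : Type*} (s : Finset ι) {u : ι → Space K L → ℝ} (h : ∀ i, MemLp (u i) 2) :
    ft (fun x => ∑ i ∈ s, u i x) = ∑ i ∈ s, ft (u i) := by
  classical
  induction s using Finset.induction_on with
  | empty =>
    have := ft_smul 0 (MemLp.zero (p := 2) (μ := volume) (α := Space K L) (ε := ℝ))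
    simpa [Pi.zero_def] using this
  | insert a s ha ih =>
    rw [Finset.sum_insert ha, ← ih, ← ft_add (h a) (memLp_finsetSum s fun i _ => h i)]
    congr 1
    ext x
    simp [Finset.sum_insert ha]

theorem sum_coord_sq (ξ : Space K L) : ∑ i, (ξ i) ^ 2 = ‖ξ‖ ^ 2 := by
  rw [EuclideanSpace.norm_sq_eq]
  simp

theorem weakLaplacian_memLp {m : ℕ} {u : Space K L → ℝ} (h : MemSob (m + 2) u) :
    MemLp (weakLaplacian u) 2 :=
  memLp_finsetSum _ fun i _ => ((h.weakPartial i).weakPartial i).memLp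

theorem ft_weakLaplacian {m : ℕ} {u : Space K L → ℝ} (h : MemSob (m + 2) u) :
    ∀ᵐ ξ, ft (weakLaplacian u) ξ = -((2 * Real.pi * ‖ξ‖ : ℝ) : ℂ) ^ 2 * ft u ξ := by
  have e : ft (weakLaplacian u) = ∑ i, ft (weakPartial i (weakPartial i u)) :=
    ft_sum Finset.univ fun i => ((h.weakPartial i).weakPartial i).memLp
  rw [e]
  have h1 := ae_all_iff.2 fun i => ft_weakPartial h i
  have h2 := ae_all_iff.2 fun i => ft_weakPartial (h.weakPartial i) i
  filter_upwards [h1, h2, Lp.coeFn_finsetSum Finset.univ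
    (fun i => ft (weakPartial i (weakPartial i u)))] with ξ e1 e2 e3
  rw [e3, Finset.sum_apply]
  simp_rw [e2, e1]
  have : ((‖ξ‖ : ℝ) : ℂ) ^ 2 = ∑ i, (ξ i : ℂ) ^ 2 := by
    rw [← Complex.ofReal_pow, ← sum_coord_sq]
    push_cast
    rfl
  push_cast
  rw [mul_pow, this, Finset.mul_sum, ← Finset.sum_neg_distrib, Finset.sum_mul]
  refine Finset.sum_congr rfl fun i _ => ?_
  linear_combination (4 * Real.pi ^ 2 * (ξ i) ^ 2 * ft u ξ : ℂ) * Complex.I_sq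

theorem MemSob.weakLaplacian {m : ℕ} {u : Space K L → ℝ} (h : MemSob (m + 2) u) :
    MemSob m (weakLaplacian u) := by
  refine memSob_iff.2 ⟨weakLaplacian_memLp h, ?_⟩
  refine memLp_norm_pow_mul_of_le
    ((memSob_iff.1 h).2.norm.const_mul ((2 * Real.pi) ^ 2)) ?_
  filter_upwards [ft_weakLaplacian h] with ξ hξ
  rw [hξ, norm_smul, norm_pow, norm_norm, norm_mul, norm_neg, norm_pow, Complex.norm_real,
    Real.norm_of_nonneg (by positivity)]
  refine le_of_eq ?_
  ring

theorem nablaPowSq_zero (u : Space K L → ℝ) : nablaPowSq 0 u = fun x => u x ^ 2 := by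
  ext x
  simp [nablaPowSq]

theorem nablaPowSq_one (u : Space K L → ℝ) :
    nablaPowSq 1 u = fun x => ∑ i, weakPartial i u x ^ 2 := by
  ext x
  simp [nablaPowSq]

theorem nablaPowSq_add_two (m : ℕ) (u : Space K L → ℝ) :
    nablaPowSq (m + 2) u = nablaPowSq m (weakLaplacian u) := by
  ext x
  simp only [nablaPowSq]
  rw [show (m + 2) / 2 = m / 2 + 1 by omega]
  simp only [Function.iterate_succ_apply]
  simp [Nat.even_add]

/-- Two-step induction: each Laplacian contributes the symbol `-(2π|ξ|)²`, and a last gradient, if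
`m` is odd, contributes `2π|ξ|` after summing over directions. -/
theorem integral_nablaPowSq {m : ℕ} {u : Space K L → ℝ} (h : MemSob m u) :
    ∫ x, nablaPowSq m u x = ∫ ξ, ((2 * Real.pi * ‖ξ‖) ^ m * ‖ft u ξ‖) ^ 2 := by
  induction m using Nat.twoStepInduction generalizing u with
  | zero =>
    simp only [nablaPowSq_zero, pow_zero, one_mul]
    rw [← norm_ft_sq h, L2C.norm_sq]
  | one =>
    simp only [nablaPowSq_one, pow_one]
    have hp : ∀ i, MemLp (weakPartial i u) 2 := fun i => (weakPartial_spec h i).1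
    rw [integral_finsetSum _ fun i _ => (hp i).integrable_sq]
    simp_rw [← norm_ft_sq (hp _), L2C.norm_sq]
    rw [← integral_finsetSum _ fun i _ => L2C.integrable_norm_sq _]
    refine integral_congr_ae ?_
    filter_upwards [ae_all_iff.2 fun i => ft_weakPartial h i] with ξ hξ
    simp_rw [hξ, norm_two_pi_I_mul, mul_pow, sq_abs, ← sum_coord_sq ξ, Finset.mul_sum,
      Finset.sum_mul]
    exact Finset.sum_congr rfl fun i _ => by ring
  | more m ih _ =>
    rw [nablaPowSq_add_two, ih h.weakLaplacian]
    refine integral_congr_ae ?_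
    filter_upwards [ft_weakLaplacian h] with ξ hξ
    rw [hξ, norm_mul, norm_neg, norm_pow, Complex.norm_real, Real.norm_of_nonneg (by positivity)]
    ring

end Sobolev

end SingularPolyharmonic

namespace SingularPolyharmonic

/-! ### The Hardy–Rellich inequality with weight in `y`. -/

section Hardy

variable {K L : ℕ}

theorem MemLp.bdd_mul_real {g v : Space K L → ℝ} (hv : MemLp v 2) (hg : Continuous g) {C : ℝ}
    (hC : ∀ x, |g x| ≤ C) : MemLp (fun x => g x * v x) 2 := by
  refine (hv.const_mul C).of_le (hg.aestronglyMeasurable.mul hv.1) (.of_forall fun x => ?_)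
  have hC0 : 0 ≤ C := (abs_nonneg _).trans (hC 0)
  rw [norm_mul, norm_mul, Real.norm_of_nonneg hC0]
  exact mul_le_mul_of_nonneg_right (hC x) (norm_nonneg _)

/-- A smooth bounded function `g` with bounded partial derivative `g'` in direction `i`. -/
structure IsBddWeight (i : Fin K ⊕ Fin L) (g g' : Space K L → ℝ) : Prop where
  smooth : ContDiff ℝ ∞ g
  bdd : ∃ C, ∀ x, |g x| ≤ C
  bdd' : ∃ C, ∀ x, |g' x| ≤ C
  fderiv_eq : ∀ x, fderiv ℝ g x (EuclideanSpace.single i 1) = g' x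

theorem IsBddWeight.continuous' {i : Fin K ⊕ Fin L} {g g' : Space K L → ℝ}
    (h : IsBddWeight i g g') : Continuous g' := by
  have := (contDiff_partial h.smooth i).continuous
  simpa only [h.fderiv_eq] using this

theorem IsBddWeight.memLp {i : Fin K ⊕ Fin L} {g g' : Space K L → ℝ}
    (h : IsBddWeight i g g') {v : Space K L → ℝ} (hv : MemLp v 2) :
    MemLp (fun x => g x * v x) 2 := by
  obtain ⟨C, hC⟩ := h.bdd
  exact MemLp.bdd_mul_real hv h.smooth.continuous hC

theorem IsBddWeight.memLp' {i : Fin K ⊕ Fin L} {g g' : Space K L → ℝ}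
    (h : IsBddWeight i g g') {v : Space K L → ℝ} (hv : MemLp v 2) :
    MemLp (fun x => g' x * v x) 2 := by
  obtain ⟨C, hC⟩ := h.bdd'
  exact MemLp.bdd_mul_real hv h.continuous' hC

theorem IsBddWeight.hasWeakPartial {i : Fin K ⊕ Fin L} {g g' : Space K L → ℝ}
    (h : IsBddWeight i g g') {v v' : Space K L → ℝ} (hv : MemLp v 2) (hv' : MemLp v' 2)
    (hw : HasWeakPartial i v v') :
    HasWeakPartial i (fun x => g x * v x) fun x => g' x * v x + g x * v' x := by
  intro φ hφ hφc
  have key := hw (fun x => g x * φ x) (h.smooth.mul hφ) hφc.mul_left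
  have hd : ∀ x, fderiv ℝ (fun x => g x * φ x) x (EuclideanSpace.single i 1) =
      g x * fderiv ℝ φ x (EuclideanSpace.single i 1) + φ x * g' x := by
    intro x
    have d1 : DifferentiableAt ℝ g x := (h.smooth.differentiable (by simp)).differentiableAt
    have d2 : DifferentiableAt ℝ φ x := (hφ.differentiable (by simp)).differentiableAt
    rw [fderiv_fun_mul d1 d2]
    simp [h.fderiv_eq]
  simp_rw [hd] at key
  have hφ2 : MemLp φ 2 := hφ.continuous.memLp_of_hasCompactSupport hφc
  have hφ'2 : MemLp (fun x => fderiv ℝ φ x (EuclideanSpace.single i 1)) 2 :=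
    (contDiff_partial hφ i).continuous.memLp_of_hasCompactSupport (hφc.fderiv_apply (𝕜 := ℝ) _)
  have i1 : Integrable fun x => g x * v x * fderiv ℝ φ x (EuclideanSpace.single i 1) :=
    (h.memLp hv).integrable_mul hφ'2
  have i2 : Integrable fun x => g' x * v x * φ x := (h.memLp' hv).integrable_mul hφ2
  have i3 : Integrable fun x => g x * v' x * φ x := (h.memLp hv').integrable_mul hφ2
  have e1 : ∫ x, v x * (g x * fderiv ℝ φ x (EuclideanSpace.single i 1) + φ x * g' x) =
      (∫ x, g x * v x * fderiv ℝ φ x (EuclideanSpace.single i 1)) + ∫ x, g' x * v x * φ x := by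
    rw [← integral_add i1 i2]
    exact integral_congr_ae (.of_forall fun x => by ring)
  have e2 : ∫ x, (g' x * v x + g x * v' x) * φ x =
      (∫ x, g' x * v x * φ x) + ∫ x, v' x * (g x * φ x) := by
    have i3' : Integrable fun x => v' x * (g x * φ x) :=
      i3.congr (.of_forall fun x => by ring)
    rw [← integral_add i2 i3']
    exact integral_congr_ae (.of_forall fun x => by ring)
  rw [e2]
  linarith

theorem IsBddWeight.integral_mul_partial {i : Fin K ⊕ Fin L} {g g' : Space K L → ℝ}
    (h : IsBddWeight i g g') {v v' w w' : Space K L → ℝ} (hv : MemLp v 2) (hv' : MemLp v' 2)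
    (hvp : HasWeakPartial i v v') (hw : MemLp w 2) (hw' : MemLp w' 2)
    (hwp : HasWeakPartial i w w') :
    ∫ x, g x * v x * w' x = -(∫ x, g' x * (v x * w x)) - ∫ x, g x * (v' x * w x) := by
  rw [SingularPolyharmonic.integral_mul_partial (h.memLp hv) hw
    ((h.memLp' hv).add (h.memLp hv')) hw' (h.hasWeakPartial hv hv' hvp) hwp, ← neg_add',
    neg_inj, ← integral_add]
  · exact integral_congr_ae (.of_forall fun x => by simp only [Pi.add_apply]; ring)
  · exact ((h.memLp' hv).integrable_mul hw).congr (.of_forall fun x => by simp [mul_assoc])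
  · exact ((h.memLp hv').integrable_mul hw).congr (.of_forall fun x => by simp [mul_assoc])

/-- The `i`-th coordinate of `(y, 0)`. -/
def yCoord (i : Fin K ⊕ Fin L) (x : Space K L) : ℝ := Sum.elim (fun j => x (Sum.inl j)) 0 i

/-- `1` if `i` is one of the coordinates of `y`, and `0` otherwise. -/
def isYCoord (i : Fin K ⊕ Fin L) : ℝ := Sum.elim (fun _ => 1) (fun _ => 0) i

/-- The weight `1 / (|y|² + ε)`. -/
noncomputable def regWeight (ε : ℝ) (x : Space K L) : ℝ := (‖yPart x‖ ^ 2 + ε)⁻¹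

theorem norm_yPart_sq (x : Space K L) : ‖yPart x‖ ^ 2 = ∑ i, yCoord i x ^ 2 := by
  rw [EuclideanSpace.norm_sq_eq, Fintype.sum_sum_type]
  simp [yCoord, yPart]

theorem contDiff_yCoord (i : Fin K ⊕ Fin L) : ContDiff ℝ ∞ (yCoord (K := K) (L := L) i) := by
  rcases i with j | j
  · exact (EuclideanSpace.proj (𝕜 := ℝ) (Sum.inl j : Fin K ⊕ Fin L)).contDiff
  · exact contDiff_const

theorem fderiv_yCoord (i : Fin K ⊕ Fin L) (x : Space K L) (k : Fin K ⊕ Fin L) :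
    fderiv ℝ (yCoord i) x (EuclideanSpace.single k 1) = if i = k then isYCoord i else 0 := by
  rcases i with j | j
  · have : HasFDerivAt (yCoord (Sum.inl j))
        (EuclideanSpace.proj (𝕜 := ℝ) (Sum.inl j : Fin K ⊕ Fin L)) x :=
      (EuclideanSpace.proj (𝕜 := ℝ) (Sum.inl j : Fin K ⊕ Fin L)).hasFDerivAt
    rw [this.fderiv]
    simp [isYCoord]
  · have : HasFDerivAt (yCoord (Sum.inr j)) (0 : Space K L →L[ℝ] ℝ) x := hasFDerivAt_const _ _
    rw [this.fderiv]
    simp [isYCoord]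

theorem regWeight_eq (ε : ℝ) : regWeight (K := K) (L := L) ε =
    fun x => (∑ i, yCoord i x ^ 2 + ε)⁻¹ := by
  ext x
  rw [regWeight, norm_yPart_sq]

theorem regWeight_pos {ε : ℝ} (hε : 0 < ε) (x : Space K L) : 0 < regWeight ε x := by
  rw [regWeight]
  positivity

theorem contDiff_regWeight {ε : ℝ} (hε : 0 < ε) : ContDiff ℝ ∞ (regWeight (K := K) (L := L) ε) := by
  rw [regWeight_eq]
  refine ContDiff.inv ((ContDiff.sum fun i _ => (contDiff_yCoord i).pow 2).add contDiff_const)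
    fun x => ?_
  have : 0 ≤ ∑ i, yCoord i x ^ 2 := Finset.sum_nonneg fun i _ => sq_nonneg _
  positivity

theorem fderiv_regWeight {ε : ℝ} (hε : 0 < ε) (x : Space K L) (i : Fin K ⊕ Fin L) :
    fderiv ℝ (regWeight ε) x (EuclideanSpace.single i 1) =
      -2 * regWeight ε x ^ 2 * yCoord i x := by
  have hd : ∀ k, HasFDerivAt (yCoord k) (fderiv ℝ (yCoord k) x) x := fun k =>
    ((contDiff_yCoord k).differentiable (by simp)).differentiableAt.hasFDerivAt
  have hs : HasFDerivAt (fun x : Space K L => ∑ k, yCoord k x ^ 2 + ε)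
      (∑ k, (2 • yCoord k x ^ (2 - 1)) • fderiv ℝ (yCoord k) x) x :=
    (HasFDerivAt.fun_sum fun k _ => (hd k).pow 2).add_const ε
  have hne : ∑ k, yCoord k x ^ 2 + ε ≠ 0 := by
    rw [← norm_yPart_sq]
    positivity
  have hinv := (hasDerivAt_inv hne).comp_hasFDerivAt x hs
  rw [regWeight_eq]
  change fderiv ℝ ((fun s : ℝ => s⁻¹) ∘ fun x : Space K L => ∑ k, yCoord k x ^ 2 + ε) x _ = _
  rw [hinv.fderiv]
  simp only [smul_apply, sum_apply, fderiv_yCoord]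
  rcases i with j | j
  · simp [yCoord, isYCoord]
    field_simp
  · simp [yCoord, isYCoord]

theorem regWeight_le {ε : ℝ} (hε : 0 < ε) (x : Space K L) : regWeight ε x ≤ ε⁻¹ := by
  rw [regWeight]
  apply inv_anti₀ hε
  nlinarith [sq_nonneg ‖yPart x‖]

theorem norm_yPart_sq_mul_regWeight {ε : ℝ} (hε : 0 < ε) (x : Space K L) :
    ‖yPart x‖ ^ 2 * regWeight ε x = 1 - ε * regWeight ε x := by
  have : ‖yPart x‖ ^ 2 + ε ≠ 0 := by positivity
  rw [regWeight]
  field_simp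
  ring

theorem abs_yCoord_mul_regWeight_le {ε : ℝ} (hε : 0 < ε) (i : Fin K ⊕ Fin L) (x : Space K L) :
    |yCoord i x| * regWeight ε x ≤ 1 + ε⁻¹ := by
  have h1 : yCoord i x ^ 2 ≤ ‖yPart x‖ ^ 2 := by
    rw [norm_yPart_sq]
    exact Finset.single_le_sum (f := fun i => yCoord i x ^ 2) (fun i _ => sq_nonneg _)
      (Finset.mem_univ i)
  have h2 := norm_yPart_sq_mul_regWeight hε x
  have h3 := regWeight_pos hε x
  have h4 := regWeight_le hε x
  have h5 : |yCoord i x| ≤ 1 + ‖yPart x‖ ^ 2 := by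
    rw [← sq_abs] at h1
    nlinarith [sq_nonneg (|yCoord i x| - 1), abs_nonneg (yCoord i x)]
  nlinarith [mul_le_mul_of_nonneg_right h5 h3.le, mul_pos hε h3]

theorem abs_regWeight_pow_le {ε : ℝ} (hε : 0 < ε) (b : ℕ) (x : Space K L) :
    |regWeight ε x ^ b| ≤ ε⁻¹ ^ b := by
  rw [abs_of_nonneg (by have := regWeight_pos hε x; positivity)]
  exact pow_le_pow_left₀ (regWeight_pos hε x).le (regWeight_le hε x) b

theorem isBddWeight_regWeight_pow {ε : ℝ} (hε : 0 < ε) (b : ℕ) (i : Fin K ⊕ Fin L) :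
    IsBddWeight i (fun x : Space K L => regWeight ε x ^ b)
      (fun x => -2 * b * (regWeight ε x ^ (b + 1) * yCoord i x)) where
  smooth := (contDiff_regWeight hε).pow b
  bdd := ⟨ε⁻¹ ^ b, abs_regWeight_pow_le hε b⟩
  bdd' := by
    refine ⟨2 * b * (ε⁻¹ ^ b * (1 + ε⁻¹)), fun x => ?_⟩
    have h3 := regWeight_pos hε x
    rw [abs_mul, pow_succ, abs_mul, abs_mul, abs_mul, abs_of_pos h3, abs_neg, abs_two, Nat.abs_cast,
      mul_assoc (|regWeight ε x ^ b|), mul_comm (regWeight ε x)]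
    exact mul_le_mul_of_nonneg_left (mul_le_mul (abs_regWeight_pow_le hε b x)
      (abs_yCoord_mul_regWeight_le hε i x) (by positivity) (by positivity)) (by positivity)
  fderiv_eq x := by
    rw [fderiv_fun_pow _ ((contDiff_regWeight hε).differentiable (by simp)).differentiableAt]
    rw [smul_apply, fderiv_regWeight hε]
    rcases b with _ | b
    · simp
    · simp only [Nat.add_sub_cancel, nsmul_eq_mul, smul_eq_mul]
      ring

theorem isBddWeight_regWeight_pow_mul_yCoord {ε : ℝ} (hε : 0 < ε) (b : ℕ) (i : Fin K ⊕ Fin L) :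
    IsBddWeight i (fun x : Space K L => regWeight ε x ^ (b + 1) * yCoord i x)
      (fun x => regWeight ε x ^ (b + 1) * isYCoord i -
        2 * (b + 1) * (regWeight ε x ^ (b + 2) * yCoord i x ^ 2)) := by
  have h := isBddWeight_regWeight_pow hε (b + 1) i
  refine ⟨h.smooth.mul (contDiff_yCoord i), ⟨ε⁻¹ ^ b * (1 + ε⁻¹), fun x => ?_⟩,
    ⟨ε⁻¹ ^ (b + 1) + 2 * (b + 1) * (ε⁻¹ ^ b * (1 + ε⁻¹) ^ 2), fun x => ?_⟩, fun x => ?_⟩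
  · have h3 := regWeight_pos hε x
    rw [pow_succ, abs_mul, abs_mul, abs_of_pos h3, mul_assoc, mul_comm (regWeight ε x)]
    exact mul_le_mul (abs_regWeight_pow_le hε b x)
      (abs_yCoord_mul_regWeight_le hε i x) (by positivity) (by positivity)
  · have h3 := regWeight_pos hε x
    refine (abs_sub _ _).trans (add_le_add ?_ ?_)
    · rw [abs_mul]
      refine (mul_le_of_le_one_right (abs_nonneg _) ?_).trans (abs_regWeight_pow_le hε (b + 1) x)
      rcases i with j | j <;> simp [isYCoord]
    · rw [show 2 * (b + 1) * (regWeight ε x ^ (b + 2) * yCoord i x ^ 2) =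
        2 * (b + 1) * (regWeight ε x ^ b * (yCoord i x * regWeight ε x) ^ 2) by ring, 
        abs_mul (2 * ((b : ℝ) + 1)), abs_mul (regWeight ε x ^ b), abs_pow (yCoord i x * _),
        abs_mul (yCoord i x), abs_of_pos h3, abs_of_nonneg (by positivity : (0 : ℝ) ≤ 2 * (b + 1))]
      refine mul_le_mul_of_nonneg_left (mul_le_mul (abs_regWeight_pow_le hε b x)
        (pow_le_pow_left₀ (by positivity) (abs_yCoord_mul_regWeight_le hε i x) 2)
        (by positivity) (by positivity)) (by positivity)
  · rw [fderiv_fun_mul (h.smooth.differentiable (by simp)).differentiableAt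
      ((contDiff_yCoord i).differentiable (by simp)).differentiableAt]
    simp only [add_apply, smul_apply, h.fderiv_eq,
      fderiv_yCoord, if_true, smul_eq_mul]
    push_cast
    ring

theorem integrable_regWeight_pow_mul {ε : ℝ} (hε : 0 < ε) (n : ℕ) {v w : Space K L → ℝ}
    (hv : MemLp v 2) (hw : MemLp w 2) :
    Integrable fun x => regWeight ε x ^ n * (v x * w x) :=
  ((MemLp.bdd_mul_real hv ((contDiff_regWeight hε).pow n).continuous
    (abs_regWeight_pow_le hε n)).integrable_mul hw).congr
    (.of_forall fun x => by simp only [Pi.mul_apply]; ring)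

theorem integrable_regWeight_pow_mul_yCoord {ε : ℝ} (hε : 0 < ε) (n : ℕ) (i : Fin K ⊕ Fin L)
    {v w : Space K L → ℝ} (hv : MemLp v 2) (hw : MemLp w 2) :
    Integrable fun x => regWeight ε x ^ (n + 1) * yCoord i x * (v x * w x) :=
  (((isBddWeight_regWeight_pow_mul_yCoord hε n i).memLp hv).integrable_mul hw).congr
    (.of_forall fun x => by simp only [Pi.mul_apply]; ring)

theorem sum_isYCoord : ∑ i : Fin K ⊕ Fin L, isYCoord i = K := by
  rw [Fintype.sum_sum_type]
  simp [isYCoord]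

/-- Writing `q` for the regularised weight, integrate `∂ᵢ(v²)` against the field `q^(b+1) y`. Since
`|y|² q = 1 - ε q`, the divergence of that field is `(K - 2(b+1)) q^(b+1) + 2(b+1) ε q^(b+2)`. -/
theorem two_mul_integral_radial {ε : ℝ} (hε : 0 < ε) (b : ℕ) {v : Space K L → ℝ}
    (hv : MemSob 1 v) :
    2 * ∑ i, ∫ x, regWeight ε x ^ (b + 1) * yCoord i x * (v x * weakPartial i v x) =
      -((K : ℝ) - 2 * (b + 1)) * (∫ x, regWeight ε x ^ (b + 1) * (v x * v x)) -
        2 * (b + 1) * (ε * ∫ x, regWeight ε x ^ (b + 2) * (v x * v x)) := by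
  have hp : ∀ i, MemLp (weakPartial i v) 2 := fun i => (weakPartial_spec hv i).1
  have h2 := hv.memLp
  have key : ∀ i, 2 * ∫ x, regWeight ε x ^ (b + 1) * yCoord i x * (v x * weakPartial i v x) =
      -∫ x, (regWeight ε x ^ (b + 1) * isYCoord i -
        2 * (b + 1) * (regWeight ε x ^ (b + 2) * yCoord i x ^ 2)) * (v x * v x) := by
    intro i
    have h := (isBddWeight_regWeight_pow_mul_yCoord hε b i).integral_mul_partial h2 (hp i)
      (weakPartial_spec hv i).2 h2 (hp i) (weakPartial_spec hv i).2
    have e1 : ∫ x, regWeight ε x ^ (b + 1) * yCoord i x * v x * weakPartial i v x =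
        ∫ x, regWeight ε x ^ (b + 1) * yCoord i x * (v x * weakPartial i v x) :=
      integral_congr_ae (.of_forall fun x => by ring)
    have e2 : ∫ x, regWeight ε x ^ (b + 1) * yCoord i x * (weakPartial i v x * v x) =
        ∫ x, regWeight ε x ^ (b + 1) * yCoord i x * (v x * weakPartial i v x) :=
      integral_congr_ae (.of_forall fun x => by ring)
    linarith
  rw [Finset.mul_sum, Finset.sum_congr rfl fun i _ => key i, Finset.sum_neg_distrib,
    ← integral_finsetSum]
  · have hpt : ∀ x : Space K L, ∑ i, (regWeight ε x ^ (b + 1) * isYCoord i -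
        2 * (b + 1) * (regWeight ε x ^ (b + 2) * yCoord i x ^ 2)) * (v x * v x) =
        ((K : ℝ) - 2 * (b + 1)) * (regWeight ε x ^ (b + 1) * (v x * v x)) +
        2 * (b + 1) * ε * (regWeight ε x ^ (b + 2) * (v x * v x)) := by
      intro x
      rw [← Finset.sum_mul, Finset.sum_sub_distrib, ← Finset.mul_sum, ← Finset.mul_sum,
        ← Finset.mul_sum, sum_isYCoord, ← norm_yPart_sq]
      have := norm_yPart_sq_mul_regWeight hε x
      linear_combination (-2 * (b + 1) * regWeight ε x ^ (b + 1) * (v x * v x)) * this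
    simp_rw [hpt]
    rw [integral_add ((integrable_regWeight_pow_mul hε _ h2 h2).const_mul _)
      ((integrable_regWeight_pow_mul hε _ h2 h2).const_mul _), integral_const_mul,
      integral_const_mul]
    ring
  · intro i _
    exact (((isBddWeight_regWeight_pow_mul_yCoord hε b i).memLp' h2).integrable_mul h2).congr
      (.of_forall fun x => by simp only [Pi.mul_apply]; ring)

theorem integral_add_add {f g h : Space K L → ℝ} (hf : Integrable f) (hg : Integrable g)
    (hh : Integrable h) :
    ∫ x, (f x + g x + h x) = (∫ x, f x) + (∫ x, g x) + ∫ x, h x := by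
  rw [← integral_add hf hg]
  exact integral_add (hf.add hg) hh

/-- Expand `∑ q^b (∂ᵢv + t q yᵢ v)² ≥ 0` and bound `|y|² q` by `1` in the last term. The parameter
`t` is optimised by the users. -/
theorem regWeight_hardy {ε : ℝ} (hε : 0 < ε) (b : ℕ) {v : Space K L → ℝ} (hv : MemSob 1 v)
    (t : ℝ) :
    0 ≤ (∑ i, ∫ x, regWeight ε x ^ b * (weakPartial i v x * weakPartial i v x)) +
      2 * t * (∑ i, ∫ x, regWeight ε x ^ (b + 1) * yCoord i x * (v x * weakPartial i v x)) +
      t ^ 2 * ∫ x, regWeight ε x ^ (b + 1) * (v x * v x) := by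
  have hp : ∀ i, MemLp (weakPartial i v) 2 := fun i => (weakPartial_spec hv i).1
  have h2 := hv.memLp
  have iA := fun i => integrable_regWeight_pow_mul hε b (hp i) (hp i)
  have iD := fun i => integrable_regWeight_pow_mul_yCoord hε b i h2 (hp i)
  have iI := integrable_regWeight_pow_mul hε (b + 1) h2 h2
  rw [← integral_finsetSum _ fun i _ => iA i, ← integral_finsetSum _ fun i _ => iD i,
    ← integral_const_mul, ← integral_const_mul, ← integral_add_add
      (integrable_finsetSum _ fun i _ => iA i)
      ((integrable_finsetSum _ fun i _ => iD i).const_mul _) (iI.const_mul _)]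
  refine integral_nonneg fun x => ?_
  have hq := regWeight_pos hε x
  have h1 : 0 ≤ regWeight ε x ^ b *
      ∑ i, (weakPartial i v x + t * v x * (regWeight ε x * yCoord i x)) ^ 2 := by positivity
  have h3 : regWeight ε x ^ b *
      ∑ i, (weakPartial i v x + t * v x * (regWeight ε x * yCoord i x)) ^ 2 =
      (∑ i, regWeight ε x ^ b * (weakPartial i v x * weakPartial i v x)) +
      2 * t * (∑ i, regWeight ε x ^ (b + 1) * yCoord i x * (v x * weakPartial i v x)) +
      t ^ 2 * regWeight ε x ^ (b + 2) * v x ^ 2 * ‖yPart x‖ ^ 2 := by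
    rw [norm_yPart_sq, Finset.mul_sum, Finset.mul_sum, Finset.mul_sum, ← Finset.sum_add_distrib,
      ← Finset.sum_add_distrib]
    exact Finset.sum_congr rfl fun i _ => by ring
  have h4 := norm_yPart_sq_mul_regWeight hε x
  have h5 : t ^ 2 * regWeight ε x ^ (b + 2) * v x ^ 2 * ‖yPart x‖ ^ 2 ≤
      t ^ 2 * (regWeight ε x ^ (b + 1) * (v x * v x)) := by
    have : t ^ 2 * regWeight ε x ^ (b + 2) * v x ^ 2 * ‖yPart x‖ ^ 2 =
        t ^ 2 * regWeight ε x ^ (b + 1) * v x ^ 2 * (‖yPart x‖ ^ 2 * regWeight ε x) := by ring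
    rw [this, h4]
    have h6 : 0 ≤ t ^ 2 * regWeight ε x ^ (b + 1) * v x ^ 2 * (ε * regWeight ε x) := by positivity
    nlinarith
  simp only [Pi.zero_apply]
  linarith

theorem regWeight_hardy_first {ε : ℝ} (hε : 0 < ε) (hK : 2 ≤ K) {v : Space K L → ℝ}
    (hv : MemSob 1 v) :
    (((K : ℝ) - 2) / 2) ^ 2 * ∫ x, regWeight ε x ^ 1 * (v x * v x) ≤
      ∑ i, ∫ x, weakPartial i v x ^ 2 := by
  have h1 := two_mul_integral_radial hε 0 hv
  -- The optimal `t`: the cross term contributes `-2t²` times the weighted integral, against `+t²`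
  -- from the square. The `ε` term has the favourable sign.
  have h2 := regWeight_hardy hε 0 hv (((K : ℝ) - 2) / 2)
  have hK' : (2 : ℝ) ≤ K := by exact_mod_cast hK
  have hI : 0 ≤ ε * ∫ x, regWeight ε x ^ (0 + 2) * (v x * v x) := by
    refine mul_nonneg hε.le (integral_nonneg fun x => ?_)
    have := regWeight_pos hε x
    simp only [Pi.zero_apply]
    have := mul_self_nonneg (v x)
    positivity
  simp only [pow_zero, one_mul, ← pow_two (weakPartial _ v _)] at h2
  push_cast at h1
  simp only [zero_add] at h1 h2 hI
  set D := ∑ i, ∫ x, regWeight ε x ^ 1 * yCoord i x * (v x * weakPartial i v x)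
  nlinarith [mul_nonneg (by linarith : (0 : ℝ) ≤ (K - 2) / 2) hI]

theorem integral_laplacian_mul {ε : ℝ} (hε : 0 < ε) (b : ℕ) {v : Space K L → ℝ}
    (hv : MemSob 2 v) :
    ∫ x, regWeight ε x ^ b * (v x * weakLaplacian v x) =
      2 * b * (∑ i, ∫ x, regWeight ε x ^ (b + 1) * yCoord i x * (v x * weakPartial i v x)) -
      ∑ i, ∫ x, regWeight ε x ^ b * (weakPartial i v x * weakPartial i v x) := by
  have h2 := hv.memLp
  have hp : ∀ i, MemLp (weakPartial i v) 2 := fun i => (weakPartial_spec hv i).1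
  have hpp : ∀ i, MemLp (weakPartial i (weakPartial i v)) 2 := fun i =>
    (weakPartial_spec (hv.weakPartial i) i).1
  have key : ∀ i, ∫ x, regWeight ε x ^ b * (v x * weakPartial i (weakPartial i v) x) =
      2 * b * (∫ x, regWeight ε x ^ (b + 1) * yCoord i x * (v x * weakPartial i v x)) -
      ∫ x, regWeight ε x ^ b * (weakPartial i v x * weakPartial i v x) := by
    intro i
    have h := (isBddWeight_regWeight_pow hε b i).integral_mul_partial h2 (hp i)
      (weakPartial_spec hv i).2 (hp i) (hpp i) (weakPartial_spec (hv.weakPartial i) i).2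
    have e1 : ∫ x, regWeight ε x ^ b * v x * weakPartial i (weakPartial i v) x =
        ∫ x, regWeight ε x ^ b * (v x * weakPartial i (weakPartial i v) x) :=
      integral_congr_ae (.of_forall fun x => by ring)
    have e2 : ∫ x, -2 * b * (regWeight ε x ^ (b + 1) * yCoord i x) * (v x * weakPartial i v x) =
        -2 * b * ∫ x, regWeight ε x ^ (b + 1) * yCoord i x * (v x * weakPartial i v x) := by
      rw [← integral_const_mul]
      exact integral_congr_ae (.of_forall fun x => by ring)
    rw [← e1, h, e2]
    ring
  rw [Finset.mul_sum, ← Finset.sum_sub_distrib, ← Finset.sum_congr rfl fun i _ => key i,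
    ← integral_finsetSum _ fun i _ => integrable_regWeight_pow_mul hε b h2 (hpp i)]
  refine integral_congr_ae (.of_forall fun x => ?_)
  simp only [weakLaplacian, Finset.mul_sum]

/-- Integration by parts and the weighted Hardy inequality give `c ∫ q^(a+2) v² ≤ -∫ q^(a+1) v Δv`,
with `c` the unsquared constant. Then `∫ q^a (Δv + c q v)² ≥ 0` completes the square. -/
theorem regWeight_rellich {ε : ℝ} (hε : 0 < ε) {a : ℕ} (hK : 2 * a + 4 ≤ K) {v : Space K L → ℝ}
    (hv : MemSob 2 v) :
    (((K : ℝ) - 4 - 2 * a) * (K + 2 * a) / 4) ^ 2 * ∫ x, regWeight ε x ^ (a + 2) * (v x * v x) ≤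
      ∫ x, regWeight ε x ^ a * (weakLaplacian v x * weakLaplacian v x) := by
  have h1 := two_mul_integral_radial hε (a + 1) (hv.mono one_le_two)
  set t : ℝ := ((K : ℝ) - 4 - 2 * a) / 2 with ht
  have h2 := regWeight_hardy hε (a + 1) (hv.mono one_le_two) t
  have h3 := integral_laplacian_mul hε (a + 1) hv
  have hK' : (2 : ℝ) * a + 4 ≤ K := by exact_mod_cast hK
  have ht0 : 0 ≤ t := by rw [ht]; linarith
  have hI : 0 ≤ ε * ∫ x, regWeight ε x ^ (a + 1 + 2) * (v x * v x) := by
    refine mul_nonneg hε.le (integral_nonneg fun x => ?_)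
    have := regWeight_pos hε x
    simp only [Pi.zero_apply]
    have := mul_self_nonneg (v x)
    positivity
  push_cast at h1 h3
  set D := ∑ i, ∫ x, regWeight ε x ^ (a + 1 + 1) * yCoord i x * (v x * weakPartial i v x)
  set A := ∑ i, ∫ x, regWeight ε x ^ (a + 1) * (weakPartial i v x * weakPartial i v x)
  set Z := ∫ x, regWeight ε x ^ (a + 1) * (v x * weakLaplacian v x)
  set Y := ∫ x, regWeight ε x ^ (a + 1 + 1) * (v x * v x) with hY
  set c : ℝ := ((K : ℝ) - 4 - 2 * a) * (K + 2 * a) / 4 with hc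
  have hYnn : 0 ≤ Y := integral_nonneg fun x => by
    have := regWeight_pos hε x
    have := mul_self_nonneg (v x)
    simp only [Pi.zero_apply]
    positivity
  -- The constant arises as `2t(t + a + 1) - t²`: the first term from the radial identity, the
  -- second from the Hardy inequality with parameter `t`.
  have hct : c = t * (t + 2 * (a + 1)) := by rw [hc, ht]; ring
  have hKt : (K : ℝ) - 2 * (a + 1 + 1) = 2 * t := by rw [ht]; ring
  have hZ : c * Y ≤ -Z := by
    rw [hKt] at h1
    have h4 : 0 ≤ (t + (a + 1)) * ((2 * (a + 1 + 1)) * (ε * ∫ x, regWeight ε x ^ (a + 1 + 2) * (v x * v x))) := by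
      positivity
    rw [hct]
    nlinarith
  have hL := weakLaplacian_memLp (m := 0) hv
  have i1 := integrable_regWeight_pow_mul hε a hL hL
  have i2 := integrable_regWeight_pow_mul hε (a + 1) hv.memLp hL
  have i3 := integrable_regWeight_pow_mul hε (a + 2) hv.memLp hv.memLp
  have hsq : 0 ≤ (∫ x, regWeight ε x ^ a * (weakLaplacian v x * weakLaplacian v x)) +
      2 * c * Z + c ^ 2 * Y := by
    rw [← integral_const_mul, ← integral_const_mul,
      ← integral_add_add i1 (i2.const_mul _) (i3.const_mul _)]
    refine integral_nonneg fun x => ?_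
    have hq := regWeight_pos hε x
    have : 0 ≤ regWeight ε x ^ a * (weakLaplacian v x + c * v x * regWeight ε x) ^ 2 := by
      positivity
    simp only [Pi.zero_apply]
    refine this.trans (le_of_eq ?_)
    ring
  have hc0 : 0 ≤ c := by rw [hct]; positivity
  nlinarith [mul_le_mul_of_nonneg_left hZ hc0]

/-- The square root of the optimal constant in the Hardy–Rellich inequality of order `m` in
`ℝ^K`. -/
noncomputable def rellichConst (K m : ℕ) : ℝ :=
  2 ^ m * Real.Gamma (((K : ℝ) + 2 * m) / 4) / Real.Gamma (((K : ℝ) - 2 * m) / 4)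

theorem rellichConst_zero {K : ℕ} (hK : 0 < K) : rellichConst K 0 = 1 := by
  have : (0 : ℝ) < K := by exact_mod_cast hK
  have : Real.Gamma ((K : ℝ) / 4) ≠ 0 := (Real.Gamma_pos_of_pos (by positivity)).ne'
  simp [rellichConst, this]

theorem rellichConst_one {K : ℕ} (hK : 2 < K) : rellichConst K 1 = ((K : ℝ) - 2) / 2 := by
  have : (2 : ℝ) < K := by exact_mod_cast hK
  have h0 : ((K : ℝ) - 2) / 4 ≠ 0 := by
    have : 0 < ((K : ℝ) - 2) / 4 := by linarith
    exact this.ne'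
  have h1 : Real.Gamma (((K : ℝ) - 2) / 4) ≠ 0 := (Real.Gamma_pos_of_pos (by linarith)).ne'
  have h2 : ((K : ℝ) + 2) / 4 = ((K : ℝ) - 2) / 4 + 1 := by ring
  rw [rellichConst]
  push_cast
  rw [mul_one, h2, Real.Gamma_add_one h0]
  field_simp
  ring

/-- Raising the order by two shifts the numerator's Gamma argument up by one and the denominator's
down by one, so the functional equation produces exactly the constant of the one-step Rellich
inequality. -/
theorem rellichConst_add_two {K m : ℕ} (hK : 2 * (m + 2) < K) :
    rellichConst K (m + 2) =
      ((K : ℝ) - 4 - 2 * m) * (K + 2 * m) / 4 * rellichConst K m := by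
  have hK' : (2 : ℝ) * (m + 2) < K := by exact_mod_cast hK
  have h1 : ((K : ℝ) + 2 * (m + 2)) / 4 = ((K : ℝ) + 2 * m) / 4 + 1 := by ring
  have h2 : ((K : ℝ) - 2 * m) / 4 = ((K : ℝ) - 2 * (m + 2)) / 4 + 1 := by ring
  have h3 : 0 < ((K : ℝ) - 2 * (m + 2)) / 4 := by linarith
  have h4 : 0 < ((K : ℝ) + 2 * m) / 4 := by linarith [m.cast_nonneg (α := ℝ)]
  have h5 : Real.Gamma (((K : ℝ) - 2 * (m + 2)) / 4) ≠ 0 := (Real.Gamma_pos_of_pos h3).ne'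
  have h6 : (K : ℝ) - 2 * (m + 2) ≠ 0 := by linarith
  rw [rellichConst, rellichConst, h2]
  push_cast
  rw [h1, Real.Gamma_add_one h3.ne', Real.Gamma_add_one h4.ne']
  field_simp
  ring

/-- Each application of `regWeight_rellich` trades two powers of the weight for one Laplacian, down
to order `0` or `1`; the constants multiply up. -/
theorem regWeight_hardy_rellich {ε : ℝ} (hε : 0 < ε) {m : ℕ} (hK : 2 * m < K)
    {v : Space K L → ℝ} (hv : MemSob m v) :
    rellichConst K m ^ 2 * ∫ x, regWeight ε x ^ m * (v x * v x) ≤ ∫ x, nablaPowSq m v x := by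
  induction m using Nat.twoStepInduction generalizing v with
  | zero =>
    rw [rellichConst_zero (by omega), nablaPowSq_zero]
    simp [pow_two]
  | one =>
    rw [rellichConst_one (by omega), nablaPowSq_one]
    rw [integral_finsetSum _ fun i _ => ((weakPartial_spec hv i).1).integrable_sq]
    exact regWeight_hardy_first hε (by omega) hv
  | more m ih _ =>
    rw [rellichConst_add_two hK, nablaPowSq_add_two]
    have h1 := ih (by omega) hv.weakLaplacian
    have h2 := regWeight_rellich hε (a := m) (by omega) (hv.mono (by omega : 2 ≤ m + 2))
    have h3 := mul_le_mul_of_nonneg_left h2 (sq_nonneg (rellichConst K m))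
    refine le_trans (le_of_eq ?_) (h3.trans h1)
    ring

/-- Fatou as the regularisation tends to `0`. The lower integral avoids presupposing that the
singular term is integrable. -/
theorem lintegral_hardy_rellich {m : ℕ} (hm : 1 ≤ m) (hK : 2 * m < K) {v : Space K L → ℝ}
    (hv : MemSob m v) :
    ENNReal.ofReal (rellichConst K m ^ 2) * ∫⁻ x, ENNReal.ofReal (v x ^ 2 / ‖yPart x‖ ^ (2 * m)) ≤
      ENNReal.ofReal (∫ x, nablaPowSq m v x) := by
  let ε : ℕ → ℝ := fun n => 1 / ((n : ℝ) + 1)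
  have hε : ∀ n, 0 < ε n := fun n => by positivity
  have hεlim : Tendsto ε atTop (𝓝 0) := tendsto_one_div_add_atTop_nhds_zero_nat
  have hpt : ∀ x, ENNReal.ofReal (v x ^ 2 / ‖yPart x‖ ^ (2 * m)) ≤
      liminf (fun n => ENNReal.ofReal (regWeight (ε n) x ^ m * (v x * v x))) atTop := by
    intro x
    -- On `y = 0` the quotient is `0` by the convention for division, because `m ≥ 1`.
    by_cases hx : ‖yPart x‖ = 0
    · have : 2 * m ≠ 0 := by omega
      simp [hx, this]
    · have hlim : Tendsto (fun n => regWeight (ε n) x ^ m * (v x * v x)) atTop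
          (𝓝 (v x ^ 2 / ‖yPart x‖ ^ (2 * m))) := by
        have h1 : Tendsto (fun n => (‖yPart x‖ ^ 2 + ε n)⁻¹) atTop (𝓝 (‖yPart x‖ ^ 2 + 0)⁻¹) :=
          (tendsto_const_nhds.add hεlim).inv₀ (by simpa using hx)
        have h2 := (h1.pow m).mul_const (v x * v x)
        have e : v x ^ 2 / ‖yPart x‖ ^ (2 * m) = (‖yPart x‖ ^ 2 + 0)⁻¹ ^ m * (v x * v x) := by
          rw [add_zero, inv_pow, ← pow_mul]
          field_simp
        rw [e]
        exact h2
      exact ((ENNReal.continuous_ofReal.tendsto _).comp hlim).liminf_eq.ge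
  have hint : ∀ n, ENNReal.ofReal (rellichConst K m ^ 2) *
      ∫⁻ x, ENNReal.ofReal (regWeight (ε n) x ^ m * (v x * v x)) ≤
        ENNReal.ofReal (∫ x, nablaPowSq m v x) := by
    intro n
    rw [← ofReal_integral_eq_lintegral_ofReal
      (integrable_regWeight_pow_mul (hε n) m hv.memLp hv.memLp)
      (.of_forall fun x => by
        have := regWeight_pos (hε n) x
        have := mul_self_nonneg (v x)
        simp only [Pi.zero_apply]
        positivity), ← ENNReal.ofReal_mul (sq_nonneg _)]
    exact ENNReal.ofReal_le_ofReal (regWeight_hardy_rellich (hε n) hK hv)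
  calc _ ≤ ENNReal.ofReal (rellichConst K m ^ 2) *
        liminf (fun n => ∫⁻ x, ENNReal.ofReal (regWeight (ε n) x ^ m * (v x * v x))) atTop := by
        gcongr
        refine (lintegral_mono hpt).trans (lintegral_liminf_le' fun n => ?_)
        exact (integrable_regWeight_pow_mul (hε n) m hv.memLp hv.memLp).1.aemeasurable.ennreal_ofReal
    _ ≤ liminf (fun n => ENNReal.ofReal (rellichConst K m ^ 2) *
        ∫⁻ x, ENNReal.ofReal (regWeight (ε n) x ^ m * (v x * v x))) atTop := by
        have := ENNReal.le_liminf_mul (f := atTop)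
          (u := fun _ : ℕ => ENNReal.ofReal (rellichConst K m ^ 2))
          (v := fun n => ∫⁻ x, ENNReal.ofReal (regWeight (ε n) x ^ m * (v x * v x)))
        rwa [liminf_const] at this
    _ ≤ _ := by
        refine liminf_le_of_le (by isBoundedDefault) fun b hb => ?_
        obtain ⟨n, hn⟩ := hb.exists
        exact hn.trans (hint n)

end Hardy

end SingularPolyharmonic

namespace SingularPolyharmonic

open FourierTransform RealInnerProductSpace

/-! ### The embedding into a Hilbert space. -/

section Model

variable {K L : ℕ}

/-- The Hilbert space into which `X^m_{G(K)}` is embedded. -/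
abbrev Model (K L : ℕ) : Type := PiLp 2 fun _ : Fin 3 => L2C (Space K L)

theorem Model.norm_sq (h : Model K L) : ‖h‖ ^ 2 = ‖h 0‖ ^ 2 + ‖h 1‖ ^ 2 + ‖h 2‖ ^ 2 := by
  rw [PiLp.norm_sq_eq_of_L2, Fin.sum_univ_three]

theorem pair_zero_add (z z' : EuclideanSpace ℝ (Fin L)) :
    (pair 0 (z + z') : Space K L) = pair 0 z + pair 0 z' := by
  ext i
  rcases i with i | i <;> simp [pair]

theorem pair_zero_zero : (pair 0 0 : Space K L) = 0 := by
  ext i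
  rcases i with i | i <;> simp [pair]

theorem norm_pair_sq (y : EuclideanSpace ℝ (Fin K)) (z : EuclideanSpace ℝ (Fin L)) :
    ‖pair y z‖ ^ 2 = ‖y‖ ^ 2 + ‖z‖ ^ 2 := by
  rw [EuclideanSpace.norm_sq_eq, EuclideanSpace.norm_sq_eq, EuclideanSpace.norm_sq_eq,
    Fintype.sum_sum_type]
  simp [pair]

theorem norm_pair_zero (z : EuclideanSpace ℝ (Fin L)) : ‖(pair 0 z : Space K L)‖ = ‖z‖ := by
  have := norm_pair_sq (0 : EuclideanSpace ℝ (Fin K)) z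
  rw [norm_zero, zero_pow two_ne_zero, zero_add] at this
  exact (sq_eq_sq₀ (norm_nonneg _) (norm_nonneg _)).1 this

theorem continuous_pair_zero : Continuous fun z : EuclideanSpace ℝ (Fin L) =>
    (pair 0 z : Space K L) := by
  refine (PiLp.continuous_toLp 2 _).comp (continuous_pi fun i => ?_)
  rcases i with i | i
  · exact continuous_const
  · exact (EuclideanSpace.proj (𝕜 := ℝ) i).continuous

theorem yPart_add_pair_zero (x : Space K L) (z : EuclideanSpace ℝ (Fin L)) :
    yPart (x + pair 0 z) = yPart x := by
  ext i
  simp [yPart, pair]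

theorem zPart_add_pair_zero (x : Space K L) (z : EuclideanSpace ℝ (Fin L)) :
    zPart (x + pair 0 z) = zPart x + z := by
  ext i
  simp [zPart, pair]

theorem pair_add_pair_zero (y : EuclideanSpace ℝ (Fin K)) (z z' : EuclideanSpace ℝ (Fin L)) :
    pair y z + pair 0 z' = pair y (z + z') := by
  ext i
  rcases i with i | i <;> simp [pair]

theorem pair_yPart_zPart (x : Space K L) : pair (yPart x) (zPart x) = x := by
  ext i
  rcases i with i | i <;> simp [pair, yPart, zPart]

theorem yPart_pair (y : EuclideanSpace ℝ (Fin K)) (z : EuclideanSpace ℝ (Fin L)) :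
    yPart (pair y z) = y := by
  ext i; simp [pair, yPart]

theorem zPart_pair (y : EuclideanSpace ℝ (Fin K)) (z : EuclideanSpace ℝ (Fin L)) :
    zPart (pair y z) = z := by
  ext i; simp [pair, zPart]

theorem continuous_yPart : Continuous (yPart : Space K L → EuclideanSpace ℝ (Fin K)) :=
  (PiLp.continuous_toLp 2 _).comp
    (continuous_pi fun i => (EuclideanSpace.proj (𝕜 := ℝ) (Sum.inl i)).continuous)

/-- The action of the translations in `z` on the Hilbert space `Model`. -/
noncomputable def modelShift (z : EuclideanSpace ℝ (Fin L)) : Model K L →ₗᵢ[ℝ] Model K L where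
  toFun h := WithLp.toLp 2 fun k => mulPhase (pair 0 z) (h k)
  map_add' f g := by ext1 k; simp
  map_smul' c f := by
    ext1 k
    simp only [PiLp.smul_apply, RingHom.id_apply]
    exact ((mulPhase (pair 0 z)).toLinearMap.restrictScalars ℝ).map_smul c (f k)
  norm_map' f := by
    rw [← sq_eq_sq₀ (norm_nonneg _) (norm_nonneg _)]
    simp [Model.norm_sq]

theorem modelShift_apply (z : EuclideanSpace ℝ (Fin L)) (h : Model K L) (k : Fin 3) :
    modelShift z h k = mulPhase (pair 0 z) (h k) := rfl

theorem modelShift_zero (h : Model K L) : modelShift 0 h = h := by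
  ext1 k
  rw [modelShift_apply, pair_zero_zero, mulPhase_zero]

theorem modelShift_add (z z' : EuclideanSpace ℝ (Fin L)) (h : Model K L) :
    modelShift (z + z') h = modelShift z (modelShift z' h) := by
  ext1 k
  simp_rw [modelShift_apply, pair_zero_add, mulPhase_add]

/-- Riemann–Lebesgue in each component. This is the source of all asymptotic orthogonality between
profiles. -/
theorem tendsto_inner_modelShift_cocompact (h g : Model K L) :
    Tendsto (fun z => ⟪modelShift z h, g⟫) (cocompact (EuclideanSpace ℝ (Fin L))) (𝓝 0) := by
  have hcc : Tendsto (fun z : EuclideanSpace ℝ (Fin L) => (pair 0 z : Space K L))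
      (cocompact _) (cocompact _) := by
    rw [← Metric.cobounded_eq_cocompact, ← Metric.cobounded_eq_cocompact, ← comap_norm_atTop,
      ← comap_norm_atTop, tendsto_comap_iff]
    simp only [Function.comp_def, norm_pair_zero]
    exact tendsto_comap
  have hk : ∀ k, Tendsto (fun z => ⟪mulPhase (pair 0 z : Space K L) (h k), g k⟫)
      (cocompact (EuclideanSpace ℝ (Fin L))) (𝓝 0) := by
    intro k
    simp_rw [L2C.real_inner_eq_re]
    have := (tendsto_inner_mulPhase_cocompact (h k) (g k)).comp hcc
    exact (Complex.continuous_re.tendsto' 0 0 rfl).comp this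
  have := tendsto_finsetSum Finset.univ fun k _ => hk k
  simpa [PiLp.inner_apply, modelShift_apply] using this

theorem continuous_modelShift (h : Model K L) : Continuous fun z => modelShift z h := by
  refine (PiLp.continuous_toLp 2 _).comp (continuous_pi fun k => ?_)
  exact (continuous_mulPhase (h k)).comp continuous_pair_zero

/-- The function `|μ|^(1/2) u / |y|^m`. -/
noncomputable def potTerm (m : ℕ) (μ : ℝ) (u : Space K L → ℝ) (x : Space K L) : ℝ :=
  √|μ| * (u x / ‖yPart x‖ ^ m)

theorem potTerm_sq (m : ℕ) (μ : ℝ) (u : Space K L → ℝ) (x : Space K L) :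
    potTerm m μ u x ^ 2 = |μ| * (u x ^ 2 / ‖yPart x‖ ^ (2 * m)) := by
  rw [potTerm, mul_pow, Real.sq_sqrt (abs_nonneg μ), div_pow, ← pow_mul, mul_comm m]

theorem memLp_potTerm_iff {m : ℕ} {μ : ℝ} {u : Space K L → ℝ} (hu : MemLp u 2) :
    MemLp (potTerm m μ u) 2 ↔
      ENNReal.ofReal |μ| * ∫⁻ x, ENNReal.ofReal (u x ^ 2 / ‖yPart x‖ ^ (2 * m)) < ⊤ := by
  have hmeas : AEStronglyMeasurable (potTerm m μ u) volume := by
    have h1 : AEMeasurable (fun x : Space K L => ‖yPart x‖ ^ m) :=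
      (continuous_yPart.norm.pow m).measurable.aemeasurable
    exact ((hu.1.aemeasurable.div h1).const_mul _).aestronglyMeasurable
  have h2 : ∀ x, ENNReal.ofReal (potTerm m μ u x ^ 2) =
      ENNReal.ofReal |μ| * ENNReal.ofReal (u x ^ 2 / ‖yPart x‖ ^ (2 * m)) := fun x => by
    rw [potTerm_sq, ENNReal.ofReal_mul (abs_nonneg μ)]
  rw [← lintegral_const_mul' _ _ ENNReal.ofReal_ne_top]
  simp_rw [← h2]
  rw [memLp_two_iff_integrable_sq hmeas, Integrable, hasFiniteIntegral_iff_ofReal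
    (.of_forall fun x => sq_nonneg _)]
  exact ⟨fun h => h.2, fun h => ⟨hmeas.pow 2, h⟩⟩

theorem memX_iff {m : ℕ} {μ : ℝ} {u : Space K L → ℝ} :
    MemX m μ u ↔ MemSob m u ∧ IsCylindrical u ∧ MemLp (potTerm m μ u) 2 := by
  constructor
  · rintro ⟨h1, h2, h3⟩
    exact ⟨h1, h2, (memLp_potTerm_iff h1.memLp).2 h3⟩
  · rintro ⟨h1, h2, h3⟩
    exact ⟨h1, h2, (memLp_potTerm_iff h1.memLp).1 h3⟩

theorem potTerm_add (m : ℕ) (μ : ℝ) (u v : Space K L → ℝ) :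
    potTerm m μ (u + v) = potTerm m μ u + potTerm m μ v := by
  ext x; simp only [potTerm, Pi.add_apply]; ring

theorem potTerm_smul (m : ℕ) (μ c : ℝ) (u : Space K L → ℝ) :
    potTerm m μ (c • u) = c • potTerm m μ u := by
  ext x; simp only [potTerm, Pi.smul_apply, smul_eq_mul]; ring

theorem memLp_highFreq {m : ℕ} {u : Space K L → ℝ} (h : MemSob m u) :
    MemLp (fun ξ => (2 * Real.pi * ‖ξ‖) ^ m • ft u ξ) 2 := by
  refine ((memSob_iff.1 h).2.const_smul ((2 * Real.pi) ^ m)).ae_eq (.of_forall fun ξ => ?_)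
  simp only [Pi.smul_apply, smul_smul, mul_pow]

open Classical in
/-- The function `(2π|ξ|)^m û` in `L²`. -/
noncomputable def highFreq (m : ℕ) (u : Space K L → ℝ) : L2C (Space K L) :=
  if h : MemLp (fun ξ => (2 * Real.pi * ‖ξ‖) ^ m • ft u ξ) 2 then h.toLp else 0

theorem coeFn_highFreq {m : ℕ} {u : Space K L → ℝ} (h : MemSob m u) :
    highFreq m u =ᵐ[volume] fun ξ => (2 * Real.pi * ‖ξ‖) ^ m • ft u ξ := by
  rw [highFreq, dif_pos (memLp_highFreq h)]
  exact (memLp_highFreq h).coeFn_toLp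

theorem MemSob.add {m : ℕ} {u v : Space K L → ℝ} (hu : MemSob m u) (hv : MemSob m v) :
    MemSob m (u + v) := by
  rw [memSob_iff] at *
  refine ⟨hu.1.add hv.1, (hu.2.add hv.2).ae_eq ?_⟩
  rw [ft_add hu.1 hv.1]
  filter_upwards [Lp.coeFn_add (ft u) (ft v)] with ξ h
  rw [h]
  simp [smul_add]

theorem MemSob.smul {m : ℕ} {u : Space K L → ℝ} (hu : MemSob m u) (c : ℝ) :
    MemSob m (c • u) := by
  rw [memSob_iff] at *
  refine ⟨hu.1.const_smul c, (hu.2.const_smul (c : ℂ)).ae_eq ?_⟩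
  rw [ft_smul c hu.1]
  filter_upwards [Lp.coeFn_smul (c : ℂ) (ft u)] with ξ h
  rw [h]
  change (c : ℂ) • (‖ξ‖ ^ m • ft u ξ) = ‖ξ‖ ^ m • ((c : ℂ) • ft u ξ)
  exact smul_comm _ _ _

theorem highFreq_add {m : ℕ} {u v : Space K L → ℝ} (hu : MemSob m u) (hv : MemSob m v) :
    highFreq m (u + v) = highFreq m u + highFreq m v := by
  ext1
  have h := coeFn_highFreq (hu.add hv)
  rw [ft_add hu.memLp hv.memLp] at h
  filter_upwards [h, coeFn_highFreq hu, coeFn_highFreq hv, Lp.coeFn_add (ft u) (ft v),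
    Lp.coeFn_add (highFreq m u) (highFreq m v)] with ξ h1 h2 h3 h4 h5
  rw [h1, h5, Pi.add_apply, h2, h3, h4, Pi.add_apply, smul_add]

theorem highFreq_smul {m : ℕ} {u : Space K L → ℝ} (hu : MemSob m u) (c : ℝ) :
    highFreq m (c • u) = (c : ℂ) • highFreq m u := by
  ext1
  have h := coeFn_highFreq (hu.smul c)
  rw [ft_smul c hu.memLp] at h
  filter_upwards [h, coeFn_highFreq hu, Lp.coeFn_smul (c : ℂ) (ft u),
    Lp.coeFn_smul (c : ℂ) (highFreq m u)] with ξ h1 h2 h4 h5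
  rw [h1, h5, Pi.smul_apply, h2, h4, Pi.smul_apply, smul_comm]

theorem exists_isometry_rotate (A : EuclideanSpace ℝ (Fin K) ≃ₗᵢ[ℝ] EuclideanSpace ℝ (Fin K)) :
    ∃ B : Space K L ≃ₗᵢ[ℝ] Space K L, ∀ x, B x = pair (A (yPart x)) (zPart x) := by
  have hadd : ∀ x x' : Space K L, pair (A (yPart (x + x'))) (zPart (x + x')) =
      pair (A (yPart x)) (zPart x) + pair (A (yPart x')) (zPart x') := by
    intro x x'
    have h1 : yPart (x + x') = yPart x + yPart x' := by ext; simp [yPart]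
    rw [h1, map_add]
    ext i
    rcases i with i | i <;> simp [pair, zPart]
  have hsmul : ∀ (c : ℝ) (x : Space K L), pair (A (yPart (c • x))) (zPart (c • x)) =
      c • pair (A (yPart x)) (zPart x) := by
    intro c x
    have h1 : yPart (c • x) = c • yPart x := by ext; simp [yPart]
    rw [h1, map_smul]
    ext i
    rcases i with i | i <;> simp [pair, zPart]
  have hnorm : ∀ x : Space K L, ‖pair (A (yPart x)) (zPart x)‖ = ‖x‖ := by
    intro x
    rw [← sq_eq_sq₀ (norm_nonneg _) (norm_nonneg _), norm_pair_sq, A.norm_map, ← norm_pair_sq,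
      pair_yPart_zPart]
  let F : Space K L →ₗᵢ[ℝ] Space K L :=
    ⟨⟨⟨fun x => pair (A (yPart x)) (zPart x), hadd⟩, hsmul⟩, hnorm⟩
  exact ⟨F.toLinearIsometryEquiv rfl, fun x => rfl⟩

theorem IsCylindrical.add {u v : Space K L → ℝ} (hu : IsCylindrical u) (hv : IsCylindrical v) :
    IsCylindrical (u + v) := fun A => by
  filter_upwards [hu A, hv A] with x h1 h2
  simp [h1, h2]

theorem IsCylindrical.smul {u : Space K L → ℝ} (hu : IsCylindrical u) (c : ℝ) :
    IsCylindrical (c • u) := fun A => by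
  filter_upwards [hu A] with x h1
  simp [h1]

/-- The transform commutes with isometries, so the almost everywhere invariance becomes an equality
in `L²`, a condition that is visibly closed. -/
theorem isCylindrical_iff_ft {u : Space K L → ℝ} (hu : MemLp u 2) :
    IsCylindrical u ↔ ∀ (A : EuclideanSpace ℝ (Fin K) ≃ₗᵢ[ℝ] EuclideanSpace ℝ (Fin K))
      (B : Space K L ≃ₗᵢ[ℝ] Space K L), (∀ x, B x = pair (A (yPart x)) (zPart x)) →
      rotateL2 B (ft u) = ft u := by
  have key : ∀ (A : EuclideanSpace ℝ (Fin K) ≃ₗᵢ[ℝ] EuclideanSpace ℝ (Fin K))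
      (B : Space K L ≃ₗᵢ[ℝ] Space K L), (∀ x, B x = pair (A (yPart x)) (zPart x)) →
      (rotateL2 B (ft u) = ft u ↔
        ∀ᵐ x : Space K L, u (pair (A (yPart x)) (zPart x)) = u x) := by
    intro A B hB
    simp_rw [← hB]
    have h2 : MemLp (fun x => u (B x)) 2 := hu.comp_measurePreserving B.measurePreserving
    rw [← ft_rotate hu]
    exact ⟨fun h => ae_eq_of_ft_eq h2 hu h, fun h => ft_congr h⟩
  constructor
  · exact fun h A B hB => (key A B hB).2 (h A)
  · intro h A
    obtain ⟨B, hB⟩ := exists_isometry_rotate (L := L) A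
    exact (key A B hB).1 (h A B hB)

/-- The space `X^m_{G(K)}` as a subspace of the space of all functions. -/
def spaceX (K L m : ℕ) (μ : ℝ) : Submodule ℝ (Space K L → ℝ) where
  carrier := {u | MemX m μ u}
  add_mem' {u v} hu hv := by
    rw [Set.mem_ofPred_eq, memX_iff] at *
    exact ⟨hu.1.add hv.1, hu.2.1.add hv.2.1, by rw [potTerm_add]; exact hu.2.2.add hv.2.2⟩
  zero_mem' := by
    rw [Set.mem_ofPred_eq, memX_iff, memSob_iff]
    have h0 : ft (0 : Space K L → ℝ) = 0 := by
      have := ft_smul 0 (MemLp.zero (p := 2) (μ := volume) (α := Space K L) (ε := ℝ))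
      simpa using this
    refine ⟨⟨MemLp.zero, ?_⟩, fun A => by simp, ?_⟩
    · rw [h0]
      refine MemLp.zero.ae_eq ?_
      filter_upwards [Lp.coeFn_zero ℂ 2 (volume : Measure (Space K L))] with ξ h
      rw [h]
      simp
    · have : potTerm m μ (0 : Space K L → ℝ) = 0 := by ext; simp [potTerm]
      rw [this]
      exact MemLp.zero
  smul_mem' c u hu := by
    rw [Set.mem_ofPred_eq, memX_iff] at *
    exact ⟨hu.1.smul c, hu.2.1.smul c, by rw [potTerm_smul]; exact hu.2.2.const_smul c⟩

/-- The three components of the embedding of `X^m_{G(K)}` into `Model`. -/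
noncomputable def toModel (m : ℕ) (μ : ℝ) (u : Space K L → ℝ) : Model K L :=
  WithLp.toLp 2 ![ft u, highFreq m u, ft (potTerm m μ u)]

theorem toModel_zero (m : ℕ) (μ : ℝ) (u : Space K L → ℝ) : toModel m μ u 0 = ft u := rfl
theorem toModel_one (m : ℕ) (μ : ℝ) (u : Space K L → ℝ) : toModel m μ u 1 = highFreq m u := rfl
theorem toModel_two (m : ℕ) (μ : ℝ) (u : Space K L → ℝ) :
    toModel m μ u 2 = ft (potTerm m μ u) := rfl

theorem MemX.sob {m : ℕ} {μ : ℝ} {u : Space K L → ℝ} (h : MemX m μ u) : MemSob m u := h.1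

theorem MemX.memLp {m : ℕ} {μ : ℝ} {u : Space K L → ℝ} (h : MemX m μ u) : MemLp u 2 := h.1.memLp

theorem MemX.pot {m : ℕ} {μ : ℝ} {u : Space K L → ℝ} (h : MemX m μ u) :
    MemLp (potTerm m μ u) 2 := (memX_iff.1 h).2.2

theorem Model.ext3 {f g : Model K L} (h0 : f 0 = g 0) (h1 : f 1 = g 1) (h2 : f 2 = g 2) :
    f = g := by
  ext1 k
  fin_cases k
  exacts [h0, h1, h2]

theorem toModel_add {m : ℕ} {μ : ℝ} {u v : Space K L → ℝ} (hu : MemX m μ u) (hv : MemX m μ v) :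
    toModel m μ (u + v) = toModel m μ u + toModel m μ v := by
  refine Model.ext3 ?_ ?_ ?_
  · exact ft_add hu.memLp hv.memLp
  · exact highFreq_add hu.sob hv.sob
  · change ft (potTerm m μ (u + v)) = _
    rw [potTerm_add]
    exact ft_add hu.pot hv.pot

theorem toModel_smul {m : ℕ} {μ : ℝ} {u : Space K L → ℝ} (hu : MemX m μ u) (c : ℝ) :
    toModel m μ (c • u) = c • toModel m μ u := by
  refine Model.ext3 ?_ ?_ ?_
  · exact ft_smul c hu.memLp
  · exact highFreq_smul hu.sob c
  · change ft (potTerm m μ (c • u)) = _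
    rw [potTerm_smul]
    exact ft_smul c hu.pot

/-- The embedding of `X^m_{G(K)}` into `Model`. -/
noncomputable def embX (K L m : ℕ) (μ : ℝ) : spaceX K L m μ →ₗ[ℝ] Model K L where
  toFun u := toModel m μ u
  map_add' u v := toModel_add u.2 v.2
  map_smul' c u := toModel_smul u.2 c

theorem MemX.add {m : ℕ} {μ : ℝ} {u v : Space K L → ℝ} (hu : MemX m μ u) (hv : MemX m μ v) :
    MemX m μ (u + v) := (spaceX K L m μ).add_mem hu hv

theorem MemX.sub {m : ℕ} {μ : ℝ} {u v : Space K L → ℝ} (hu : MemX m μ u) (hv : MemX m μ v) :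
    MemX m μ (u - v) := (spaceX K L m μ).sub_mem hu hv

theorem MemX.sum {m : ℕ} {μ : ℝ} {ι : Type*} (s : Finset ι) {u : ι → Space K L → ℝ}
    (hu : ∀ i, MemX m μ (u i)) : MemX m μ (∑ i ∈ s, u i) :=
  (spaceX K L m μ).sum_mem fun i _ => hu i

theorem toModel_sub {m : ℕ} {μ : ℝ} {u v : Space K L → ℝ} (hu : MemX m μ u) (hv : MemX m μ v) :
    toModel m μ (u - v) = toModel m μ u - toModel m μ v :=
  (embX K L m μ).map_sub ⟨u, hu⟩ ⟨v, hv⟩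

theorem toModel_sum {m : ℕ} {μ : ℝ} {ι : Type*} (s : Finset ι) {u : ι → Space K L → ℝ}
    (hu : ∀ i, MemX m μ (u i)) : toModel m μ (∑ i ∈ s, u i) = ∑ i ∈ s, toModel m μ (u i) := by
  have := map_sum (embX K L m μ) (fun i => (⟨u i, hu i⟩ : spaceX K L m μ)) s
  simp only [embX, LinearMap.coe_mk, AddHom.coe_mk] at this
  rw [← this]
  congr 1
  simp

theorem mulPhase_smul_comm {a : Space K L} {m : ℕ} {u : Space K L → ℝ} (hu : MemSob m u) :
    MemSob m (fun x => u (x + a)) ∧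
      highFreq m (fun x => u (x + a)) = mulPhase a (highFreq m u) := by
  have hv : MemLp (fun x => u (x + a)) 2 :=
    hu.memLp.comp_measurePreserving (measurePreserving_add_right volume a)
  have hs : MemSob m (fun x => u (x + a)) := by
    rw [memSob_iff]
    refine ⟨hv, memLp_norm_pow_mul_of_le ((memSob_iff.1 hu).2.norm) ?_⟩
    rw [ft_translate hu.memLp]
    filter_upwards [coeFn_mulPhase a (ft u)] with ξ h
    rw [h]
    simp
  refine ⟨hs, ?_⟩
  ext1
  have h1 := coeFn_highFreq hs
  rw [ft_translate hu.memLp] at h1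
  filter_upwards [h1, coeFn_mulPhase a (ft u), coeFn_mulPhase a (highFreq m u),
    coeFn_highFreq hu] with ξ h1 h2 h3 h4
  rw [h1, h2, h3, h4, smul_comm]

theorem MemX.shift {m : ℕ} {μ : ℝ} {u : Space K L → ℝ} (hu : MemX m μ u)
    (z : EuclideanSpace ℝ (Fin L)) : MemX m μ (shift z u) := by
  have hp : potTerm m μ (SingularPolyharmonic.shift z u) =
      fun x => potTerm m μ u (x + pair 0 z) := by
    ext x
    simp only [potTerm, SingularPolyharmonic.shift, yPart_add_pair_zero]
  rw [memX_iff]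
  refine ⟨(mulPhase_smul_comm hu.sob).1, fun A => ?_, ?_⟩
  · have h := (measurePreserving_add_right (volume : Measure (Space K L))
      (pair 0 z)).quasiMeasurePreserving.ae (hu.2.1 A)
    filter_upwards [h] with x hx
    simp only [SingularPolyharmonic.shift, pair_add_pair_zero]
    rw [yPart_add_pair_zero, zPart_add_pair_zero] at hx
    exact hx
  · rw [hp]
    exact hu.pot.comp_measurePreserving (measurePreserving_add_right volume _)

theorem toModel_shift {m : ℕ} {μ : ℝ} {u : Space K L → ℝ} (hu : MemX m μ u)
    (z : EuclideanSpace ℝ (Fin L)) : toModel m μ (shift z u) = modelShift z (toModel m μ u) := by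
  refine Model.ext3 ?_ ?_ ?_
  · exact ft_translate hu.memLp _
  · exact (mulPhase_smul_comm hu.sob).2
  · have hp : potTerm m μ (shift z u) = fun x => potTerm m μ u (x + pair 0 z) := by
      ext x
      simp only [potTerm, shift, yPart_add_pair_zero]
    rw [toModel_two, hp]
    exact ft_translate hu.pot _

theorem integral_sq_eq {m : ℕ} {μ : ℝ} {u : Space K L → ℝ} (hu : MemX m μ u) :
    ∫ x, u x ^ 2 = ‖toModel m μ u 0‖ ^ 2 := (norm_ft_sq hu.memLp).symm

theorem integral_nabla_eq {m : ℕ} {μ : ℝ} {u : Space K L → ℝ} (hu : MemX m μ u) :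
    ∫ x, nablaPowSq m u x = ‖toModel m μ u 1‖ ^ 2 := by
  rw [integral_nablaPowSq hu.sob, toModel_one, L2C.norm_sq]
  refine integral_congr_ae ?_
  filter_upwards [coeFn_highFreq hu.sob] with ξ h
  rw [h, norm_smul, Real.norm_of_nonneg (by positivity)]

theorem integral_pot_eq {m : ℕ} {μ : ℝ} {u : Space K L → ℝ} (hu : MemX m μ u) :
    |μ| * ∫ x, u x ^ 2 / ‖yPart x‖ ^ (2 * m) = ‖toModel m μ u 2‖ ^ 2 := by
  rw [toModel_two, norm_ft_sq hu.pot]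
  simp_rw [potTerm_sq]
  rw [integral_const_mul]

/-- The third component carries `|μ|^(1/2)`, so only the sign of `μ` is left over; for `μ = 0` that
component is zero. -/
theorem formSq_eq {m : ℕ} {μ : ℝ} {u : Space K L → ℝ} (hu : MemX m μ u) :
    formSq m μ u = ‖toModel m μ u 1‖ ^ 2 + SignType.sign μ * ‖toModel m μ u 2‖ ^ 2 := by
  rw [formSq, integral_nabla_eq hu, ← integral_pot_eq hu, ← mul_assoc, sign_mul_abs]

end Model

end SingularPolyharmonic

namespace SingularPolyharmonic

open FourierTransform RealInnerProductSpace

/-! ### Equivalence of norms, weak convergence and completeness. -/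

section NormX

variable {K L : ℕ}

/-- For `μ ≥ 0` the two norms agree. For `μ < 0` the Hardy–Rellich inequality bounds the potential
term by a fraction `θ < 1` of the gradient term, and this strict inequality is the admissibility of
`μ`. -/
theorem exists_norm_toModel_le {m : ℕ} (hm : 1 ≤ m) {μ : ℝ} (hμ : AdmissiblePotential K m μ) :
    (∃ C : ℝ, ∀ u : Space K L → ℝ, MemX m μ u → ‖toModel m μ u‖ ≤ C * normX m μ u) ∧
      ∀ u : Space K L → ℝ, MemX m μ u → normX m μ u ≤ ‖toModel m μ u‖ := by
  have hform : ∀ u : Space K L → ℝ, MemX m μ u → formSq m μ u + ∫ x, u x ^ 2 =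
      ‖toModel m μ u 0‖ ^ 2 + ‖toModel m μ u 1‖ ^ 2 +
        SignType.sign μ * ‖toModel m μ u 2‖ ^ 2 := by
    intro u hu
    rw [formSq_eq hu, integral_sq_eq hu]
    ring
  refine ⟨?_, fun u hu => ?_⟩
  · rcases le_or_gt 0 μ with h0 | h0
    · refine ⟨1, fun u hu => ?_⟩
      rw [one_mul, normX, hform u hu]
      refine Real.le_sqrt_of_sq_le ?_
      rw [Model.norm_sq]
      rcases h0.eq_or_lt with h | h
      · have h2 := integral_pot_eq hu
        rw [← h, abs_zero, zero_mul] at h2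
        rw [← h, ← h2]
        simp
      · rw [sign_pos h]
        simp
    · rcases hμ with ⟨hK, hlt⟩ | ⟨-, h⟩
      swap
      · exact absurd h h0.not_ge
      change -(rellichConst K m ^ 2) < μ at hlt
      set G := rellichConst K m ^ 2 with hG
      have hGpos : 0 < G := by linarith
      set θ : ℝ := -μ / G with hθ
      have hθ1 : θ < 1 := by rw [hθ, div_lt_one hGpos]; linarith
      have hθ0 : 0 < θ := div_pos (by linarith) hGpos
      -- After clearing denominators this constant needs `(3 - θ) θ ≤ 1 + θ`, that is `(1 - θ)² ≥
      -- 0`.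
      refine ⟨√(2 / (1 - θ)), fun u hu => ?_⟩
      have hh := lintegral_hardy_rellich hm hK hu.sob
      have h2 : ‖toModel m μ u 2‖ ^ 2 ≤ θ * ‖toModel m μ u 1‖ ^ 2 := by
        rw [← integral_pot_eq hu, ← integral_nabla_eq hu]
        have hint : Integrable fun x => u x ^ 2 / ‖yPart x‖ ^ (2 * m) := by
          have := hu.pot.integrable_sq
          simp_rw [potTerm_sq] at this
          refine (this.const_mul |μ|⁻¹).congr (.of_forall fun x => ?_)
          have : |μ| ≠ 0 := abs_ne_zero.2 h0.ne
          field_simp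
        rw [← ofReal_integral_eq_lintegral_ofReal hint
          (.of_forall fun x => by simp only [Pi.zero_apply]; positivity),
          ← ENNReal.ofReal_mul hGpos.le, ENNReal.ofReal_le_ofReal_iff
            (by rw [integral_nabla_eq hu]; positivity)] at hh
        rw [abs_of_neg h0, hθ, div_mul_eq_mul_div, le_div_iff₀ hGpos]
        nlinarith
      rw [normX, hform u hu, ← Real.sqrt_mul (by have : 0 < 1 - θ := by linarith
                                                 positivity), sign_neg h0]
      refine Real.le_sqrt_of_sq_le ?_
      rw [Model.norm_sq, div_mul_eq_mul_div, le_div_iff₀ (by linarith)]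
      simp only [SignType.coe_neg_one]
      have t0 := mul_nonneg (sq_nonneg ‖toModel m μ u 0‖) (by linarith : 0 ≤ 1 + θ)
      have t1 := mul_nonneg (sq_nonneg ‖toModel m μ u 1‖) (sq_nonneg (1 - θ))
      have t2 := mul_le_mul_of_nonneg_right h2 (by linarith : 0 ≤ 3 - θ)
      linarith
  · rw [normX, hform u hu]
    refine Real.sqrt_le_iff.2 ⟨norm_nonneg _, ?_⟩
    rw [Model.norm_sq]
    have : (SignType.sign μ : ℝ) ≤ 1 := by
      rcases SignType.sign μ with _ | _ | _ <;> norm_num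
    nlinarith [sq_nonneg ‖toModel m μ u 2‖]

/-- A functional bounded by `normX` is bounded by the model norm, hence factors through the image of
the embedding; Hahn–Banach extends it to `Model` and Riesz represents it by a vector. -/
theorem weakConvX_of_toModel {m : ℕ} (hm : 1 ≤ m) {μ : ℝ} (hμ : AdmissiblePotential K m μ)
    {w : ℕ → Space K L → ℝ} {w₀ : Space K L → ℝ} (hw : ∀ n, MemX m μ (w n)) (hw₀ : MemX m μ w₀)
    (h : ∀ g : Model K L, Tendsto (fun n => ⟪toModel m μ (w n), g⟫) atTop
      (𝓝 ⟪toModel m μ w₀, g⟫)) : WeakConvX m μ w w₀ := by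
  rintro l ⟨C, hC⟩
  have hle := (exists_norm_toModel_le (L := L) hm hμ).2
  let J := embX K L m μ
  let l' : spaceX K L m μ →ₗ[ℝ] ℝ := l ∘ₗ (spaceX K L m μ).subtype
  have hl' : ∀ u : spaceX K L m μ, |l' u| ≤ |C| * ‖J u‖ := fun u =>
    (hC u u.2).trans (mul_le_mul (le_abs_self C) (hle u u.2) (Real.sqrt_nonneg _) (abs_nonneg C))
  have hker : LinearMap.ker J ≤ LinearMap.ker l' := by
    intro u hu
    rw [LinearMap.mem_ker] at hu ⊢
    have := hl' u
    rw [hu, norm_zero, mul_zero] at this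
    exact abs_nonpos_iff.1 this
  let f : LinearMap.range J →ₗ[ℝ] ℝ :=
    ((LinearMap.ker J).liftQ l' hker) ∘ₗ J.quotKerEquivRange.symm.toLinearMap
  have hf : ∀ u, f ⟨J u, LinearMap.mem_range_self J u⟩ = l' u := by
    intro u
    have : J.quotKerEquivRange.symm ⟨J u, LinearMap.mem_range_self J u⟩ =
        (LinearMap.ker J).mkQ u := by
      rw [LinearEquiv.symm_apply_eq]
      rfl
    simp only [f, LinearMap.comp_apply, LinearEquiv.coe_coe, this]
    simp
  let F : StrongDual ℝ (LinearMap.range J) := f.mkContinuous |C| (by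
    rintro ⟨_, u, rfl⟩
    rw [hf]
    exact hl' u)
  obtain ⟨Φ, hΦ, -⟩ := exists_extension_norm_eq (LinearMap.range J) F
  have hrep : ∀ u, MemX m μ u → l u = ⟪toModel m μ u, (InnerProductSpace.toDual ℝ _).symm Φ⟫ := by
    intro u hu
    rw [real_inner_comm, InnerProductSpace.toDual_symm_apply]
    have h1 := hΦ ⟨J ⟨u, hu⟩, LinearMap.mem_range_self J _⟩
    have h2 := hf ⟨u, hu⟩
    exact h2.symm.trans h1.symm
  simp_rw [hrep _ (hw _), hrep _ hw₀]
  exact h _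

/-- Multiplication by an arbitrary function is a closed operator: pass to a subsequence along which
both sequences converge almost everywhere. -/
theorem ae_eq_smul_of_tendsto {F G : ℕ → L2C (Space K L)} {F₀ G₀ : L2C (Space K L)}
    (hF : Tendsto F atTop (𝓝 F₀)) (hG : Tendsto G atTop (𝓝 G₀)) (a : Space K L → ℝ)
    (h : ∀ n, G n =ᵐ[volume] fun ξ => a ξ • F n ξ) : G₀ =ᵐ[volume] fun ξ => a ξ • F₀ ξ := by
  obtain ⟨s, hs, hsF⟩ := (tendstoInMeasure_of_tendsto_Lp hF).exists_seq_tendsto_ae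
  obtain ⟨r, hr, hrG⟩ := (tendstoInMeasure_of_tendsto_Lp
    (hG.comp hs.tendsto_atTop)).exists_seq_tendsto_ae
  filter_upwards [hsF, hrG, ae_all_iff.2 h] with ξ h1 h2 h3
  refine tendsto_nhds_unique h2 ?_
  have := ((h1.comp hr.tendsto_atTop).const_smul (a ξ))
  refine this.congr fun n => ?_
  simp only [Function.comp_apply]
  exact (h3 _).symm

theorem tendsto_toLp_ofReal_iff {u : ℕ → Space K L → ℝ} {v : Space K L → ℝ}
    (hu : ∀ n, MemLp (u n) 2) (hv : MemLp v 2) :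
    Tendsto (fun n => ft (u n)) atTop (𝓝 (ft v)) ↔
      Tendsto (fun n => ((memLp_ofReal (hu n)).toLp : L2C (Space K L))) atTop
        (𝓝 (memLp_ofReal hv).toLp) := by
  rw [ft_of_memLp hv]
  simp_rw [ft_of_memLp (hu _)]
  exact (Lp.fourierTransformₗᵢ (Space K L) ℂ).isometry.isEmbedding.tendsto_nhds_iff.symm

/-- The second and third components depend on the first through closed multiplication operators, one
in frequency and one in space. Reality and invariance under rotations are closed conditions too. -/
theorem isClosed_range_embX (m : ℕ) (μ : ℝ) :
    IsClosed (LinearMap.range (embX K L m μ) : Set (Model K L)) := by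
  rw [← isSeqClosed_iff_isClosed]
  intro h h₀ hmem hlim
  choose u hu using hmem
  have hX : ∀ n, MemX m μ (u n : Space K L → ℝ) := fun n => (u n).2
  have hcomp : ∀ k, Tendsto (fun n => toModel m μ (u n) k) atTop (𝓝 (h₀ k)) := by
    intro k
    have hc : Continuous fun h : Model K L => h k := by fun_prop
    refine ((hc.tendsto h₀).comp hlim).congr fun n => ?_
    simp only [Function.comp_apply, ← hu n]
    rfl
  have h0 : Tendsto (fun n => ft (u n)) atTop (𝓝 (h₀ 0)) := hcomp 0
  have h1 : Tendsto (fun n => highFreq m (u n)) atTop (𝓝 (h₀ 1)) := hcomp 1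
  have h2 : Tendsto (fun n => ft (potTerm m μ (u n))) atTop (𝓝 (h₀ 2)) := hcomp 2
  obtain ⟨v, hv, hv0⟩ := exists_ft_eq_of_tendsto (fun n => (hX n).memLp) h0
  obtain ⟨p, hp, hp0⟩ := exists_ft_eq_of_tendsto (fun n => (hX n).pot) h2
  have e1 : h₀ 1 =ᵐ[volume] fun ξ => (2 * Real.pi * ‖ξ‖) ^ m • ft v ξ := by
    rw [hv0]
    exact ae_eq_smul_of_tendsto h0 h1 (fun ξ => (2 * Real.pi * ‖ξ‖) ^ m)
      fun n => coeFn_highFreq (hX n).sob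
  have hsob : MemSob m v := by
    refine memSob_iff.2 ⟨hv, ?_⟩
    refine (((Lp.memLp (h₀ 1)).const_smul ((2 * Real.pi) ^ m)⁻¹)).ae_eq ?_
    filter_upwards [e1] with ξ hξ
    have : (2 * Real.pi) ^ m ≠ 0 := by positivity
    rw [Pi.smul_apply, hξ, smul_smul, mul_pow (2 * Real.pi), inv_mul_cancel_left₀ this]
  have e2 : p =ᵐ[volume] potTerm m μ v := by
    rw [← hv0] at h0
    rw [← hp0] at h2
    rw [tendsto_toLp_ofReal_iff (fun n => (hX n).memLp) hv] at h0
    rw [tendsto_toLp_ofReal_iff (fun n => (hX n).pot) hp] at h2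
    have := ae_eq_smul_of_tendsto h0 h2 (fun x => √|μ| / ‖yPart x‖ ^ m) fun n => by
      filter_upwards [coeFn_toLp_ofReal (hX n).memLp, coeFn_toLp_ofReal (hX n).pot] with x h1 h2
      rw [h1, h2, potTerm, Complex.real_smul]
      push_cast
      ring
    filter_upwards [this, coeFn_toLp_ofReal hv, coeFn_toLp_ofReal hp] with x h1 h2 h3
    rw [h2, h3, Complex.real_smul] at h1
    rw [potTerm]
    have h4 : p x = √|μ| / ‖yPart x‖ ^ m * v x := by exact_mod_cast h1
    rw [h4]
    ring
  have hcyl : IsCylindrical v := by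
    rw [isCylindrical_iff_ft hv, hv0]
    intro A B hB
    refine tendsto_nhds_unique (((rotateL2 B).continuous.tendsto _).comp h0) ?_
    refine h0.congr fun n => ?_
    exact ((isCylindrical_iff_ft (hX n).memLp).1 (hX n).2.1 A B hB).symm
  have hvX : MemX m μ v := memX_iff.2 ⟨hsob, hcyl, hp.ae_eq e2⟩
  refine ⟨⟨v, hvX⟩, ?_⟩
  refine Model.ext3 hv0 ?_ ?_
  · change highFreq m v = h₀ 1
    ext1
    exact (coeFn_highFreq hsob).trans e1.symm
  · change ft (potTerm m μ v) = h₀ 2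
    rw [← ft_congr e2, hp0]

/-- A closed subspace is its own double orthogonal complement, hence weakly closed. Weak limits in
`Model` therefore come from actual functions. -/
theorem exists_toModel_eq_of_weakLimit {m : ℕ} {μ : ℝ} {F : Filter ℕ} [F.NeBot]
    {w : ℕ → Space K L → ℝ} (hw : ∀ n, MemX m μ (w n)) {h₀ : Model K L}
    (h : ∀ g : Model K L, Tendsto (fun n => ⟪toModel m μ (w n), g⟫) F (𝓝 ⟪h₀, g⟫)) :
    ∃ v, MemX m μ v ∧ toModel m μ v = h₀ := by
  have hcl := isClosed_range_embX (K := K) (L := L) m μ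
  have : CompleteSpace (LinearMap.range (embX K L m μ)) := hcl.completeSpace_coe
  have hmem : h₀ ∈ LinearMap.range (embX K L m μ) := by
    rw [← Submodule.orthogonal_orthogonal (LinearMap.range (embX K L m μ))]
    rw [Submodule.mem_orthogonal']
    intro g hg
    refine tendsto_nhds_unique (h g) ?_
    refine tendsto_const_nhds.congr fun n => ?_
    rw [Submodule.mem_orthogonal] at hg
    exact (hg _ (LinearMap.mem_range_self (embX K L m μ) ⟨w n, hw n⟩)).symm
  obtain ⟨u, hu⟩ := hmem
  exact ⟨u, u.2, hu⟩

end NormX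

end SingularPolyharmonic

namespace SingularPolyharmonic

open FourierTransform RealInnerProductSpace

/-! ### Dyadic estimates for functions of finite Sobolev energy. -/

section Tail

variable {E : Type*} [NormedAddCommGroup E] [InnerProductSpace ℝ E] [FiniteDimensional ℝ E]
  [MeasurableSpace E] [BorelSpace E]

theorem volume_ball_eq_pow_mul {r : ℝ} (hr : 0 < r) :
    volume (Metric.ball (0 : E) r) =
      ENNReal.ofReal (r ^ Module.finrank ℝ E * volume.real (Metric.ball (0 : E) 1)) := by
  rw [Measure.addHaar_ball_of_pos _ _ hr, ENNReal.ofReal_mul (by positivity), ofReal_measureReal]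

/-- Summation over dyadic shells: the shell at radius `2^j` contributes a multiple of
`(2^(N-2m))^j`. The sum is geometric for `N > 2m` and grows linearly in `k` for `N = 2m`, which
separates power growth from exponential growth. -/
theorem lintegral_inv_weight_ball_le {m : ℕ} (hm : 2 * m ≤ Module.finrank ℝ E) :
    ∃ C : ℝ, 0 < C ∧ ∀ k : ℕ, ∫⁻ ξ in Metric.ball (0 : E) (2 ^ k),
      ENNReal.ofReal (1 + ‖ξ‖ ^ (2 * m))⁻¹ ≤
        ENNReal.ofReal (C * (1 + ∑ j ∈ Finset.range k, (2 ^ (Module.finrank ℝ E - 2 * m)) ^ j)) := by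
  set N := Module.finrank ℝ E with hN
  set V := volume.real (Metric.ball (0 : E) 1) with hV
  have hV0 : 0 ≤ V := measureReal_nonneg
  refine ⟨2 ^ N * V + 1, by positivity, fun k => ?_⟩
  induction k with
  | zero =>
    refine (lintegral_mono (g := fun _ => 1) fun ξ => ?_).trans ?_
    · rw [← ENNReal.ofReal_one]
      refine ENNReal.ofReal_le_ofReal (inv_le_one_of_one_le₀ ?_)
      have : 0 ≤ ‖ξ‖ ^ (2 * m) := by positivity
      linarith
    · simp only [setLIntegral_one, pow_zero, Finset.range_zero, Finset.sum_empty]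
      rw [volume_ball_eq_pow_mul one_pos]
      refine ENNReal.ofReal_le_ofReal ?_
      have : (1 : ℝ) ≤ 2 ^ N := one_le_pow₀ (by norm_num)
      simp only [one_pow, ← hV]
      nlinarith
  | succ k ih =>
    have hsub : Metric.ball (0 : E) (2 ^ (k + 1)) ⊆ Metric.ball 0 (2 ^ k) ∪
        (Metric.ball 0 (2 ^ (k + 1)) \ Metric.ball 0 (2 ^ k)) := by
      intro x hx
      by_cases h : x ∈ Metric.ball (0 : E) (2 ^ k)
      · exact Or.inl h
      · exact Or.inr ⟨hx, h⟩
    refine (lintegral_mono_set hsub).trans ((lintegral_union_le _ _ _).trans ?_)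
    have hshell : ∫⁻ ξ in Metric.ball (0 : E) (2 ^ (k + 1)) \ Metric.ball 0 (2 ^ k),
        ENNReal.ofReal (1 + ‖ξ‖ ^ (2 * m))⁻¹ ≤
        ENNReal.ofReal ((2 ^ N * V + 1) * (2 ^ (N - 2 * m)) ^ k) := by
      refine (setLIntegral_mono (g := fun _ => ENNReal.ofReal (((2 : ℝ) ^ k) ^ (2 * m))⁻¹)
        measurable_const fun ξ hξ => ?_).trans ?_
      · refine ENNReal.ofReal_le_ofReal (inv_anti₀ (by positivity) ?_)
        have h1 : (2 : ℝ) ^ k ≤ ‖ξ‖ := by simpa using hξ.2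
        have := pow_le_pow_left₀ (by positivity) h1 (2 * m)
        linarith
      · rw [setLIntegral_const]
        refine (mul_le_mul_right (measure_mono Set.sdiff_subset) _).trans ?_
        rw [volume_ball_eq_pow_mul (by positivity), ← ENNReal.ofReal_mul (by positivity)]
        refine ENNReal.ofReal_le_ofReal ?_
        rw [← hN, ← hV]
        have e : ((2 : ℝ) ^ (k + 1)) ^ N = 2 ^ N * ((2 ^ (N - 2 * m)) ^ k * (2 ^ k) ^ (2 * m)) := by
          rw [← pow_mul, ← pow_mul, ← pow_mul, ← pow_add, ← pow_add]
          congr 1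
          obtain ⟨d, hd⟩ := Nat.exists_eq_add_of_le hm
          rw [hd]
          simp only [Nat.add_sub_cancel_left]
          ring
        rw [e]
        have : (0 : ℝ) < (2 ^ k) ^ (2 * m) := by positivity
        field_simp
        have : (0 : ℝ) ≤ (2 ^ (N - 2 * m)) ^ k := by positivity
        nlinarith
    refine (add_le_add ih hshell).trans ?_
    rw [← ENNReal.ofReal_add (by positivity) (by positivity), Finset.sum_range_succ]
    refine ENNReal.ofReal_le_ofReal (le_of_eq ?_)
    ring

/-- Cauchy–Schwarz with weight `1 + |ξ|^(2m)`, in the form of a pointwise weighted mean inequality,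
so that lower integrals suffice. -/
theorem norm_lowPass_le {m : ℕ} {F : L2C E} {B A R : ℝ} (hB : 0 < B) (hA : 0 < A)
    (hF : ∫⁻ ξ, ENNReal.ofReal ((1 + ‖ξ‖ ^ (2 * m)) * ‖F ξ‖ ^ 2) ≤ ENNReal.ofReal (B ^ 2))
    (hR : ∫⁻ ξ in Metric.ball (0 : E) R, ENNReal.ofReal (1 + ‖ξ‖ ^ (2 * m))⁻¹ ≤
      ENNReal.ofReal (A ^ 2)) (x : E) :
    ‖lowPass R F x‖ ≤ A * B := by
  have h1 : ENNReal.ofReal ‖lowPass R F x‖ ≤ ∫⁻ ξ in Metric.ball (0 : E) R, ENNReal.ofReal ‖F ξ‖ := by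
    rw [lowPass, ofReal_norm]
    refine (enorm_integral_le_lintegral_enorm _).trans (le_of_eq (lintegral_congr fun ξ => ?_))
    rw [← ofReal_norm, Circle.norm_smul]
  have h2 : ∀ ξ : E, ENNReal.ofReal ‖F ξ‖ ≤ ENNReal.ofReal (B / (2 * A)) *
      ENNReal.ofReal (1 + ‖ξ‖ ^ (2 * m))⁻¹ + ENNReal.ofReal (A / (2 * B)) *
        ENNReal.ofReal ((1 + ‖ξ‖ ^ (2 * m)) * ‖F ξ‖ ^ 2) := by
    intro ξ
    have hW : 0 < 1 + ‖ξ‖ ^ (2 * m) := by positivity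
    rw [← ENNReal.ofReal_mul (by positivity), ← ENNReal.ofReal_mul (by positivity),
      ← ENNReal.ofReal_add (by positivity) (by positivity)]
    refine ENNReal.ofReal_le_ofReal ?_
    set W := 1 + ‖ξ‖ ^ (2 * m)
    have : B / (2 * A) * W⁻¹ + A / (2 * B) * (W * ‖F ξ‖ ^ 2) - ‖F ξ‖ =
        (B - A * W * ‖F ξ‖) ^ 2 / (2 * A * B * W) := by
      field_simp
      ring
    have h3 : 0 ≤ (B - A * W * ‖F ξ‖) ^ 2 / (2 * A * B * W) := by positivity
    linarith
  have hm1 : Measurable fun ξ : E => ENNReal.ofReal (1 + ‖ξ‖ ^ (2 * m))⁻¹ := by fun_prop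
  have h3 : ENNReal.ofReal ‖lowPass R F x‖ ≤ ENNReal.ofReal (A * B) := by
    refine h1.trans ((lintegral_mono h2).trans ?_)
    rw [lintegral_add_left (hm1.const_mul _), lintegral_const_mul' _ _ ENNReal.ofReal_ne_top,
      lintegral_const_mul' _ _ ENNReal.ofReal_ne_top]
    refine (add_le_add (mul_le_mul_right hR _)
      (mul_le_mul_right ((setLIntegral_le_lintegral _ _).trans hF) _)).trans (le_of_eq ?_)
    rw [← ENNReal.ofReal_mul (by positivity), ← ENNReal.ofReal_mul (by positivity),
      ← ENNReal.ofReal_add (by positivity) (by positivity)]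
    congr 1
    field_simp
    ring
  exact (ENNReal.ofReal_le_ofReal_iff (by positivity)).1 h3

/-- Chebyshev's inequality for the part of `u` with frequencies of size at least `R`. -/
theorem measure_le_of_norm_lowPass_le {u : E → ℝ} (hu : MemLp u 2) {R η : ℝ} (hη : 0 < η)
    {S : Set E} (hS : ∀ᵐ x, x ∈ S → η ≤ ‖(u x : ℂ) - lowPass R (ft u) x‖) :
    volume S ≤ ENNReal.ofReal (1 / η ^ 2) *
      ∫⁻ ξ in (Metric.ball (0 : E) R)ᶜ, ENNReal.ofReal (‖ft u ξ‖ ^ 2) := by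
  rw [← lintegral_sub_lowPass_sq R hu]
  have hcont : Continuous fun x => lowPass R (ft u) x := by
    simp_rw [lowPass_eq_inner]
    exact Continuous.inner ((continuous_mulPhase _).comp continuous_neg) continuous_const
  have hmeas : AEMeasurable fun x => ENNReal.ofReal (‖(u x : ℂ) - lowPass R (ft u) x‖ ^ 2) := by
    have := ((memLp_ofReal hu).aestronglyMeasurable.sub hcont.aestronglyMeasurable).norm
    exact (this.aemeasurable.pow_const 2).ennreal_ofReal
  have h1 : volume S ≤ volume {x | ENNReal.ofReal (η ^ 2) ≤
      ENNReal.ofReal (‖(u x : ℂ) - lowPass R (ft u) x‖ ^ 2)} := by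
    refine measure_mono_ae ?_
    filter_upwards [hS] with x hx hxS
    exact ENNReal.ofReal_le_ofReal (pow_le_pow_left₀ hη.le (hx hxS) 2)
  have h2 := mul_meas_ge_le_lintegral₀ hmeas (ENNReal.ofReal (η ^ 2))
  have h3 : ENNReal.ofReal (1 / η ^ 2) * ENNReal.ofReal (η ^ 2) = 1 := by
    rw [← ENNReal.ofReal_mul (by positivity), ← ENNReal.ofReal_one]
    congr 1
    field_simp
  calc volume S ≤ ENNReal.ofReal (1 / η ^ 2) * (ENNReal.ofReal (η ^ 2) * volume S) := by
        rw [← mul_assoc, h3, one_mul]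
    _ ≤ _ := by
        gcongr
        exact (mul_le_mul_right h1 _).trans h2

theorem sum_indicator_dyadic_le {m : ℕ} (hm : 1 ≤ m) (t : ℝ) (ht : 0 ≤ t) :
    ∑' k : ℕ, (if (2 : ℝ) ^ k ≤ t then ENNReal.ofReal ((4 ^ m) ^ k) else 0) ≤
      ENNReal.ofReal (2 * t ^ (2 * m)) := by
  refine ENNReal.tsum_le_of_sum_range_le fun n => ?_
  have hr : (4 : ℝ) ≤ 4 ^ m := le_self_pow₀ (by norm_num) (by omega)
  -- A geometric sum is comparable to its last term. The second bound says that all earlier terms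
  -- together do not exceed the one about to be added; it carries the induction.
  have key : ∀ n : ℕ, ∑ k ∈ Finset.range n, (if (2 : ℝ) ^ k ≤ t then (4 ^ m : ℝ) ^ k else 0) ≤
      2 * t ^ (2 * m) ∧ ∑ k ∈ Finset.range n, (if (2 : ℝ) ^ k ≤ t then (4 ^ m : ℝ) ^ k else 0) ≤
        (4 ^ m : ℝ) ^ n := by
    intro n
    induction n with
    | zero => simp; positivity
    | succ n ih =>
      have hp : (0 : ℝ) < (4 ^ m) ^ n := by positivity
      have e : ((4 : ℝ) ^ m) ^ (n + 1) = 4 ^ m * (4 ^ m) ^ n := pow_succ' _ _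
      rw [Finset.sum_range_succ]
      split_ifs with h
      · have : ((4 : ℝ) ^ m) ^ n ≤ t ^ (2 * m) := by
          have := pow_le_pow_left₀ (by positivity) h (2 * m)
          refine le_trans (le_of_eq ?_) this
          rw [show (4 : ℝ) = 2 ^ 2 by norm_num, ← pow_mul, ← pow_mul, ← pow_mul]
          congr 1
          ring
        refine ⟨by linarith [ih.2], ?_⟩
        rw [e]
        nlinarith [ih.2]
      · rw [add_zero]
        refine ⟨ih.1, ih.2.trans ?_⟩
        rw [e]
        nlinarith
  refine le_trans (le_of_eq ?_) (ENNReal.ofReal_le_ofReal (key n).1)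
  rw [ENNReal.ofReal_sum_of_nonneg (fun k _ => by split_ifs <;> positivity)]
  refine Finset.sum_congr rfl fun k _ => ?_
  split_ifs <;> simp

/-- The dyadic splitting estimate behind the critical Sobolev and Trudinger inequalities. -/
theorem lintegral_comp_abs_le {m : ℕ} (hm : 1 ≤ m) {B C : ℝ} (hC : 0 ≤ C)
    {Φ : ℝ → ℝ} {a : ℕ → ℝ} (ha : ∀ k, 0 < a k) (ha' : Tendsto a atTop atTop)
    (hΦ : MonotoneOn Φ (Set.Ici (a 0)))
    (hbound : ∀ k, Φ (a (k + 1)) * 4 ≤ C * (4 ^ m) ^ k * a k ^ 2)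
    {u : E → ℝ} (hu : MemLp u 2)
    (hF : ∫⁻ ξ, ENNReal.ofReal ((1 + ‖ξ‖ ^ (2 * m)) * ‖ft u ξ‖ ^ 2) ≤ ENNReal.ofReal (B ^ 2))
    (hlow : ∀ k x, ‖lowPass (2 ^ k) (ft u) x‖ ≤ a k / 2) :
    ∫⁻ x in {x | a 0 ≤ |u x|}, ENNReal.ofReal (Φ |u x|) ≤ ENNReal.ofReal (2 * C * B ^ 2) := by
  have habs : AEMeasurable (fun x => |u x|) := hu.aestronglyMeasurable.norm.aemeasurable
  have hS : ∀ k, NullMeasurableSet {x | a k ≤ |u x|} := fun k =>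
    nullMeasurableSet_le aemeasurable_const habs
  -- Where `a k ≤ |u| < a (k + 1)`, monotonicity gives `Φ |u| ≤ Φ (a (k + 1))`, and the `k`-th
  -- summand alone suffices.
  have hpt : ∀ x, x ∈ {x | a 0 ≤ |u x|} → ENNReal.ofReal (Φ |u x|) ≤
      ∑' k, {x | a k ≤ |u x|}.indicator (fun _ => ENNReal.ofReal (Φ (a (k + 1)))) x := by
    intro x hx
    have hex : ∃ k, |u x| < a k := (ha'.eventually_gt_atTop |u x|).exists
    classical
    have h0 : Nat.find hex ≠ 0 := by
      intro h
      have := Nat.find_spec hex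
      rw [h] at this
      exact absurd hx (not_le.2 this)
    obtain ⟨k, hk⟩ := Nat.exists_eq_succ_of_ne_zero h0
    have h1 : |u x| < a (k + 1) := by
      have := Nat.find_spec hex
      rwa [hk] at this
    have h2 : a k ≤ |u x| := not_lt.1 (Nat.find_min hex (by omega))
    refine le_trans ?_ (ENNReal.le_tsum k)
    rw [Set.indicator_of_mem (by exact h2)]
    exact ENNReal.ofReal_le_ofReal (hΦ hx (hx.out.trans h1.le) h1.le)
  -- At height `a k` the cut is made at frequency `2^k`: the low part is at most `a k / 2`, so the
  -- high part is at least `a k / 2` there and Chebyshev applies.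
  have hvol : ∀ k, ENNReal.ofReal (Φ (a (k + 1))) * volume {x | a k ≤ |u x|} ≤
      ENNReal.ofReal C * ∫⁻ ξ, (if (2 : ℝ) ^ k ≤ ‖ξ‖ then ENNReal.ofReal ((4 ^ m) ^ k) else 0) *
        ENNReal.ofReal (‖ft u ξ‖ ^ 2) := by
    intro k
    have h1 := measure_le_of_norm_lowPass_le hu (R := 2 ^ k) (η := a k / 2)
      (S := {x | a k ≤ |u x|}) (half_pos (ha k)) (.of_forall fun x hx => by
        have h2 : a k ≤ ‖(u x : ℂ)‖ := by
          rw [Complex.norm_real]; exact hx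
        have := norm_sub_norm_le (u x : ℂ) (lowPass (2 ^ k) (ft u) x)
        linarith [hlow k x])
    refine (mul_le_mul_right h1 _).trans ?_
    have e : ∫⁻ ξ, (if (2 : ℝ) ^ k ≤ ‖ξ‖ then ENNReal.ofReal ((4 ^ m) ^ k) else 0) *
        ENNReal.ofReal (‖ft u ξ‖ ^ 2) = ENNReal.ofReal ((4 ^ m) ^ k) *
          ∫⁻ ξ in (Metric.ball (0 : E) (2 ^ k))ᶜ, ENNReal.ofReal (‖ft u ξ‖ ^ 2) := by
      rw [← lintegral_const_mul' _ _ ENNReal.ofReal_ne_top,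
        ← lintegral_indicator Metric.isOpen_ball.measurableSet.compl]
      refine lintegral_congr fun ξ => ?_
      by_cases h : (2 : ℝ) ^ k ≤ ‖ξ‖
      · rw [if_pos h, Set.indicator_of_mem (by simpa using h)]
      · rw [if_neg h, Set.indicator_of_notMem (by simpa using h), zero_mul]
    rw [e, ← mul_assoc, ← mul_assoc]
    refine mul_le_mul_left ?_ _
    rw [← ENNReal.ofReal_mul' (by positivity), ← ENNReal.ofReal_mul hC]
    refine ENNReal.ofReal_le_ofReal ?_
    have := hbound k
    have h4 := ha k
    rw [mul_one_div, div_le_iff₀ (by positivity)]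
    nlinarith
  calc ∫⁻ x in {x | a 0 ≤ |u x|}, ENNReal.ofReal (Φ |u x|)
      ≤ ∫⁻ x in {x | a 0 ≤ |u x|},
        ∑' k, {x | a k ≤ |u x|}.indicator (fun _ => ENNReal.ofReal (Φ (a (k + 1)))) x :=
        lintegral_mono_ae ((ae_restrict_iff'₀ (hS 0)).2 (.of_forall hpt))
    _ ≤ ∫⁻ x, ∑' k, {x | a k ≤ |u x|}.indicator (fun _ => ENNReal.ofReal (Φ (a (k + 1)))) x :=
        setLIntegral_le_lintegral _ _
    _ = ∑' k, ENNReal.ofReal (Φ (a (k + 1))) * volume {x | a k ≤ |u x|} := by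
        rw [lintegral_tsum fun k => aemeasurable_const.indicator₀ (hS k)]
        refine tsum_congr fun k => ?_
        rw [lintegral_indicator₀ (hS k), setLIntegral_const]
    _ ≤ ∑' k, ENNReal.ofReal C * ∫⁻ ξ, (if (2 : ℝ) ^ k ≤ ‖ξ‖ then ENNReal.ofReal ((4 ^ m) ^ k)
        else 0) * ENNReal.ofReal (‖ft u ξ‖ ^ 2) := ENNReal.tsum_le_tsum hvol
    _ = ENNReal.ofReal C * ∫⁻ ξ, (∑' k : ℕ, if (2 : ℝ) ^ k ≤ ‖ξ‖ then ENNReal.ofReal ((4 ^ m) ^ k)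
        else 0) * ENNReal.ofReal (‖ft u ξ‖ ^ 2) := by
        rw [ENNReal.tsum_mul_left, ← lintegral_tsum]
        · simp_rw [ENNReal.tsum_mul_right]
        · intro k
          refine AEMeasurable.mul ?_ ?_
          · exact (Measurable.ite (measurableSet_le measurable_const measurable_norm)
              measurable_const measurable_const).aemeasurable
          · exact ((Lp.aestronglyMeasurable (ft u)).norm.aemeasurable.pow_const 2).ennreal_ofReal
    _ ≤ ENNReal.ofReal C * ∫⁻ ξ, ENNReal.ofReal 2 *
          ENNReal.ofReal ((1 + ‖ξ‖ ^ (2 * m)) * ‖ft u ξ‖ ^ 2) := by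
        refine mul_le_mul_right (lintegral_mono fun ξ => ?_) _
        refine (mul_le_mul_left (sum_indicator_dyadic_le hm ‖ξ‖ (norm_nonneg _)) _).trans ?_
        rw [← ENNReal.ofReal_mul (by positivity), ← ENNReal.ofReal_mul (by positivity)]
        refine ENNReal.ofReal_le_ofReal ?_
        nlinarith [sq_nonneg ‖ft u ξ‖]
    _ ≤ ENNReal.ofReal C * (ENNReal.ofReal 2 * ENNReal.ofReal (B ^ 2)) := by
        rw [lintegral_const_mul' _ _ ENNReal.ofReal_ne_top]
        exact mul_le_mul_right (mul_le_mul_right hF _) _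
    _ = ENNReal.ofReal (2 * C * B ^ 2) := by
        rw [← ENNReal.ofReal_mul (by positivity), ← ENNReal.ofReal_mul (by positivity)]
        congr 1
        ring

end Tail

end SingularPolyharmonic

namespace SingularPolyharmonic

open FourierTransform RealInnerProductSpace

/-! ### The critical growth function, for `N > 2m` and for `N = 2m`. -/

section Growth

theorem one_add_sum_two_pow_pow_le {d : ℕ} (hd : d ≠ 0) (k : ℕ) :
    1 + ∑ j ∈ Finset.range k, ((2 : ℝ) ^ d) ^ j ≤ (2 ^ d) ^ k := by
  have hρ : (2 : ℝ) ≤ 2 ^ d := le_self_pow₀ (by norm_num) hd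
  induction k with
  | zero => simp
  | succ k ih =>
    rw [Finset.sum_range_succ, pow_succ (2 ^ d : ℝ) k]
    have : (0 : ℝ) < (2 ^ d) ^ k := by positivity
    nlinarith

/-- The height attached to frequency `2^k` is twice the sup bound on the low frequency part, with `σ
k` dominating the shell sum. For `N > 2m` the growth function is the critical Sobolev power; for `N
= 2m` it is `exp (t² / D)`, a Trudinger bound with an exponent adapted to the norm bound `B`, enough
because `H` is below every exponential. -/
theorem exists_critical_growth {E : Type*} [NormedAddCommGroup E] [InnerProductSpace ℝ E]
    [FiniteDimensional ℝ E] [MeasurableSpace E] [BorelSpace E] {m : ℕ} (hm : 1 ≤ m)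
    (hN : 2 * m ≤ Module.finrank ℝ E) {B : ℝ} (hB : 0 < B) :
    ∃ (Φ : ℝ → ℝ) (M C : ℝ), 0 < M ∧ (∀ t, 0 < t → 0 < Φ t) ∧
      (∀ u : E → ℝ, MemLp u 2 → ∫⁻ ξ, ENNReal.ofReal ((1 + ‖ξ‖ ^ (2 * m)) * ‖ft u ξ‖ ^ 2) ≤
        ENNReal.ofReal (B ^ 2) →
        ∫⁻ x in {x | M ≤ |u x|}, ENNReal.ofReal (Φ |u x|) ≤ ENNReal.ofReal C) ∧
      ∀ H : ℝ → ℝ, SubcriticalAtInfinity (Module.finrank ℝ E) m H →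
        Tendsto (fun t => H t / Φ |t|) (cocompact ℝ) (𝓝 0) := by
  obtain ⟨A, hA, hAk⟩ := lintegral_inv_weight_ball_le hN
  set N := Module.finrank ℝ E with hNdef
  suffices h : ∃ (σ : ℕ → ℝ) (Φ : ℝ → ℝ) (C : ℝ), 0 ≤ C ∧ (∀ t, 0 < t → 0 < Φ t) ∧
      MonotoneOn Φ (Set.Ici 0) ∧ (∀ k, 1 + ∑ j ∈ Finset.range k, ((2 : ℝ) ^ (N - 2 * m)) ^ j ≤ σ k) ∧
      Tendsto σ atTop atTop ∧ (∀ k, Φ (√(4 * B ^ 2 * A * σ (k + 1))) * 4 ≤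
        C * (4 ^ m) ^ k * (4 * B ^ 2 * A * σ k)) ∧
      ∀ H : ℝ → ℝ, SubcriticalAtInfinity N m H →
        Tendsto (fun t => H t / Φ |t|) (cocompact ℝ) (𝓝 0) by
    obtain ⟨σ, Φ, C, hC, hpos, hmono, hσ, hσt, hb, hH⟩ := h
    have hσpos : ∀ k, 0 < σ k := fun k => lt_of_lt_of_le (by positivity) (hσ k)
    have hak : ∀ k, 0 < √(4 * B ^ 2 * A * σ k) := fun k =>
      Real.sqrt_pos.2 (mul_pos (by positivity) (hσpos k))
    refine ⟨Φ, √(4 * B ^ 2 * A * σ 0), 2 * C * B ^ 2, hak 0, hpos, fun u hu hF => ?_, hH⟩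
    refine lintegral_comp_abs_le (a := fun k => √(4 * B ^ 2 * A * σ k)) hm hC hak ?_
      (hmono.mono (Set.Ici_subset_Ici.2 (Real.sqrt_nonneg _))) (fun k => ?_) hu hF fun k x => ?_
    · exact Real.tendsto_sqrt_atTop.comp (hσt.const_mul_atTop (by positivity))
    · rw [Real.sq_sqrt (mul_pos (by positivity) (hσpos k)).le]
      exact hb k
    · have h1 := norm_lowPass_le (F := ft u) (A := √(A * σ k)) hB
        (Real.sqrt_pos.2 (mul_pos hA (hσpos k))) hF (R := 2 ^ k) (by
          rw [Real.sq_sqrt (mul_pos hA (hσpos k)).le]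
          exact (hAk k).trans (ENNReal.ofReal_le_ofReal (mul_le_mul_of_nonneg_left (hσ k) hA.le))) x
      refine h1.trans (le_of_eq ?_)
      rw [show 4 * B ^ 2 * A * σ k = (2 * B) ^ 2 * (A * σ k) by ring,
        Real.sqrt_mul (sq_nonneg _) (A * σ k), Real.sqrt_sq (by positivity)]
      ring
  rcases hN.lt_or_eq with hlt | heq
  · have hd : N - 2 * m ≠ 0 := by omega
    have hcast : ((N - 2 * m : ℕ) : ℝ) = (N : ℝ) - 2 * m := by
      rw [Nat.cast_sub hN]; push_cast; ring
    have hdpos : (0 : ℝ) < (N : ℝ) - 2 * m := by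
      rw [← hcast]; exact_mod_cast Nat.pos_of_ne_zero hd
    set q : ℝ := (N : ℝ) / ((N : ℝ) - 2 * m) with hq
    have hq0 : 0 ≤ q := by positivity
    have hD : 0 < 4 * B ^ 2 * A := by positivity
    set D := 4 * B ^ 2 * A
    have hρq : ((2 : ℝ) ^ (N - 2 * m)) ^ q = 2 ^ N := by
      rw [← Real.rpow_natCast, ← Real.rpow_mul (by norm_num), hcast, hq, mul_div_cancel₀ _ hdpos.ne',
        Real.rpow_natCast]
    refine ⟨fun k => (2 ^ (N - 2 * m)) ^ k, fun t => t ^ (2 * (N : ℝ) / ((N : ℝ) - 2 * m)),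
      4 * D ^ q * 2 ^ N / D, by positivity, fun t ht => by positivity, ?_,
      one_add_sum_two_pow_pow_le hd, ?_, fun k => ?_, fun H hH => hH.1 hlt⟩
    · intro a ha b hb hab
      exact Real.rpow_le_rpow ha hab (by positivity)
    · exact tendsto_pow_atTop_atTop_of_one_lt (one_lt_pow₀ (by norm_num) hd)
    · have h1 : √(D * (2 ^ (N - 2 * m)) ^ (k + 1)) ^ (2 * (N : ℝ) / ((N : ℝ) - 2 * m)) =
          D ^ q * (2 ^ N) ^ (k + 1) := by
        rw [Real.sqrt_eq_rpow, ← Real.rpow_mul (by positivity),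
          show (1 / 2 : ℝ) * (2 * (N : ℝ) / ((N : ℝ) - 2 * m)) = q by rw [hq]; ring,
          Real.mul_rpow hD.le (by positivity), ← Real.rpow_natCast ((2 : ℝ) ^ (N - 2 * m)),
          ← Real.rpow_mul (by positivity), mul_comm _ q, Real.rpow_mul (by positivity), hρq,
          Real.rpow_natCast]
      simp only []
      rw [h1]
      have h2 : ((4 : ℝ) ^ m) ^ k * (2 ^ (N - 2 * m)) ^ k = (2 ^ N) ^ k := by
        rw [← mul_pow]
        congr 1
        rw [show (4 : ℝ) = 2 ^ 2 by norm_num, ← pow_mul, ← pow_add]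
        congr 1
        omega
      have h3 : 4 * D ^ q * 2 ^ N / D * (4 ^ m) ^ k * (D * (2 ^ (N - 2 * m)) ^ k) =
          4 * D ^ q * 2 ^ N * (((4 : ℝ) ^ m) ^ k * (2 ^ (N - 2 * m)) ^ k) := by
        field_simp
      rw [h3, h2, pow_succ]
      apply le_of_eq
      ring
  · have hd : N - 2 * m = 0 := by omega
    have hD : 0 < 4 * B ^ 2 * A := by positivity
    set D := 4 * B ^ 2 * A
    -- The rate `D⁻¹` makes the value at the `k`-th height equal to `exp (k + 1)`, which the gain
    -- `(4^m)^k` beats because `e < 4`.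
    refine ⟨fun k => k + 1, fun t => Real.exp (D⁻¹ * t ^ 2), 4 * Real.exp 2 / D, by positivity,
      fun t _ => Real.exp_pos _, ?_, fun k => ?_, ?_, fun k => ?_, fun H hH => ?_⟩
    · intro a ha b hb hab
      have : a ^ 2 ≤ b ^ 2 := pow_le_pow_left₀ ha hab 2
      exact Real.exp_le_exp.2 (mul_le_mul_of_nonneg_left this (by positivity))
    · rw [hd]
      simp [add_comm]
    · exact tendsto_atTop_add_const_right _ _ tendsto_natCast_atTop_atTop
    · simp only []
      rw [Real.sq_sqrt (by positivity), inv_mul_cancel_left₀ hD.ne']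
      have e1 : Real.exp (((k + 1 : ℕ) : ℝ) + 1) = Real.exp 2 * Real.exp 1 ^ k := by
        rw [← Real.exp_nat_mul, ← Real.exp_add]
        congr 1
        push_cast
        ring
      have e2 : Real.exp 1 ^ k ≤ (4 ^ m) ^ k := by
        refine pow_le_pow_left₀ (Real.exp_pos _).le ?_ k
        have h4 : (4 : ℝ) ≤ 4 ^ m := le_self_pow₀ (by norm_num) (by omega)
        linarith [Real.exp_one_lt_three]
      rw [e1]
      have h3 : 4 * Real.exp 2 / D * (4 ^ m) ^ k * (D * ((k : ℝ) + 1)) =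
          4 * Real.exp 2 * ((4 ^ m) ^ k * ((k : ℝ) + 1)) := by
        field_simp
      rw [h3]
      have h5 : Real.exp 1 ^ k ≤ (4 ^ m) ^ k * ((k : ℝ) + 1) :=
        e2.trans (le_mul_of_one_le_right (by positivity) (by linarith [k.cast_nonneg (α := ℝ)]))
      have := mul_le_mul_of_nonneg_left h5 (Real.exp_pos 2).le
      linarith
    · simp_rw [sq_abs]
      exact hH.2 heq.symm _ (by positivity)

end Growth

/-! ### Integrability of `H(u)` and uniform smallness of the tails. -/

section TailX

variable {K L : ℕ}

theorem finrank_space : Module.finrank ℝ (Space K L) = K + L := by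
  simp

theorem MemX.lintegral_weight_le {m : ℕ} {μ : ℝ} {u : Space K L → ℝ} (hu : MemX m μ u) {B : ℝ}
    (hB : ‖toModel m μ u‖ ≤ B) :
    ∫⁻ ξ, ENNReal.ofReal ((1 + ‖ξ‖ ^ (2 * m)) * ‖ft u ξ‖ ^ 2) ≤ ENNReal.ofReal (B ^ 2) := by
  have h1 : ∫⁻ ξ, ENNReal.ofReal ((1 + ‖ξ‖ ^ (2 * m)) * ‖ft u ξ‖ ^ 2) ≤
      ∫⁻ ξ, (ENNReal.ofReal (‖ft u ξ‖ ^ 2) + ENNReal.ofReal (‖highFreq m u ξ‖ ^ 2)) := by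
    refine lintegral_mono_ae ?_
    filter_upwards [coeFn_highFreq hu.sob] with ξ hξ
    rw [← ENNReal.ofReal_add (by positivity) (by positivity), hξ]
    refine ENNReal.ofReal_le_ofReal ?_
    rw [norm_smul, Real.norm_of_nonneg (by positivity), mul_pow, ← pow_mul, mul_comm m 2, mul_pow]
    have hπ : (1 : ℝ) ≤ (2 * Real.pi) ^ (2 * m) :=
      one_le_pow₀ (by linarith [Real.pi_gt_three])
    have : 0 ≤ ‖ξ‖ ^ (2 * m) * ‖ft u ξ‖ ^ 2 := by positivity
    nlinarith
  refine h1.trans ?_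
  rw [lintegral_add_left', L2C.lintegral_norm_sq, L2C.lintegral_norm_sq,
    ← ENNReal.ofReal_add (by positivity) (by positivity)]
  · refine ENNReal.ofReal_le_ofReal ?_
    have h2 := Model.norm_sq (toModel m μ u)
    rw [toModel_zero, toModel_one] at h2
    have h3 := pow_le_pow_left₀ (norm_nonneg _) hB 2
    nlinarith [sq_nonneg ‖toModel m μ u 2‖]
  · exact ((Lp.aestronglyMeasurable (ft u)).norm.aemeasurable.pow_const 2).ennreal_ofReal

theorem MemX.lintegral_sq_le {m : ℕ} {μ : ℝ} {u : Space K L → ℝ} (hu : MemX m μ u) {B : ℝ}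
    (hB : ‖toModel m μ u‖ ≤ B) :
    ∫⁻ x, ENNReal.ofReal (u x ^ 2) ≤ ENNReal.ofReal (B ^ 2) := by
  rw [← ofReal_integral_eq_lintegral_ofReal hu.memLp.integrable_sq
    (.of_forall fun x => sq_nonneg (u x)), ← norm_ft_sq hu.memLp]
  refine ENNReal.ofReal_le_ofReal ?_
  have h2 := Model.norm_sq (toModel m μ u)
  rw [toModel_zero, toModel_one] at h2
  have h3 := pow_le_pow_left₀ (norm_nonneg _) hB 2
  nlinarith [sq_nonneg ‖toModel m μ u 2‖, sq_nonneg ‖highFreq m u‖]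

/-- The nonlinearity is uniformly small on the sets where bounded functions are very small or
very large. -/
theorem exists_tail_bound {m : ℕ} (hm : 1 ≤ m) (hK : 2 * m ≤ K) (μ : ℝ) {H : ℝ → ℝ}
    (hH : Continuous H) (hH0 : SuperquadraticAtZero H) (hHinf : SubcriticalAtInfinity (K + L) m H)
    (B : ℝ) {ε : ℝ} (hε : 0 < ε) :
    ∃ δ M : ℝ, 0 < δ ∧ δ < M ∧ ∀ u : Space K L → ℝ, MemX m μ u → ‖toModel m μ u‖ ≤ B →
      ∫⁻ x in {x | |u x| < δ ∨ M < |u x|}, ENNReal.ofReal |H (u x)| ≤ ENNReal.ofReal ε := by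
  have hB' : 0 < |B| + 1 := by positivity
  obtain ⟨Φ, M₀, C, hM₀, hΦ, hint, hsub⟩ := exists_critical_growth (E := Space K L) hm
    (by rw [finrank_space]; omega) hB'
  rw [finrank_space] at hsub
  -- The limit at `0` ignores the point itself, so the value there has to come from continuity.
  have hzero : H 0 = 0 := by
    have h1 : Tendsto (fun t => H t / t ^ 2 * t ^ 2) (𝓝[≠] 0) (𝓝 (0 * 0 ^ 2)) :=
      hH0.mul ((continuous_pow 2).tendsto' (0 : ℝ) _ rfl |>.mono_left nhdsWithin_le_nhds)
    have h2 : Tendsto H (𝓝[≠] 0) (𝓝 (H 0)) := (hH.tendsto 0).mono_left nhdsWithin_le_nhds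
    have h3 := tendsto_nhds_unique h2 (h1.congr' ?_)
    · simpa using h3
    · filter_upwards [self_mem_nhdsWithin] with t ht
      have : t ≠ 0 := ht
      field_simp
  obtain ⟨δ, hδ, hsmall⟩ : ∃ δ > 0, ∀ t, |t| < δ →
      |H t| ≤ ε / (2 * (|B| + 1) ^ 2) * t ^ 2 := by
    have := Metric.tendsto_nhdsWithin_nhds.1 hH0 (ε / (2 * (|B| + 1) ^ 2)) (by positivity)
    obtain ⟨δ, hδ, h⟩ := this
    refine ⟨δ, hδ, fun t ht => ?_⟩
    by_cases h0 : t = 0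
    · simp [h0, hzero]
    · have := h (Set.mem_compl_singleton_iff.2 h0) (by simpa using ht)
      rw [Real.dist_eq, sub_zero, abs_div, abs_of_nonneg (sq_nonneg t),
        div_lt_iff₀ (by positivity)] at this
      exact this.le
  obtain ⟨M₁, hlarge⟩ : ∃ M₁ : ℝ, ∀ t, M₁ < |t| → |H t / Φ (|t|)| < ε / (2 * (|C| + 1)) := by
    have h1 := (Metric.tendsto_nhds.1 (hsub H hHinf)) (ε / (2 * (|C| + 1))) (by positivity)
    rw [← Metric.cobounded_eq_cocompact, (Metric.hasBasis_cobounded_compl_closedBall (0 : ℝ)).eventually_iff] at h1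
    obtain ⟨r, -, h⟩ := h1
    refine ⟨r, fun t ht => ?_⟩
    have := h (show t ∈ (Metric.closedBall 0 r)ᶜ by simpa using ht)
    simpa [Real.dist_eq, abs_div] using this
  refine ⟨δ, max (max M₀ M₁) (δ + 1), hδ, lt_max_of_lt_right (by linarith), fun u hu huB => ?_⟩
  have huB' : ‖toModel m μ u‖ ≤ |B| + 1 := huB.trans ((le_abs_self B).trans (by linarith))
  have hsub : {x | |u x| < δ ∨ max (max M₀ M₁) (δ + 1) < |u x|} ⊆
      {x | |u x| < δ} ∪ {x | M₀ ≤ |u x| ∧ M₁ < |u x|} := by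
    rintro x (h | h)
    · exact Or.inl h
    · have h1 := (le_max_left _ _).trans_lt h
      exact Or.inr ⟨((le_max_left _ _).trans_lt h1).le, (le_max_right _ _).trans_lt h1⟩
  have habs : AEMeasurable (fun x => |u x|) := hu.memLp.aestronglyMeasurable.norm.aemeasurable
  have hS1 : NullMeasurableSet {x | |u x| < δ} := nullMeasurableSet_lt habs aemeasurable_const
  have hS2 : NullMeasurableSet {x | M₀ ≤ |u x| ∧ M₁ < |u x|} :=
    (nullMeasurableSet_le aemeasurable_const habs).inter
      (nullMeasurableSet_lt aemeasurable_const habs)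
  have hI1 : ∫⁻ x in {x | |u x| < δ}, ENNReal.ofReal |H (u x)| ≤ ENNReal.ofReal (ε / 2) := by
    calc ∫⁻ x in {x | |u x| < δ}, ENNReal.ofReal |H (u x)|
        ≤ ∫⁻ x in {x | |u x| < δ}, ENNReal.ofReal (ε / (2 * (|B| + 1) ^ 2)) *
          ENNReal.ofReal (u x ^ 2) := by
          refine lintegral_mono_ae ((ae_restrict_iff'₀ hS1).2 (.of_forall fun x hx => ?_))
          rw [← ENNReal.ofReal_mul (by positivity)]
          exact ENNReal.ofReal_le_ofReal (hsmall _ hx)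
      _ ≤ ENNReal.ofReal (ε / (2 * (|B| + 1) ^ 2)) * ENNReal.ofReal ((|B| + 1) ^ 2) := by
          rw [lintegral_const_mul' _ _ ENNReal.ofReal_ne_top]
          exact mul_le_mul_right ((setLIntegral_le_lintegral _ _).trans (hu.lintegral_sq_le huB')) _
      _ = ENNReal.ofReal (ε / 2) := by
          rw [← ENNReal.ofReal_mul (by positivity)]
          congr 1
          field_simp
  have hI2 : ∫⁻ x in {x | M₀ ≤ |u x| ∧ M₁ < |u x|}, ENNReal.ofReal |H (u x)| ≤
      ENNReal.ofReal (ε / 2) := by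
    calc ∫⁻ x in {x | M₀ ≤ |u x| ∧ M₁ < |u x|}, ENNReal.ofReal |H (u x)|
        ≤ ∫⁻ x in {x | M₀ ≤ |u x| ∧ M₁ < |u x|}, ENNReal.ofReal (ε / (2 * (|C| + 1))) *
          ENNReal.ofReal (Φ |u x|) := by
          refine lintegral_mono_ae ((ae_restrict_iff'₀ hS2).2 (.of_forall fun x hx => ?_))
          rw [← ENNReal.ofReal_mul (by positivity)]
          have hp := hΦ _ (hM₀.trans_le hx.1)
          have := hlarge _ hx.2
          rw [abs_div, abs_of_pos hp, div_lt_iff₀ hp] at this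
          exact ENNReal.ofReal_le_ofReal this.le
      _ ≤ ENNReal.ofReal (ε / (2 * (|C| + 1))) * ENNReal.ofReal C := by
          rw [lintegral_const_mul' _ _ ENNReal.ofReal_ne_top]
          exact mul_le_mul_right ((lintegral_mono_set fun x hx => hx.1).trans
            (hint u hu.memLp (hu.lintegral_weight_le huB'))) _
      _ ≤ ENNReal.ofReal (ε / 2) := by
          rw [← ENNReal.ofReal_mul (by positivity)]
          refine ENNReal.ofReal_le_ofReal ?_
          rw [div_mul_eq_mul_div, div_le_div_iff₀ (by positivity) (by positivity)]
          nlinarith [le_abs_self C]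
  calc _ ≤ ∫⁻ x in {x | |u x| < δ} ∪ {x | M₀ ≤ |u x| ∧ M₁ < |u x|}, ENNReal.ofReal |H (u x)| :=
        lintegral_mono_set hsub
    _ ≤ _ := lintegral_union_le _ _ _
    _ ≤ ENNReal.ofReal (ε / 2) + ENNReal.ofReal (ε / 2) := add_le_add hI1 hI2
    _ = ENNReal.ofReal ε := by
        rw [← ENNReal.ofReal_add (by positivity) (by positivity), add_halves]

theorem measure_le_abs_le {u : Space K L → ℝ} (hu : MemLp u 2) {δ : ℝ} (hδ : 0 < δ) :
    volume {x | δ ≤ |u x|} ≤ ENNReal.ofReal (1 / δ ^ 2) * ENNReal.ofReal (‖ft u‖ ^ 2) := by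
  -- With `R = 0` the frequency ball is empty and nothing is subtracted: this is plain Chebyshev.
  have h := measure_le_of_norm_lowPass_le hu (R := 0) hδ (S := {x | δ ≤ |u x|})
    (.of_forall fun x hx => by
      have : ‖(u x : ℂ)‖ = |u x| := by simp
      simpa [lowPass, this] using hx)
  refine h.trans (mul_le_mul_right ?_ _)
  rw [← L2C.lintegral_norm_sq]
  exact setLIntegral_le_lintegral _ _

/-- Away from the two tails `H` is bounded, and the set where `|u| ≥ δ` has controlled measure. All
bounds on `∫ |H(u)|` use this split. -/
theorem lintegral_abs_comp_le {u : Space K L → ℝ} (hu : MemLp u 2) {H : ℝ → ℝ} {δ M C : ℝ}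
    (hC : ∀ t ∈ Set.Icc (-M) M, |H t| ≤ C) :
    ∫⁻ x, ENNReal.ofReal |H (u x)| ≤
      (∫⁻ x in {x | |u x| < δ ∨ M < |u x|}, ENNReal.ofReal |H (u x)|) +
        ENNReal.ofReal C * volume {x | δ ≤ |u x|} := by
  have hcov : (Set.univ : Set (Space K L)) ⊆ {x | |u x| < δ ∨ M < |u x|} ∪
      {x | δ ≤ |u x| ∧ |u x| ≤ M} := by
    intro x _
    rcases lt_or_ge |u x| δ with h1 | h1
    · exact Or.inl (Or.inl h1)
    · rcases lt_or_ge M |u x| with h2 | h2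
      · exact Or.inl (Or.inr h2)
      · exact Or.inr ⟨h1, h2⟩
  have habs : AEMeasurable (fun x => |u x|) := hu.aestronglyMeasurable.norm.aemeasurable
  rw [← setLIntegral_univ]
  refine (lintegral_mono_set hcov).trans ((lintegral_union_le _ _ _).trans (add_le_add_right ?_ _))
  refine (lintegral_mono_ae (g := fun _ => ENNReal.ofReal C) ((ae_restrict_iff'₀
    ((nullMeasurableSet_le aemeasurable_const habs).inter
      (nullMeasurableSet_le habs aemeasurable_const))).2
    (.of_forall fun x hx => ENNReal.ofReal_le_ofReal (hC _ (abs_le.1 hx.2))))).trans ?_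
  rw [setLIntegral_const]
  exact mul_le_mul_right (measure_mono fun x hx => hx.1) _

theorem integrable_comp {m : ℕ} (hm : 1 ≤ m) (hK : 2 * m ≤ K) {μ : ℝ} {H : ℝ → ℝ}
    (hH : Continuous H) (hH0 : SuperquadraticAtZero H) (hHinf : SubcriticalAtInfinity (K + L) m H)
    {u : Space K L → ℝ} (hu : MemX m μ u) : Integrable fun x => H (u x) := by
  obtain ⟨δ, M, hδ, hM, h⟩ := exists_tail_bound (L := L) hm hK μ hH hH0 hHinf ‖toModel m μ u‖ one_pos
  refine ⟨hH.comp_aestronglyMeasurable hu.memLp.aestronglyMeasurable, ?_⟩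
  obtain ⟨C, hC⟩ := (isCompact_Icc (a := -M) (b := M)).exists_bound_of_continuousOn hH.continuousOn
  rw [hasFiniteIntegral_iff_norm]
  refine (lintegral_abs_comp_le (δ := δ) hu.memLp hC).trans_lt
    (ENNReal.add_lt_top.2 ⟨(h u hu le_rfl).trans_lt ENNReal.ofReal_lt_top,
      ENNReal.mul_lt_top ENNReal.ofReal_lt_top ((measure_le_abs_le hu.memLp hδ).trans_lt ?_)⟩)
  exact ENNReal.mul_lt_top ENNReal.ofReal_lt_top ENNReal.ofReal_lt_top

/-- The functional `u ↦ ∫ H(u)` is bounded on bounded sets. -/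
theorem exists_lintegral_abs_comp_le {m : ℕ} (hm : 1 ≤ m) (hK : 2 * m ≤ K) (μ : ℝ) {H : ℝ → ℝ}
    (hH : Continuous H) (hH0 : SuperquadraticAtZero H) (hHinf : SubcriticalAtInfinity (K + L) m H)
    (B : ℝ) : ∃ S : ℝ, 0 ≤ S ∧ ∀ u : Space K L → ℝ, MemX m μ u → ‖toModel m μ u‖ ≤ B →
      ∫⁻ x, ENNReal.ofReal |H (u x)| ≤ ENNReal.ofReal S := by
  obtain ⟨δ, M, hδ, hM, h⟩ := exists_tail_bound (L := L) hm hK μ hH hH0 hHinf B one_pos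
  obtain ⟨C, hC⟩ := (isCompact_Icc (a := -M) (b := M)).exists_bound_of_continuousOn hH.continuousOn
  refine ⟨1 + |C| * (1 / δ ^ 2 * B ^ 2), by positivity, fun u hu huB => ?_⟩
  refine (lintegral_abs_comp_le (δ := δ) (C := |C|) hu.memLp
    fun t ht => (hC t ht).trans (le_abs_self C)).trans ?_
  rw [ENNReal.ofReal_add (by positivity) (by positivity), ENNReal.ofReal_mul (abs_nonneg C),
    ENNReal.ofReal_mul (by positivity)]
  refine add_le_add (h u hu huB) (mul_le_mul_right ((measure_le_abs_le hu.memLp hδ).trans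
    (mul_le_mul_right (ENNReal.ofReal_le_ofReal ?_) _)) _)
  have h2 := Model.norm_sq (toModel m μ u)
  rw [toModel_zero] at h2
  have h3 := pow_le_pow_left₀ (norm_nonneg _) huB 2
  nlinarith [sq_nonneg ‖toModel m μ u 2‖, sq_nonneg ‖toModel m μ u 1‖]

end TailX

end SingularPolyharmonic

namespace SingularPolyharmonic

open FourierTransform RealInnerProductSpace

/-! ### Weak limits along filters and ultrafilters. -/

section WeakLimits

variable {V : Type*} [NormedAddCommGroup V] [InnerProductSpace ℝ V]

/-- Weak convergence in a real inner product space along a filter. -/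
def WeakLim (F : Filter ℕ) (h : ℕ → V) (g : V) : Prop :=
  ∀ v, Tendsto (fun n => ⟪h n, v⟫) F (𝓝 ⟪g, v⟫)

theorem WeakLim.unique {F : Filter ℕ} [F.NeBot] {h : ℕ → V} {g g' : V} (h1 : WeakLim F h g)
    (h2 : WeakLim F h g') : g = g' :=
  ext_inner_right ℝ fun v => tendsto_nhds_unique (h1 v) (h2 v)

theorem WeakLim.sub {F : Filter ℕ} {h h' : ℕ → V} {g g' : V} (h1 : WeakLim F h g)
    (h2 : WeakLim F h' g') : WeakLim F (fun n => h n - h' n) (g - g') := fun v => by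
  simp_rw [inner_sub_left]
  exact (h1 v).sub (h2 v)

theorem WeakLim.const (F : Filter ℕ) (g : V) : WeakLim F (fun _ => g) g := fun _ =>
  tendsto_const_nhds

theorem WeakLim.sum {ι : Type*} (s : Finset ι) {F : Filter ℕ} {h : ι → ℕ → V} {g : ι → V}
    (h1 : ∀ i ∈ s, WeakLim F (h i) (g i)) :
    WeakLim F (fun n => ∑ i ∈ s, h i n) (∑ i ∈ s, g i) := fun v => by
  simp_rw [sum_inner]
  exact tendsto_finsetSum _ fun i hi => h1 i hi v

theorem WeakLim.inner_tendsto {F : Filter ℕ} {h : ℕ → V} {g : V} (h1 : WeakLim F h g) {C : ℝ}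
    (hC : ∀ᶠ n in F, ‖h n‖ ≤ C) {v : ℕ → V} {v₀ : V} (hv : Tendsto v F (𝓝 v₀)) :
    Tendsto (fun n => ⟪h n, v n⟫) F (𝓝 ⟪g, v₀⟫) := by
  have h2 : Tendsto (fun n => C * ‖v n - v₀‖) F (𝓝 0) := by
    have := (tendsto_iff_norm_sub_tendsto_zero.1 hv).const_mul C
    rwa [mul_zero] at this
  have h3 : Tendsto (fun n => ⟪h n, v n - v₀⟫) F (𝓝 0) := by
    refine squeeze_zero_norm' ?_ h2
    filter_upwards [hC] with n hn
    exact (norm_inner_le_norm _ _).trans (mul_le_mul_of_nonneg_right hn (norm_nonneg _))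
  have h4 := h3.add (h1 v₀)
  rw [zero_add] at h4
  refine h4.congr fun n => ?_
  rw [inner_sub_right]
  ring

theorem WeakLim.norm_le {F : Filter ℕ} [F.NeBot] {h : ℕ → V} {g : V} (h1 : WeakLim F h g) {C : ℝ}
    (hC : ∀ᶠ n in F, ‖h n‖ ≤ C) : ‖g‖ ≤ C := by
  rcases eq_or_ne g 0 with rfl | hg
  · obtain ⟨n, hn⟩ := hC.exists
    rw [norm_zero]
    exact (norm_nonneg _).trans hn
  have h2 : ⟪g, g⟫ ≤ C * ‖g‖ := by
    refine le_of_tendsto (h1 g) ?_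
    filter_upwards [hC] with n hn
    exact (real_inner_le_norm _ _).trans (mul_le_mul_of_nonneg_right hn (norm_nonneg _))
  rw [real_inner_self_eq_norm_mul_norm] at h2
  exact le_of_mul_le_mul_right h2 (norm_pos_iff.2 hg)

/-- Along an ultrafilter every bounded scalar sequence converges. The limits of the inner products
form a bounded functional, represented by Riesz; no subsequence has to be chosen. -/
theorem exists_weakLim [CompleteSpace V] (𝒰 : Ultrafilter ℕ) {h : ℕ → V} {C : ℝ}
    (hC : ∀ᶠ n in 𝒰, ‖h n‖ ≤ C) : ∃ g, WeakLim 𝒰 h g := by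
  have hlim : ∀ v, ∃ r, Tendsto (fun n => ⟪h n, v⟫) 𝒰 (𝓝 r) := by
    intro v
    have hmem : ∀ᶠ n in 𝒰, ⟪h n, v⟫ ∈ Metric.closedBall (0 : ℝ) (C * ‖v‖) := by
      filter_upwards [hC] with n hn
      rw [mem_closedBall_zero_iff]
      exact (norm_inner_le_norm _ _).trans (mul_le_mul_of_nonneg_right hn (norm_nonneg _))
    obtain ⟨r, -, hr⟩ := (isCompact_closedBall (0 : ℝ) (C * ‖v‖)).ultrafilter_le_nhds
      (𝒰.map fun n => ⟪h n, v⟫) (by rw [le_principal_iff]; exact hmem)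
    exact ⟨r, hr⟩
  choose l hl using hlim
  let f : V →ₗ[ℝ] ℝ :=
    { toFun := l
      map_add' := fun v w => by
        refine tendsto_nhds_unique (hl (v + w)) ?_
        simp_rw [inner_add_right]
        exact (hl v).add (hl w)
      map_smul' := fun c v => by
        refine tendsto_nhds_unique (hl (c • v)) ?_
        simp_rw [inner_smul_right]
        exact (hl v).const_mul c }
  let f' : StrongDual ℝ V := f.mkContinuous C fun v => by
    refine le_of_tendsto (hl v).norm ?_
    filter_upwards [hC] with n hn
    exact (norm_inner_le_norm _ _).trans (mul_le_mul_of_nonneg_right hn (norm_nonneg _))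
  refine ⟨(InnerProductSpace.toDual ℝ V).symm f', fun v => ?_⟩
  rw [InnerProductSpace.toDual_symm_apply]
  exact hl v

end WeakLimits

/-- Dependent choice in which each new term is constrained by the finite set of all earlier ones, as
in the greedy selection of positions. -/
theorem exists_dependent_seq {α : Type*} (a₀ : α) (R : Finset α → α → Prop)
    (h : ∀ s, ∃ a, R s a) : ∃ f : ℕ → α, f 0 = a₀ ∧
      ∀ i, ∃ s : Finset α, (∀ x, x ∈ s ↔ ∃ j ≤ i, f j = x) ∧ R s (f (i + 1)) := by
  classical
  choose p hp using h
  let g : ℕ → Finset α × α := fun n => Nat.rec ({a₀}, a₀)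
    (fun _ q => (insert (p q.1) q.1, p q.1)) n
  have hg : ∀ n, g (n + 1) = (insert (p (g n).1) (g n).1, p (g n).1) := fun n => rfl
  refine ⟨fun n => (g n).2, rfl, fun i => ⟨(g i).1, ?_, ?_⟩⟩
  · induction i with
    | zero =>
      intro x
      simp only [Nat.le_zero, exists_eq_left]
      change x ∈ ({a₀} : Finset α) ↔ a₀ = x
      rw [Finset.mem_singleton, eq_comm]
    | succ i ih =>
      intro x
      rw [hg]
      simp only [Finset.mem_insert, ih]
      constructor
      · rintro (rfl | ⟨j, hj, rfl⟩)
        · exact ⟨i + 1, le_rfl, by rw [hg]⟩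
        · exact ⟨j, by omega, rfl⟩
      · rintro ⟨j, hj, rfl⟩
        rcases Nat.le_succ_iff.1 hj with h | h
        · exact Or.inr ⟨j, h, rfl⟩
        · left
          rw [h, hg]
  · simp only [hg]
    exact hp _

/-! ### Extraction of profiles in the Hilbert space. -/

section Profiles

variable {K L : ℕ}

theorem inner_modelShift_left (z : EuclideanSpace ℝ (Fin L)) (h g : Model K L) :
    ⟪modelShift z h, g⟫ = ⟪h, modelShift (-z) g⟫ := by
  have h1 := (modelShift (K := K) (-z)).inner_map_map (modelShift z h) g
  rw [← modelShift_add, neg_add_cancel, modelShift_zero] at h1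
  exact h1.symm

theorem WeakLim.comp_apply {F : Filter ℕ} {h : ℕ → Model K L} {g : Model K L}
    (hw : WeakLim F h g) (k : Fin 3) : WeakLim F (fun n => h n k) (g k) := fun v => by
  have key : ∀ x : Model K L, ⟪x, (PiLp.single 2 k v : Model K L)⟫ = ⟪x k, v⟫ := by
    intro x
    rw [PiLp.inner_apply, Finset.sum_eq_single k]
    · rw [PiLp.single_apply, if_pos rfl]
    · intro b _ hb
      rw [PiLp.single_apply, if_neg hb, inner_zero_right]
    · simp
  have := hw (PiLp.single 2 k v)
  simp_rw [key] at this
  exact this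

theorem weakLim_modelShift_zero {F : Filter ℕ} {z : ℕ → EuclideanSpace ℝ (Fin L)}
    (hz : Tendsto (fun n => ‖z n‖) F atTop) (h : Model K L) :
    WeakLim F (fun n => modelShift (z n) h) 0 := fun v => by
  rw [inner_zero_left]
  refine (tendsto_inner_modelShift_cocompact h v).comp ?_
  rw [← Metric.cobounded_eq_cocompact]
  exact tendsto_norm_atTop_iff_cobounded.1 hz

/-- Move the shift to the test vector, where it converges strongly. Thus positions at bounded
distance see the same profile up to a translation. -/
theorem WeakLim.modelShift_of_tendsto {F : Filter ℕ} {h : ℕ → Model K L} {C : ℝ}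
    (hC : ∀ᶠ n in F, ‖h n‖ ≤ C) {g : Model K L} (hw : WeakLim F h g)
    {z : ℕ → EuclideanSpace ℝ (Fin L)}
    {a : EuclideanSpace ℝ (Fin L)} (hz : Tendsto z F (𝓝 a)) :
    WeakLim F (fun n => modelShift (z n) (h n)) (modelShift a g) := fun v => by
  simp_rw [inner_modelShift_left]
  exact hw.inner_tendsto hC (((continuous_modelShift v).comp continuous_neg).tendsto a |>.comp hz)

/-- What remains of the sequence `h` after the profiles `U j` at the positions `z j`, `j < i`,
have been removed. -/
noncomputable def remainder (h : ℕ → Model K L) (U : ℕ → Model K L)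
    (z : ℕ → ℕ → EuclideanSpace ℝ (Fin L)) (i n : ℕ) : Model K L :=
  h n - ∑ j ∈ Finset.range i, modelShift (-z j n) (U j)

theorem remainder_zero (h : ℕ → Model K L) (U : ℕ → Model K L)
    (z : ℕ → ℕ → EuclideanSpace ℝ (Fin L)) (n : ℕ) : remainder h U z 0 n = h n := by
  simp [remainder]

theorem modelShift_remainder (h : ℕ → Model K L) (U : ℕ → Model K L)
    (z : ℕ → ℕ → EuclideanSpace ℝ (Fin L)) (i n : ℕ) (ζ : EuclideanSpace ℝ (Fin L)) :
    modelShift ζ (remainder h U z i n) =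
      modelShift ζ (h n) - ∑ j ∈ Finset.range i, modelShift (ζ - z j n) (U j) := by
  rw [remainder, map_sub, map_sum]
  simp_rw [sub_eq_add_neg ζ, modelShift_add]

theorem modelShift_remainder_succ (h : ℕ → Model K L) (U : ℕ → Model K L)
    (z : ℕ → ℕ → EuclideanSpace ℝ (Fin L)) (i n : ℕ) :
    modelShift (z i n) (remainder h U z i n) =
      modelShift (z i n) (remainder h U z (i + 1) n) + U i := by
  rw [modelShift_remainder, modelShift_remainder, Finset.sum_range_succ, sub_self, modelShift_zero]
  abel

/-- The family `(z, U)` is a system of profiles of `h` along `F`. -/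
structure IsProfileSystem (F : Filter ℕ) (h : ℕ → Model K L) (U : ℕ → Model K L)
    (z : ℕ → ℕ → EuclideanSpace ℝ (Fin L)) : Prop where
  separated : ∀ i j, i ≠ j → Tendsto (fun n => ‖z i n - z j n‖) F atTop
  weakLim : ∀ i, WeakLim F (fun n => modelShift (z i n) (h n)) (U i)

namespace IsProfileSystem

variable {F : Filter ℕ} {h : ℕ → Model K L} {U : ℕ → Model K L}
  {z : ℕ → ℕ → EuclideanSpace ℝ (Fin L)}

/-- Seen from position `z j`, the subtracted `U j` cancels the weak limit, and the other profiles
drift away and are weakly null. -/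
theorem weakLim_remainder (hP : IsProfileSystem F h U z) {i j : ℕ} (hj : j < i) :
    WeakLim F (fun n => modelShift (z j n) (remainder h U z i n)) 0 := by
  simp_rw [modelShift_remainder]
  have h1 : WeakLim F (fun n => ∑ l ∈ Finset.range i, modelShift (z j n - z l n) (U l))
      (∑ l ∈ Finset.range i, if l = j then U j else 0) := by
    refine WeakLim.sum _ fun l _ => ?_
    split_ifs with hl
    · subst hl
      simp_rw [sub_self, modelShift_zero]
      exact WeakLim.const _ _
    · exact weakLim_modelShift_zero (hP.separated j l (Ne.symm hl)) _
  have h2 := (hP.weakLim j).sub h1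
  rwa [Finset.sum_ite_eq' (Finset.range i) j, if_pos (Finset.mem_range.2 hj), sub_self] at h2

theorem norm_remainder_le {C : ℝ} (hC : ∀ n, ‖h n‖ ≤ C) (i n : ℕ) :
    ‖remainder h U z i n‖ ≤ C + ∑ j ∈ Finset.range i, ‖U j‖ := by
  refine (norm_sub_le _ _).trans (add_le_add (hC n) ((norm_sum_le _ _).trans ?_))
  simp

/-- Pythagoras, one profile at a time: the cross term tends to `0` by `weakLim_remainder`. The
components are kept apart since the quadratic form weighs them with different signs. -/
theorem tendsto_energy (hP : IsProfileSystem F h U z) (i : ℕ) (k : Fin 3) :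
    Tendsto (fun n => ‖h n k‖ ^ 2 - ‖remainder h U z i n k‖ ^ 2) F
      (𝓝 (∑ j ∈ Finset.range i, ‖U j k‖ ^ 2)) := by
  induction i with
  | zero => simpa [remainder_zero] using tendsto_const_nhds
  | succ i ih =>
    rw [Finset.sum_range_succ]
    have h1 : ∀ n, ‖remainder h U z i n k‖ ^ 2 - ‖remainder h U z (i + 1) n k‖ ^ 2 =
        2 * ⟪modelShift (z i n) (remainder h U z (i + 1) n) k, U i k⟫ + ‖U i k‖ ^ 2 := by
      intro n
      have e1 : ‖remainder h U z i n k‖ = ‖modelShift (z i n) (remainder h U z i n) k‖ := by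
        rw [modelShift_apply, LinearIsometry.norm_map]
      have e2 : ‖remainder h U z (i + 1) n k‖ =
          ‖modelShift (z i n) (remainder h U z (i + 1) n) k‖ := by
        rw [modelShift_apply, LinearIsometry.norm_map]
      rw [e1, e2, modelShift_remainder_succ, PiLp.add_apply, norm_add_sq_real]
      ring
    have h2 := ((hP.weakLim_remainder (Nat.lt_succ_self i)).comp_apply k (U i k)).const_mul 2
    rw [PiLp.zero_apply, inner_zero_left, mul_zero] at h2
    have h3 := ih.add (h2.add_const (‖U i k‖ ^ 2))
    rw [zero_add] at h3
    refine h3.congr fun n => ?_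
    rw [← h1]
    ring

theorem tendsto_energy_norm (hP : IsProfileSystem F h U z) (i : ℕ) :
    Tendsto (fun n => ‖h n‖ ^ 2 - ‖remainder h U z i n‖ ^ 2) F
      (𝓝 (∑ j ∈ Finset.range i, ‖U j‖ ^ 2)) := by
  have h3 := ((hP.tendsto_energy i 0).add (hP.tendsto_energy i 1)).add (hP.tendsto_energy i 2)
  rw [← Finset.sum_add_distrib, ← Finset.sum_add_distrib] at h3
  simp_rw [Model.norm_sq]
  refine h3.congr fun n => ?_
  ring

theorem sum_norm_sq_le [F.NeBot] (hP : IsProfileSystem F h U z) {C : ℝ} (hC : ∀ n, ‖h n‖ ≤ C)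
    (i : ℕ) : ∑ j ∈ Finset.range i, ‖U j‖ ^ 2 ≤ C ^ 2 := by
  refine le_of_tendsto' (hP.tendsto_energy_norm i) fun n => ?_
  have := pow_le_pow_left₀ (norm_nonneg _) (hC n) 2
  linarith [sq_nonneg ‖remainder h U z i n‖]

theorem tendsto_norm_profile [F.NeBot] (hP : IsProfileSystem F h U z) {C : ℝ}
    (hC : ∀ n, ‖h n‖ ≤ C) : Tendsto (fun i => ‖U i‖) atTop (𝓝 0) := by
  have h1 : Summable fun i => ‖U i‖ ^ 2 :=
    summable_of_sum_range_le (fun _ => by positivity) (hP.sum_norm_sq_le hC)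
  have h2 := (Real.continuous_sqrt.tendsto 0).comp h1.tendsto_atTop_zero
  simpa [Function.comp_def, Real.sqrt_sq (norm_nonneg _)] using h2

/-- Unlike the triangle inequality, the energy splitting bounds remainders independently of `i`. The
vanishing threshold can then be fixed before the number of profiles. -/
theorem eventually_norm_remainder_le (hP : IsProfileSystem F h U z) {C : ℝ}
    (hC : ∀ n, ‖h n‖ ≤ C) (i : ℕ) : ∀ᶠ n in F, ‖remainder h U z i n‖ ≤ C + 1 := by
  have h0 : (-1 : ℝ) < ∑ j ∈ Finset.range i, ‖U j‖ ^ 2 :=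
    lt_of_lt_of_le (by norm_num) (Finset.sum_nonneg fun _ _ => by positivity)
  filter_upwards [(hP.tendsto_energy_norm i).eventually (lt_mem_nhds h0)] with n hn
  have hC0 : 0 ≤ C := (norm_nonneg _).trans (hC n)
  have := pow_le_pow_left₀ (norm_nonneg _) (hC n) 2
  exact abs_le_of_sq_le_sq' (by nlinarith) (by linarith) |>.2

end IsProfileSystem

/-- Each new position sequence is separated from the earlier ones and its weak limit has at least
half the supremal norm. A translate of the remainder along `ζ` has weak limit `0` if `ζ` stays near
an old position along the ultrafilter; otherwise its limit competed in the selection. -/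
theorem exists_profileSystem (hL : 0 < L) (𝒰 : Ultrafilter ℕ) (h𝒰 : (𝒰 : Filter ℕ) ≤ atTop)
    {h : ℕ → Model K L} {C : ℝ} (hC : ∀ n, ‖h n‖ ≤ C) :
    ∃ (U : ℕ → Model K L) (z : ℕ → ℕ → EuclideanSpace ℝ (Fin L)), (∀ n, z 0 n = 0) ∧
      IsProfileSystem 𝒰 h U z ∧ ∀ (i : ℕ) (ζ : ℕ → EuclideanSpace ℝ (Fin L)) (g : Model K L),
        WeakLim 𝒰 (fun n => modelShift (ζ n) (remainder h U z (i + 1) n)) g →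
          ‖g‖ ≤ 2 * ‖U (i + 1)‖ := by
  have hbd : ∀ ζ : ℕ → EuclideanSpace ℝ (Fin L), ∀ᶠ n in (𝒰 : Filter ℕ),
      ‖modelShift (ζ n) (h n)‖ ≤ C := fun ζ => .of_forall fun n => by
    rw [LinearIsometry.norm_map]; exact hC n
  choose prof hprof using fun ζ : ℕ → EuclideanSpace ℝ (Fin L) => exists_weakLim 𝒰 (hbd ζ)
  have hprofC : ∀ ζ, ‖prof ζ‖ ≤ C := fun ζ => (hprof ζ).norm_le (hbd ζ)
  let Sep : Finset (ℕ → EuclideanSpace ℝ (Fin L)) → (ℕ → EuclideanSpace ℝ (Fin L)) → Prop :=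
    fun s ζ => ∀ x ∈ s, Tendsto (fun n => ‖ζ n - x n‖) 𝒰 atTop
  obtain ⟨z, hz0, hz⟩ := exists_dependent_seq (fun _ => (0 : EuclideanSpace ℝ (Fin L)))
    (fun s ζ => Sep s ζ ∧ ∀ ζ', Sep s ζ' → ‖prof ζ'‖ ≤ 2 * ‖prof ζ‖) (fun s => by
      -- A competitor exists because `L > 0`: take norms that exceed those of all earlier positions
      -- by `n`.
      have hne : ∃ ζ, Sep s ζ := by
        have : Nonempty (Fin L) := ⟨⟨0, hL⟩⟩
        have : ∀ n : ℕ, ∃ y : EuclideanSpace ℝ (Fin L), ‖y‖ = n + ∑ x ∈ s, ‖x n‖ := fun n =>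
          _root_.exists_norm_eq _ (by positivity)
        choose ζ hζ using this
        refine ⟨ζ, fun x hx => ?_⟩
        refine tendsto_atTop_mono (fun n => ?_) (tendsto_natCast_atTop_atTop.mono_left h𝒰)
        have h1 := norm_sub_norm_le (ζ n) (x n)
        have h2 : ‖x n‖ ≤ ∑ x ∈ s, ‖x n‖ :=
          Finset.single_le_sum (f := fun x : ℕ → EuclideanSpace ℝ (Fin L) => ‖x n‖)
            (fun _ _ => norm_nonneg _) hx
        rw [hζ] at h1
        linarith
      let S : Set ℝ := {r | ∃ ζ, Sep s ζ ∧ r = ‖prof ζ‖}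
      have hSne : S.Nonempty := by
        obtain ⟨ζ, hζ⟩ := hne
        exact ⟨_, ζ, hζ, rfl⟩
      have hSb : BddAbove S := ⟨C, by rintro _ ⟨ζ, -, rfl⟩; exact hprofC ζ⟩
      by_cases h0 : sSup S ≤ 0
      · obtain ⟨ζ, hζ⟩ := hne
        refine ⟨ζ, hζ, fun ζ' hζ' => ?_⟩
        have := le_csSup hSb ⟨ζ', hζ', rfl⟩
        linarith [norm_nonneg (prof ζ)]
      · obtain ⟨_, ⟨ζ, hζ, rfl⟩, hlt⟩ := exists_lt_of_lt_csSup hSne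
          (half_lt_self (not_le.1 h0))
        refine ⟨ζ, hζ, fun ζ' hζ' => ?_⟩
        have := le_csSup hSb ⟨ζ', hζ', rfl⟩
        linarith)
  have hsep : ∀ i j, i < j → Tendsto (fun n => ‖z j n - z i n‖) 𝒰 atTop := by
    intro i j hij
    obtain ⟨k, rfl⟩ := Nat.exists_eq_add_of_lt hij
    obtain ⟨s, hs, hs1, -⟩ := hz (i + k)
    exact hs1 (z i) ((hs _).2 ⟨i, by omega, rfl⟩)
  have hP : IsProfileSystem 𝒰 h (fun i => prof (z i)) z := by
    refine ⟨fun i j hij => ?_, fun i => hprof (z i)⟩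
    rcases lt_or_gt_of_ne hij with h1 | h1
    · simp_rw [norm_sub_rev (z i _)]
      exact hsep i j h1
    · exact hsep j i h1
  refine ⟨fun i => prof (z i), z, fun n => by rw [hz0], hP, fun i ζ g hg => ?_⟩
  obtain ⟨s, hs, hs1, hs2⟩ := hz i
  by_cases hζ : Sep s ζ
  · have h1 : WeakLim 𝒰 (fun n => modelShift (ζ n)
        (remainder h (fun i => prof (z i)) z (i + 1) n)) (prof ζ) := by
      simp_rw [modelShift_remainder]
      have h2 : WeakLim 𝒰 (fun n => ∑ l ∈ Finset.range (i + 1), modelShift (ζ n - z l n)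
          (prof (z l))) (∑ l ∈ Finset.range (i + 1), (0 : Model K L)) :=
        WeakLim.sum _ fun l hl => weakLim_modelShift_zero
          (hζ _ ((hs _).2 ⟨l, Nat.lt_succ_iff.1 (Finset.mem_range.1 hl), rfl⟩)) _
      have h3 := (hprof ζ).sub h2
      rwa [Finset.sum_const_zero, sub_zero] at h3
    rw [hg.unique h1]
    exact hs2 ζ hζ
  -- For an ultrafilter, failing to diverge means being bounded on a large set, so the difference `ζ
  -- n - z j n` converges.
  · simp only [Sep, not_forall] at hζ
    obtain ⟨x, hx, hnt⟩ := hζ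
    obtain ⟨j, hj, rfl⟩ := (hs x).1 hx
    rw [tendsto_atTop] at hnt
    push Not at hnt
    obtain ⟨R, hR⟩ := hnt
    have hR' : ∀ᶠ n in (𝒰 : Filter ℕ), ζ n - z j n ∈
        Metric.closedBall (0 : EuclideanSpace ℝ (Fin L)) R := by
      filter_upwards [hR] with n hn
      rw [mem_closedBall_zero_iff]
      exact hn.le
    obtain ⟨a, -, ha⟩ := (isCompact_closedBall (0 : EuclideanSpace ℝ (Fin L)) R).ultrafilter_le_nhds
      (𝒰.map fun n => ζ n - z j n) (by rw [le_principal_iff]; exact hR')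
    have h1 := (hP.weakLim_remainder (Nat.lt_succ_iff.2 hj)).modelShift_of_tendsto
      (C := C + ∑ j ∈ Finset.range (i + 1), ‖prof (z j)‖) (.of_forall fun n => by
        rw [LinearIsometry.norm_map]
        exact IsProfileSystem.norm_remainder_le hC _ _) ha
    rw [map_zero] at h1
    have h2 : g = 0 := by
      refine hg.unique ?_
      refine (funext fun n => ?_ : (fun n => modelShift (ζ n) _) = _) ▸ h1
      rw [← modelShift_add, sub_add_cancel]
    rw [h2, norm_zero]
    positivity

end Profiles

end SingularPolyharmonic

namespace SingularPolyharmonic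

open FourierTransform RealInnerProductSpace

/-! ### Low frequency parts, symmetry and smallness in measure. -/

section LowPassLimits

variable {K L : ℕ}

/-- The complex inner product is recovered from the real one by testing also with `i` times the
vector. -/
theorem WeakLim.tendsto_complex_inner {E : Type*} [NormedAddCommGroup E] [InnerProductSpace ℝ E]
    [FiniteDimensional ℝ E] [MeasurableSpace E] [BorelSpace E] {F : Filter ℕ} {f : ℕ → L2C E}
    {g : L2C E} (h : WeakLim F f g) {C : ℝ} (hC : ∀ᶠ n in F, ‖f n‖ ≤ C) {b : ℕ → L2C E}
    {b₀ : L2C E} (hb : Tendsto b F (𝓝 b₀)) :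
    Tendsto (fun n => inner ℂ (b n) (f n)) F (𝓝 (inner ℂ b₀ g)) := by
  have key : ∀ x y : L2C E, (inner ℂ x y : ℂ) = (⟪y, x⟫ : ℝ) + (⟪y, Complex.I • x⟫ : ℝ) * Complex.I := by
    intro x y
    rw [real_inner_comm, real_inner_comm (Complex.I • x), L2C.real_inner_eq_re, L2C.real_inner_eq_re,
      inner_smul_left]
    apply Complex.ext <;> simp
  simp_rw [key]
  have h1 := h.inner_tendsto hC hb
  have h2 := h.inner_tendsto hC (hb.const_smul Complex.I)
  exact ((Complex.continuous_ofReal.tendsto _).comp h1).add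
    (((Complex.continuous_ofReal.tendsto _).comp h2).mul_const _)

theorem norm_ft_le_norm_toModel (m : ℕ) (μ : ℝ) (u : Space K L → ℝ) :
    ‖ft u‖ ≤ ‖toModel m μ u‖ := by
  rw [← toModel_zero m μ u]
  exact PiLp.norm_apply_le _ _

/-- Two vectors of equal norm are exchanged by the reflection in the hyperplane orthogonal to their
difference, an element of `O(K)`. -/
theorem MemX.lowPass_reflect {m : ℕ} {μ : ℝ} {u : Space K L → ℝ} (hu : MemX m μ u) (R : ℝ)
    {y y' : EuclideanSpace ℝ (Fin K)} (h : ‖y‖ = ‖y'‖) (z : EuclideanSpace ℝ (Fin L)) :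
    lowPass R (ft u) (pair y z) = lowPass R (ft u) (pair y' z) := by
  obtain ⟨B, hB⟩ := exists_isometry_rotate (L := L) (Submodule.reflection (Submodule.span ℝ {y - y'})ᗮ)
  have h1 := lowPass_rotate R (ft u) B ((isCylindrical_iff_ft hu.memLp).1 hu.2.1 _ B hB) (pair y z)
  rw [hB, yPart_pair, zPart_pair, Submodule.reflection_sub h] at h1
  exact h1.symm

theorem exists_unit_vectors (hK : 2 ≤ K) :
    ∃ e : ℕ → EuclideanSpace ℝ (Fin K), (∀ j, ‖e j‖ = 1) ∧ Function.Injective e := by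
  have hrank : 1 < Module.rank ℝ (EuclideanSpace ℝ (Fin K)) := by
    rw [← Module.finrank_eq_rank, finrank_euclideanSpace_fin]
    exact_mod_cast hK
  have hne : (Metric.sphere (0 : EuclideanSpace ℝ (Fin K)) 1).Nontrivial := by
    let v : EuclideanSpace ℝ (Fin K) := EuclideanSpace.single ⟨0, by omega⟩ 1
    have hv : ‖v‖ = 1 := by simp [v]
    refine ⟨v, by simp [hv], -v, by simp [hv], fun h => ?_⟩
    have h2 : v + v = 0 := by
      nth_rewrite 2 [h]
      exact add_neg_cancel v
    rw [← two_smul ℝ v, smul_eq_zero] at h2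
    rw [h2.resolve_left two_ne_zero, norm_zero] at hv
    exact zero_ne_one hv
  have hinf := (isPreconnected_sphere hrank (0 : EuclideanSpace ℝ (Fin K)) 1).infinite_of_nontrivial hne
  let f := hinf.natEmbedding
  exact ⟨fun j => f j, fun j => by simp,
    fun i j hij => f.injective (Subtype.ext hij)⟩

theorem norm_sum_sq_of_gram {F : Filter ℕ} {E : Type*} [NormedAddCommGroup E]
    [InnerProductSpace ℂ E] (J : ℕ) {φ : ℕ → ℕ → E} {β : ℝ} (hφ : ∀ j n, ‖φ j n‖ = β)
    (h : ∀ i j, i ≠ j → Tendsto (fun n => inner ℂ (φ i n) (φ j n)) F (𝓝 0)) :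
    Tendsto (fun n => ‖∑ j ∈ Finset.range J, φ j n‖ ^ 2) F (𝓝 (J * β ^ 2)) := by
  have h1 : ∀ n, ‖∑ j ∈ Finset.range J, φ j n‖ ^ 2 =
      (∑ i ∈ Finset.range J, ∑ j ∈ Finset.range J, inner ℂ (φ i n) (φ j n)).re := by
    intro n
    rw [← inner_self_eq_norm_sq (𝕜 := ℂ), sum_inner]
    simp_rw [inner_sum]
    rfl
  simp_rw [h1]
  have h2 : Tendsto (fun n => ∑ i ∈ Finset.range J, ∑ j ∈ Finset.range J,
      (inner ℂ (φ i n) (φ j n) : ℂ)) F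
      (𝓝 (∑ i ∈ Finset.range J, ∑ j ∈ Finset.range J, if i = j then ((β : ℂ) ^ 2) else 0)) := by
    refine tendsto_finsetSum _ fun i _ => tendsto_finsetSum _ fun j _ => ?_
    split_ifs with hij
    · subst hij
      simp_rw [inner_self_eq_norm_sq_to_K, hφ]
      exact tendsto_const_nhds
    · exact h i j hij
  have h3 := (Complex.continuous_re.tendsto _).comp h2
  refine (h3.congr fun n => rfl).trans (le_of_eq ?_)
  congr 1
  simp only [Finset.sum_ite_eq, Finset.mem_range]
  rw [Finset.sum_congr rfl (g := fun _ => (β : ℂ) ^ 2)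
    (fun i hi => if_pos (Finset.mem_range.1 hi))]
  simp [← Complex.ofReal_pow]

/-- By symmetry the value `c` is taken at `J` points of the sphere through `y`, in fixed directions,
so the points separate as `|y| → ∞`. Their evaluation vectors become orthogonal, hence `J |c|` is at
most about `√J ‖b‖ C`. This replaces a radial decay lemma. -/
theorem eventually_norm_lowPass_le_of_yPart {m : ℕ} {μ : ℝ} {F : Filter ℕ} (hK : 2 ≤ K)
    {w : ℕ → Space K L → ℝ} (hw : ∀ n, MemX m μ (w n)) {C : ℝ}
    (hC : ∀ᶠ n in F, ‖toModel m μ (w n)‖ ≤ C)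
    {x : ℕ → Space K L} (hx : Tendsto (fun n => ‖yPart (x n)‖) F atTop) (R : ℝ) {ε : ℝ}
    (hε : 0 < ε) : ∀ᶠ n in F, ‖lowPass R (ft (w n)) (x n)‖ ≤ ε := by
  obtain ⟨e, he, hinj⟩ := exists_unit_vectors hK
  set b := ballIndicator (Space K L) R with hb
  obtain ⟨J, hJ⟩ := exists_nat_gt ((‖b‖ ^ 2 * C ^ 2 + 1) / ε ^ 2)
  rw [div_lt_iff₀ (by positivity)] at hJ
  have hJ0 : (0 : ℝ) < J := by
    by_contra h
    have : (J : ℝ) * ε ^ 2 ≤ 0 := mul_nonpos_of_nonpos_of_nonneg (not_lt.1 h) (by positivity)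
    nlinarith [sq_nonneg (‖b‖ * C)]
  let p : ℕ → ℕ → Space K L := fun j n => pair (‖yPart (x n)‖ • e j) (zPart (x n))
  let φ : ℕ → ℕ → L2C (Space K L) := fun j n => mulPhase (-p j n) b
  have hval : ∀ j n, inner ℂ (φ j n) (ft (w n)) = lowPass R (ft (w n)) (x n) := by
    intro j n
    rw [← lowPass_eq_inner]
    have h1 : x n = pair (yPart (x n)) (zPart (x n)) := (pair_yPart_zPart _).symm
    conv_rhs => rw [h1]
    exact (hw n).lowPass_reflect R (by rw [norm_smul, he, mul_one, norm_norm]) _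
  have hgram := norm_sum_sq_of_gram (F := F) J (φ := φ) (β := ‖b‖)
    (fun j n => LinearIsometry.norm_map _ _) (fun i j hij => by
      have h1 : ∀ n, inner ℂ (φ i n) (φ j n) = inner ℂ (mulPhase (p j n - p i n) b) b := by
        intro n
        rw [← (mulPhase (p j n)).inner_map_map, ← mulPhase_add, ← mulPhase_add, add_neg_cancel,
          mulPhase_zero, sub_eq_add_neg]
      simp_rw [h1]
      refine (tendsto_inner_mulPhase_cocompact b b).comp ?_
      rw [← Metric.cobounded_eq_cocompact, ← tendsto_norm_atTop_iff_cobounded]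
      have h2 : ∀ n, ‖p j n - p i n‖ = ‖yPart (x n)‖ * ‖e j - e i‖ := by
        intro n
        have : p j n - p i n = pair (‖yPart (x n)‖ • (e j - e i)) 0 := by
          ext k
          rcases k with k | k <;> simp [p, pair, mul_sub]
        rw [this, ← sq_eq_sq₀ (norm_nonneg _) (by positivity), norm_pair_sq, norm_smul, norm_norm]
        simp
      simp_rw [h2]
      exact hx.atTop_mul_const (norm_pos_iff.2 (sub_ne_zero.2 fun h => hij (hinj h).symm)))
  -- The slack is chosen so that, multiplied by `C²`, it costs at most `J`; this is the `+ 1` in the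
  -- choice of `J`.
  have hlt : (J : ℝ) * ‖b‖ ^ 2 < J * ‖b‖ ^ 2 + J / (C ^ 2 + 1) := by
    have : 0 < J / (C ^ 2 + 1) := by positivity
    linarith
  filter_upwards [hC, hgram.eventually (gt_mem_nhds hlt)] with n hn hg
  set c := lowPass R (ft (w n)) (x n) with hc
  have h1 : inner ℂ (∑ j ∈ Finset.range J, φ j n) (ft (w n)) = J * c := by
    rw [sum_inner]
    simp_rw [hval]
    rw [Finset.sum_const, Finset.card_range, nsmul_eq_mul]
  have h2 : (J : ℝ) * ‖c‖ ≤ ‖∑ j ∈ Finset.range J, φ j n‖ * C := by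
    have h3 := norm_inner_le_norm (𝕜 := ℂ) (∑ j ∈ Finset.range J, φ j n) (ft (w n))
    rw [h1, norm_mul, Complex.norm_natCast] at h3
    exact h3.trans (mul_le_mul_of_nonneg_left ((norm_ft_le_norm_toModel m μ _).trans hn)
      (norm_nonneg _))
  have h3 : ((J : ℝ) * ‖c‖) ^ 2 ≤ (‖∑ j ∈ Finset.range J, φ j n‖ * C) ^ 2 :=
    pow_le_pow_left₀ (by positivity) h2 2
  have h4 : (J : ℝ) ^ 2 * ‖c‖ ^ 2 ≤ (J * ‖b‖ ^ 2 + J / (C ^ 2 + 1)) * C ^ 2 := by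
    rw [mul_pow, mul_pow] at h3
    exact h3.trans (mul_le_mul_of_nonneg_right hg.le (sq_nonneg C))
  have h5 : (J : ℝ) / (C ^ 2 + 1) * C ^ 2 ≤ J := by
    rw [div_mul_eq_mul_div, div_le_iff₀ (by positivity)]
    nlinarith
  have h6 : (J : ℝ) * (J * ‖c‖ ^ 2) ≤ J * (J * ε ^ 2) := by nlinarith
  have h7 : ‖c‖ ^ 2 ≤ ε ^ 2 := le_of_mul_le_mul_left (le_of_mul_le_mul_left h6 hJ0) hJ0
  exact abs_le_of_sq_le_sq' h7 hε.le |>.2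

theorem lowPass_eq_modelShift (m : ℕ) (μ : ℝ) (u : Space K L → ℝ) (R : ℝ) (x : Space K L) :
    lowPass R (ft u) x = inner ℂ (mulPhase (-pair (yPart x) 0) (ballIndicator (Space K L) R))
      (modelShift (zPart x) (toModel m μ u) 0) := by
  rw [modelShift_apply, toModel_zero, ← lowPass_eq_inner, ← lowPass_add, pair_add_pair_zero,
    zero_add, pair_yPart_zPart]

/-- A bounded sequence of cylindrical functions all of whose translates have small weak limits has
uniformly small low frequency parts. -/
theorem eventually_norm_lowPass_le {m : ℕ} {μ : ℝ} (𝒰 : Ultrafilter ℕ) (hK : 2 ≤ K)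
    {w : ℕ → Space K L → ℝ} (hw : ∀ n, MemX m μ (w n)) {C : ℝ}
    (hC : ∀ᶠ n in 𝒰, ‖toModel m μ (w n)‖ ≤ C) {ν : ℝ}
    (hν : ∀ (ζ : ℕ → EuclideanSpace ℝ (Fin L)) (g : Model K L),
      WeakLim 𝒰 (fun n => modelShift (ζ n) (toModel m μ (w n))) g → ‖g‖ ≤ ν) (R : ℝ) {ε : ℝ}
    (hε : 0 < ε) : ∀ᶠ n in 𝒰, ∀ x,
      ‖lowPass R (ft (w n)) x‖ ≤ ‖ballIndicator (Space K L) R‖ * ν + ε := by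
  set b := ballIndicator (Space K L) R with hb
  by_contra hcon
  have hcon' : ∀ᶠ n in (𝒰 : Filter ℕ), ∃ x, ‖b‖ * ν + ε < ‖lowPass R (ft (w n)) x‖ := by
    have := Ultrafilter.eventually_not.2 hcon
    filter_upwards [this] with n hn
    push Not at hn
    exact hn
  obtain ⟨x, hx⟩ : ∃ x : ℕ → Space K L, ∀ᶠ n in (𝒰 : Filter ℕ),
      ‖b‖ * ν + ε < ‖lowPass R (ft (w n)) (x n)‖ := by
    classical
    refine ⟨fun n => if h : ∃ x, ‖b‖ * ν + ε < ‖lowPass R (ft (w n)) x‖ then h.choose else 0, ?_⟩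
    filter_upwards [hcon'] with n hn
    rw [dif_pos hn]
    exact hn.choose_spec
  have hC' : ∀ᶠ n in (𝒰 : Filter ℕ), ‖modelShift (zPart (x n)) (toModel m μ (w n))‖ ≤ C := by
    filter_upwards [hC] with n hn
    rwa [LinearIsometry.norm_map]
  obtain ⟨g, hg⟩ := exists_weakLim 𝒰 hC'
  have hgν := hν _ g hg
  have hν0 : 0 ≤ ν := (norm_nonneg _).trans hgν
  -- If `|y|` diverges, symmetry makes the value small. Otherwise `y` converges along the
  -- ultrafilter, the shift in `z` is absorbed into the function, and the value tends to an inner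
  -- product with the weak limit `g`.
  by_cases hy : Tendsto (fun n => ‖yPart (x n)‖) 𝒰 atTop
  · obtain ⟨n, h1, h2⟩ := (hx.and
      (eventually_norm_lowPass_le_of_yPart hK hw hC hy R hε)).exists
    have : 0 ≤ ‖b‖ * ν := by positivity
    linarith
  · rw [tendsto_atTop] at hy
    push Not at hy
    obtain ⟨r, hr⟩ := hy
    have hr' : ∀ᶠ n in (𝒰 : Filter ℕ), yPart (x n) ∈
        Metric.closedBall (0 : EuclideanSpace ℝ (Fin K)) r := by
      filter_upwards [hr] with n hn
      rw [mem_closedBall_zero_iff]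
      exact hn.le
    obtain ⟨a, -, ha⟩ := (isCompact_closedBall (0 : EuclideanSpace ℝ (Fin K)) r).ultrafilter_le_nhds
      (𝒰.map fun n => yPart (x n)) (by rw [le_principal_iff]; exact hr')
    have hpair : Continuous fun y : EuclideanSpace ℝ (Fin K) => (pair y 0 : Space K L) := by
      unfold pair
      refine (PiLp.continuous_toLp 2 _).comp (continuous_pi fun i => ?_)
      rcases i with i | i
      · simpa using (by fun_prop : Continuous fun y : EuclideanSpace ℝ (Fin K) => y i)
      · simpa using continuous_const
    have hb' : Tendsto (fun n => mulPhase (-pair (yPart (x n)) 0) b) 𝒰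
        (𝓝 (mulPhase (-pair a 0) b)) :=
      ((continuous_mulPhase b).comp (hpair.neg)).tendsto a |>.comp ha
    have hC0 : ∀ᶠ n in (𝒰 : Filter ℕ),
        ‖modelShift (zPart (x n)) (toModel m μ (w n)) 0‖ ≤ C := by
      filter_upwards [hC'] with n hn
      exact (PiLp.norm_apply_le _ _).trans hn
    have h1 := ((hg.comp_apply 0).tendsto_complex_inner hC0 hb').norm
    simp_rw [hb, ← lowPass_eq_modelShift] at h1
    have h2 := ge_of_tendsto h1 (hx.mono fun n hn => hn.le)
    have h3 := norm_inner_le_norm (𝕜 := ℂ) (mulPhase (-pair a 0) b) (g 0)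
    rw [LinearIsometry.norm_map] at h3
    have h4 : ‖b‖ * ‖g 0‖ ≤ ‖b‖ * ν :=
      mul_le_mul_of_nonneg_left ((PiLp.norm_apply_le _ _).trans hgν) (norm_nonneg _)
    linarith

/-- Evaluation vectors depend continuously on the point, so on a compact set weak convergence to `0`
makes low frequency parts uniformly small. -/
theorem eventually_norm_lowPass_le_on_ball {m : ℕ} {μ : ℝ} (𝒰 : Ultrafilter ℕ)
    {w : ℕ → Space K L → ℝ} {C : ℝ} (hC : ∀ᶠ n in 𝒰, ‖toModel m μ (w n)‖ ≤ C)
    (h0 : WeakLim 𝒰 (fun n => toModel m μ (w n)) 0) (R ρ : ℝ) {ε : ℝ}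
    (hε : 0 < ε) : ∀ᶠ n in 𝒰, ∀ x ∈ Metric.closedBall (0 : Space K L) ρ,
      ‖lowPass R (ft (w n)) x‖ ≤ ε := by
  set b := ballIndicator (Space K L) R with hb
  by_contra hcon
  have hcon' : ∀ᶠ n in (𝒰 : Filter ℕ), ∃ x ∈ Metric.closedBall (0 : Space K L) ρ,
      ε < ‖lowPass R (ft (w n)) x‖ := by
    have := Ultrafilter.eventually_not.2 hcon
    filter_upwards [this] with n hn
    push Not at hn
    exact hn
  obtain ⟨x, hx⟩ : ∃ x : ℕ → Space K L, ∀ᶠ n in (𝒰 : Filter ℕ),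
      x n ∈ Metric.closedBall (0 : Space K L) ρ ∧ ε < ‖lowPass R (ft (w n)) (x n)‖ := by
    classical
    refine ⟨fun n => if h : ∃ x ∈ Metric.closedBall (0 : Space K L) ρ,
      ε < ‖lowPass R (ft (w n)) x‖ then h.choose else 0, ?_⟩
    filter_upwards [hcon'] with n hn
    rw [dif_pos hn]
    exact hn.choose_spec
  obtain ⟨a, -, ha⟩ := (isCompact_closedBall (0 : Space K L) ρ).ultrafilter_le_nhds
    (𝒰.map x) (by rw [le_principal_iff]; exact hx.mono fun n hn => hn.1)
  have hb' : Tendsto (fun n => mulPhase (-(x n)) b) 𝒰 (𝓝 (mulPhase (-a) b)) :=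
    ((continuous_mulPhase b).comp continuous_neg).tendsto a |>.comp ha
  have hC0 : ∀ᶠ n in (𝒰 : Filter ℕ), ‖ft (w n)‖ ≤ C := by
    filter_upwards [hC] with n hn
    exact (norm_ft_le_norm_toModel m μ _).trans hn
  have h00 : WeakLim 𝒰 (fun n => ft (w n)) 0 := h0.comp_apply 0
  have h1 := (h00.tendsto_complex_inner hC0 hb').norm
  rw [inner_zero_right, norm_zero] at h1
  simp_rw [hb, ← lowPass_eq_inner] at h1
  have h2 := ge_of_tendsto h1 (hx.mono fun n hn => hn.2.le)
  linarith

/-- Functions with small low frequency part are small in measure. -/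
theorem exists_measure_le_of_lowPass {m : ℕ} (hm : 1 ≤ m) (μ B : ℝ) {δ κ : ℝ} (hδ : 0 < δ)
    (hκ : 0 < κ) : ∃ R : ℝ, ∀ u : Space K L → ℝ, MemX m μ u → ‖toModel m μ u‖ ≤ B →
      ∀ S : Set (Space K L), (∀ x ∈ S, ‖lowPass R (ft u) x‖ ≤ δ / 2) →
        volume (S ∩ {x | δ ≤ |u x|}) ≤ ENNReal.ofReal κ := by
  -- For `|ξ| ≥ R > 1` one has `|ξ|^(2m) ≥ R`, so the frequency tail is at most `B² / R`; Chebyshev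
  -- at height `δ / 2` contributes the factor `4 / δ²`.
  obtain ⟨R, hR⟩ := exists_nat_gt (4 / δ ^ 2 * B ^ 2 / κ + 1)
  have hR1 : (1 : ℝ) < R := lt_of_le_of_lt (by simpa using by positivity) hR
  refine ⟨R, fun u hu huB S hS => ?_⟩
  have h1 := measure_le_of_norm_lowPass_le hu.memLp (R := R) (η := δ / 2) (half_pos hδ)
    (S := S ∩ {x | δ ≤ |u x|}) (.of_forall fun x hx => by
      have h2 : δ ≤ ‖(u x : ℂ)‖ := by
        rw [Complex.norm_real]; exact hx.2
      have := norm_sub_norm_le (u x : ℂ) (lowPass R (ft u) x)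
      linarith [hS x hx.1])
  have h2 : ∫⁻ ξ in (Metric.ball (0 : Space K L) R)ᶜ, ENNReal.ofReal (‖ft u ξ‖ ^ 2) ≤
      ENNReal.ofReal (B ^ 2 / R) := by
    calc ∫⁻ ξ in (Metric.ball (0 : Space K L) R)ᶜ, ENNReal.ofReal (‖ft u ξ‖ ^ 2)
        ≤ ∫⁻ ξ in (Metric.ball (0 : Space K L) R)ᶜ, ENNReal.ofReal (1 / R) *
          ENNReal.ofReal ((1 + ‖ξ‖ ^ (2 * m)) * ‖ft u ξ‖ ^ 2) := by
          refine setLIntegral_mono' Metric.isOpen_ball.measurableSet.compl fun ξ hξ => ?_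
          rw [← ENNReal.ofReal_mul (by positivity)]
          refine ENNReal.ofReal_le_ofReal ?_
          have h3 : (R : ℝ) ≤ ‖ξ‖ := by simpa using hξ
          have h4 : ‖ξ‖ ≤ ‖ξ‖ ^ (2 * m) := le_self_pow₀ (hR1.le.trans h3) (by omega)
          rw [one_div, ← div_eq_inv_mul, le_div_iff₀ (by linarith)]
          nlinarith [sq_nonneg ‖ft u ξ‖]
      _ ≤ ENNReal.ofReal (1 / R) * ENNReal.ofReal (B ^ 2) := by
          rw [lintegral_const_mul' _ _ ENNReal.ofReal_ne_top]
          exact mul_le_mul_right ((setLIntegral_le_lintegral _ _).trans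
            (hu.lintegral_weight_le huB)) _
      _ = _ := by
          rw [← ENNReal.ofReal_mul (by positivity)]
          congr 1
          ring
  refine h1.trans ((mul_le_mul_right h2 _).trans ?_)
  rw [← ENNReal.ofReal_mul (by positivity)]
  refine ENNReal.ofReal_le_ofReal ?_
  have h5 : 4 / δ ^ 2 * B ^ 2 / κ < R := by linarith
  rw [div_lt_iff₀ hκ] at h5
  have e : 1 / (δ / 2) ^ 2 * (B ^ 2 / R) = 4 / δ ^ 2 * B ^ 2 / R := by
    field_simp
    ring
  rw [e, div_le_iff₀ (by linarith)]
  linarith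

end LowPassLimits

end SingularPolyharmonic

namespace SingularPolyharmonic

open FourierTransform RealInnerProductSpace

/-! ### The vanishing lemma and the Brezis–Lieb splitting. -/

section BrezisLieb

variable {K L : ℕ}

/-- A quantitative vanishing lemma: small weak limits of all translates make the low frequency part
uniformly small, hence the set `|w n| ≥ δ` small in measure; the tails are small anyway. The
threshold depends only on the bound `B` and on `ε`, not on the sequence. -/
theorem exists_eventually_lintegral_le {m : ℕ} (hm : 1 ≤ m) (hK : 2 * m ≤ K) (μ : ℝ) {H : ℝ → ℝ}
    (hH : Continuous H) (hH0 : SuperquadraticAtZero H) (hHinf : SubcriticalAtInfinity (K + L) m H)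
    (B : ℝ) {ε : ℝ} (hε : 0 < ε) (𝒰 : Ultrafilter ℕ) :
    ∃ ν > 0, ∀ w : ℕ → Space K L → ℝ, (∀ n, MemX m μ (w n)) →
      (∀ᶠ n in 𝒰, ‖toModel m μ (w n)‖ ≤ B) →
      (∀ (ζ : ℕ → EuclideanSpace ℝ (Fin L)) (g : Model K L),
        WeakLim 𝒰 (fun n => modelShift (ζ n) (toModel m μ (w n))) g → ‖g‖ ≤ ν) →
      ∀ᶠ n in 𝒰, ∫⁻ x, ENNReal.ofReal |H (w n x)| ≤ ENNReal.ofReal ε := by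
  obtain ⟨δ, M, hδ, hM, h⟩ := exists_tail_bound (L := L) hm hK μ hH hH0 hHinf B (half_pos hε)
  obtain ⟨C, hC⟩ := (isCompact_Icc (a := -M) (b := M)).exists_bound_of_continuousOn hH.continuousOn
  obtain ⟨R, hR⟩ := exists_measure_le_of_lowPass (K := K) (L := L) hm μ B hδ
    (show 0 < ε / (2 * (|C| + 1)) by positivity)
  set b := ballIndicator (Space K L) R
  refine ⟨δ / (4 * (‖b‖ + 1)), by positivity, fun w hw hwB hν => ?_⟩
  filter_upwards [hwB, eventually_norm_lowPass_le 𝒰 (by omega) hw hwB hν R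
    (show 0 < δ / 4 by positivity)] with n hn hlow
  have h1 : ‖b‖ * (δ / (4 * (‖b‖ + 1))) ≤ δ / 4 := by
    rw [mul_div_assoc', div_le_div_iff₀ (by positivity) (by positivity)]
    nlinarith [norm_nonneg b]
  have h2 := hR (w n) (hw n) hn Set.univ fun x _ => (hlow x).trans (by linarith)
  rw [Set.univ_inter] at h2
  refine (lintegral_abs_comp_le (δ := δ) (C := |C|) (hw n).memLp
    fun t ht => (hC t ht).trans (le_abs_self C)).trans ((add_le_add (h _ (hw n) hn)
      (mul_le_mul_right h2 _)).trans ?_)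
  rw [← ENNReal.ofReal_mul (abs_nonneg C), ← ENNReal.ofReal_add (by positivity) (by positivity)]
  refine ENNReal.ofReal_le_ofReal ?_
  have h3 : |C| * (ε / (2 * (|C| + 1))) ≤ ε / 2 := by
    rw [mul_div_assoc', div_le_div_iff₀ (by positivity) (by positivity)]
    nlinarith [abs_nonneg C]
  linarith

/-- Weakly null sequences tend to `0` in measure on sets of finite measure: discard the part of `P`
outside a large ball, and inside it use the smallness of low frequencies. -/
theorem eventually_measure_inter_le {m : ℕ} (hm : 1 ≤ m) {μ : ℝ} (𝒰 : Ultrafilter ℕ)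
    {w : ℕ → Space K L → ℝ} (hw : ∀ n, MemX m μ (w n)) {B : ℝ}
    (hB : ∀ᶠ n in 𝒰, ‖toModel m μ (w n)‖ ≤ B) (h0 : WeakLim 𝒰 (fun n => toModel m μ (w n)) 0)
    {P : Set (Space K L)} (hP : volume P ≠ ⊤) {η κ : ℝ} (hη : 0 < η) (hκ : 0 < κ) :
    ∀ᶠ n in 𝒰, volume (P ∩ {x | η ≤ |w n x|}) ≤ ENNReal.ofReal κ := by
  have hlim : Tendsto (fun ρ : ℕ => volume (P ∩ (Metric.closedBall (0 : Space K L) ρ)ᶜ)) atTop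
      (𝓝 0) := by
    have h1 : Tendsto (fun ρ : ℕ => (volume.restrict P) (Metric.closedBall (0 : Space K L) ρ)ᶜ) atTop
        (𝓝 ((volume.restrict P) (⋂ ρ : ℕ, (Metric.closedBall (0 : Space K L) ρ)ᶜ))) := by
      refine tendsto_measure_iInter_atTop
        (fun ρ => Metric.isClosed_closedBall.measurableSet.compl.nullMeasurableSet) ?_ ⟨0, ?_⟩
      · intro a b hab
        refine Set.compl_subset_compl.2 (Metric.closedBall_subset_closedBall ?_)
        exact_mod_cast hab
      · refine ne_top_of_le_ne_top hP ((measure_mono (Set.subset_univ _)).trans ?_)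
        rw [Measure.restrict_apply_univ]
    have h2 : (⋂ ρ : ℕ, (Metric.closedBall (0 : Space K L) ρ)ᶜ) = ∅ := by
      rw [← Set.compl_iUnion, Metric.iUnion_closedBall_nat, Set.compl_univ]
    rw [h2, measure_empty] at h1
    refine h1.congr fun ρ => ?_
    rw [Measure.restrict_apply Metric.isClosed_closedBall.measurableSet.compl, Set.inter_comm]
  obtain ⟨ρ, hρ⟩ := (hlim.eventually (gt_mem_nhds
    (show (0 : ENNReal) < ENNReal.ofReal (κ / 2) by
      rw [ENNReal.ofReal_pos]; exact half_pos hκ))).exists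
  obtain ⟨R, hR⟩ := exists_measure_le_of_lowPass (K := K) (L := L) hm μ B hη (half_pos hκ)
  filter_upwards [hB, eventually_norm_lowPass_le_on_ball 𝒰 hB h0 R ρ (half_pos hη)] with n hn hlow
  have h1 := hR (w n) (hw n) hn (Metric.closedBall 0 ρ) hlow
  have hsub : P ∩ {x | η ≤ |w n x|} ⊆ P ∩ (Metric.closedBall (0 : Space K L) ρ)ᶜ ∪
      Metric.closedBall 0 ρ ∩ {x | η ≤ |w n x|} := by
    rintro x ⟨h1, h2⟩
    by_cases h : x ∈ Metric.closedBall (0 : Space K L) ρ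
    · exact Or.inr ⟨h, h2⟩
    · exact Or.inl ⟨h1, h⟩
  refine (measure_mono hsub).trans ((measure_union_le _ _).trans ((add_le_add hρ.le h1).trans ?_))
  rw [← ENNReal.ofReal_add (by positivity) (by positivity), add_halves]

/-- Truncation of a continuous function away from `0` and infinity. -/
theorem exists_cutoff {H : ℝ → ℝ} (hH : Continuous H) {δ M : ℝ} (hδ : 0 < δ) :
    ∃ G : ℝ → ℝ, UniformContinuous G ∧ (∃ C, 0 ≤ C ∧ ∀ t, |G t| ≤ C) ∧
      (∀ t, |t| ≤ δ / 2 → G t = 0) ∧ (∀ t, δ ≤ |t| → |t| ≤ M → G t = H t) ∧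
      ∀ t, |H t - G t| ≤ |H t| := by
  -- Piecewise linear in `|t|`: it rises on `[δ/2, δ]` and, when `δ ≤ M`, falls on `[M, M + 1]`.
  let χ : ℝ → ℝ := fun t => min 1 (max 0 (2 / δ * |t| - 1)) * min 1 (max 0 (M + 1 - |t|))
  have hχ : Continuous χ := by fun_prop
  have hχ0 : ∀ t, 0 ≤ χ t := fun t => mul_nonneg (le_min zero_le_one (le_max_left _ _))
    (le_min zero_le_one (le_max_left _ _))
  have hχ1 : ∀ t, χ t ≤ 1 := fun t => mul_le_one₀ (min_le_left _ _)
    (le_min zero_le_one (le_max_left _ _)) (min_le_left _ _)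
  have hG : Continuous fun t => χ t * H t := hχ.mul hH
  have hsupp : HasCompactSupport fun t => χ t * H t := by
    refine HasCompactSupport.of_support_subset_isCompact (isCompact_Icc (a := -(M + 1)) (b := M + 1))
      fun t ht => ?_
    refine abs_le.1 ?_
    by_contra hcon
    refine ht ?_
    have : max 0 (M + 1 - |t|) = 0 := max_eq_left (by linarith [not_le.1 hcon])
    simp [χ, this]
  refine ⟨fun t => χ t * H t, hsupp.uniformContinuous_of_continuous hG, ?_, fun t ht => ?_,
    fun t h1 h2 => ?_, fun t => ?_⟩
  · obtain ⟨C, hC⟩ := hsupp.exists_bound_of_continuous hG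
    exact ⟨C, (norm_nonneg _).trans (hC 0), hC⟩
  · have h1 : 2 / δ * |t| - 1 ≤ 0 := by
      rw [sub_nonpos, div_mul_eq_mul_div, div_le_one hδ]
      linarith
    simp [χ, max_eq_left h1]
  · have h3 : 1 ≤ 2 / δ * |t| - 1 := by
      rw [le_sub_iff_add_le, div_mul_eq_mul_div, le_div_iff₀ hδ]
      linarith
    have e1 : min 1 (max 0 (2 / δ * |t| - 1)) = 1 := min_eq_left (le_max_of_le_right h3)
    have e2 : min 1 (max 0 (M + 1 - |t|)) = 1 := min_eq_left (le_max_of_le_right (by linarith))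
    simp only [χ, e1, e2, one_mul]
  · have : H t - χ t * H t = (1 - χ t) * H t := by ring
    rw [this, abs_mul, abs_of_nonneg (by linarith [hχ1 t])]
    exact mul_le_of_le_one_left (abs_nonneg _) (by linarith [hχ0 t])

/-- If `b` is small, `G b = 0` and uniform continuity applies, with an error only where `a` is not
small; symmetrically if `a` is small. The crude bound `3C` remains only where neither is, and there
the measure will be small. -/
theorem brezisLieb_pointwise {G : ℝ → ℝ} {C δ η η' τ τ' : ℝ} (hC : ∀ t, |G t| ≤ C)
    (hG0 : ∀ t, |t| ≤ 2 * δ → G t = 0) (hηδ : η ≤ δ) (hη' : η' ≤ 2 * δ) (hη0 : 0 ≤ τ)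
    (hτ' : 0 ≤ τ')
    (hτη : ∀ t s, |s| < η → |G (t + s) - G t| ≤ τ)
    (hτη' : ∀ t s, |s| < η' → |G (t + s) - G t| ≤ τ') (a b : ℝ) :
    |G (a + b) - G a - G b| ≤ (if δ ≤ |a| then τ else 0) +
      ((if η ≤ |b| then τ' else 0) + if η ≤ |b| ∧ η' ≤ |a| then 3 * C else 0) := by
  have hC0 : 0 ≤ C := (abs_nonneg _).trans (hC 0)
  by_cases hb : η ≤ |b|
  · have hnn : 0 ≤ if δ ≤ |a| then τ else 0 := by split_ifs <;> linarith
    rw [if_pos hb]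
    by_cases ha : η' ≤ |a|
    · rw [if_pos (show η ≤ |b| ∧ η' ≤ |a| from ⟨hb, ha⟩)]
      have h1 := abs_sub (G (a + b) - G a) (G b)
      have h2 := abs_sub (G (a + b)) (G a)
      linarith [hC (a + b), hC a, hC b]
    · rw [if_neg (show ¬(η ≤ |b| ∧ η' ≤ |a|) from fun h => ha h.2)]
      have h1 := hτη' b a (not_le.1 ha)
      rw [hG0 a ((not_le.1 ha).le.trans hη'), sub_zero, add_comm a b]
      linarith
  · rw [if_neg hb, if_neg (show ¬(η ≤ |b| ∧ η' ≤ |a|) from fun h => hb h.1)]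
    have hb' := not_le.1 hb
    have hδ : 0 < δ := lt_of_le_of_lt (abs_nonneg b) (hb'.trans_le hηδ)
    rw [hG0 b (by linarith), sub_zero]
    by_cases ha : δ ≤ |a|
    · rw [if_pos ha]
      linarith [hτη a b hb']
    · rw [if_neg ha, hG0 a (by linarith), hG0 (a + b) (by linarith [abs_add_le a b])]
      simp

/-- The Brezis-Lieb splitting of `∫ H(u)` along weakly convergent sequences. -/
theorem tendsto_integral_add_sub {m : ℕ} (hm : 1 ≤ m) (hK : 2 * m ≤ K) {μ : ℝ} {H : ℝ → ℝ}
    (hH : Continuous H) (hH0 : SuperquadraticAtZero H) (hHinf : SubcriticalAtInfinity (K + L) m H)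
    (𝒰 : Ultrafilter ℕ) {w : ℕ → Space K L → ℝ} (hw : ∀ n, MemX m μ (w n)) {B : ℝ}
    (hB : ∀ᶠ n in 𝒰, ‖toModel m μ (w n)‖ ≤ B) (h0 : WeakLim 𝒰 (fun n => toModel m μ (w n)) 0)
    {U : Space K L → ℝ} (hU : MemX m μ U) :
    Tendsto (fun n => (∫ x, H ((w n + U) x)) - ∫ x, H (w n x)) 𝒰 (𝓝 (∫ x, H (U x))) := by
  rw [Metric.tendsto_nhds]
  intro ε hε
  have hB0 : 0 ≤ B := by
    obtain ⟨n, hn⟩ := hB.exists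
    exact (norm_nonneg _).trans hn
  obtain ⟨δ, M, hδ, hM, htail⟩ := exists_tail_bound (L := L) hm hK μ hH hH0 hHinf
    (B + ‖toModel m μ U‖) (show 0 < ε / 8 by positivity)
  obtain ⟨G, hGu, ⟨C, hC0, hC⟩, hG0, hGH, hGle⟩ := exists_cutoff (M := M) hH hδ
  set A := 1 / (δ / 4) ^ 2 * B ^ 2 with hA
  have hA0 : 0 ≤ A := by positivity
  -- The order of choices matters: `A` bounds the measure of `{|w n| ≥ δ/4}` for all relevant `n`
  -- and fixes `η`; then `{|U| ≥ η}` has finite measure `p`, which fixes `η'`.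
  obtain ⟨η₁, hη₁, hτη⟩ := Metric.uniformContinuous_iff.1 hGu (ε / (8 * (A + 1))) (by positivity)
  set η := min η₁ (δ / 4) with hη
  have hη0 : 0 < η := lt_min hη₁ (by positivity)
  set P := {x | η ≤ |U x|} with hP
  have hPfin : volume P ≠ ⊤ := ((measure_le_abs_le hU.memLp hη0).trans_lt
    (ENNReal.mul_lt_top ENNReal.ofReal_lt_top ENNReal.ofReal_lt_top)).ne
  set p := (volume P).toReal with hp
  have hPp : volume P = ENNReal.ofReal p := (ENNReal.ofReal_toReal hPfin).symm
  have hp0 : 0 ≤ p := ENNReal.toReal_nonneg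
  obtain ⟨η₂, hη₂, hτη'⟩ := Metric.uniformContinuous_iff.1 hGu (ε / (8 * (p + 1))) (by positivity)
  set η' := min η₂ (δ / 4) with hη'
  have hη'0 : 0 < η' := lt_min hη₂ (by positivity)
  filter_upwards [hB, eventually_measure_inter_le hm 𝒰 hw hB h0 hPfin hη'0
    (show 0 < ε / (8 * (3 * C + 1)) by positivity)] with n hn hvol
  have hsum : MemX m μ (w n + U) := (hw n).add hU
  have hnsum : ‖toModel m μ (w n + U)‖ ≤ B + ‖toModel m μ U‖ := by
    rw [toModel_add (hw n) hU]
    exact (norm_add_le _ _).trans (add_le_add_left hn _)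
  have htrunc : ∀ u : Space K L → ℝ, MemX m μ u → ‖toModel m μ u‖ ≤ B + ‖toModel m μ U‖ →
      ∫⁻ x, ENNReal.ofReal |H (u x) - G (u x)| ≤ ENNReal.ofReal (ε / 8) := by
    intro u hu huB
    refine le_trans ?_ (htail u hu huB)
    have habs : AEMeasurable (fun x => |u x|) := hu.memLp.aestronglyMeasurable.norm.aemeasurable
    have hS : NullMeasurableSet {x | |u x| < δ ∨ M < |u x|} :=
      (nullMeasurableSet_lt habs aemeasurable_const).union
        (nullMeasurableSet_lt aemeasurable_const habs)
    rw [← lintegral_indicator₀ hS]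
    refine lintegral_mono fun x => ?_
    by_cases hx : x ∈ {x | |u x| < δ ∨ M < |u x|}
    · rw [Set.indicator_of_mem hx]
      exact ENNReal.ofReal_le_ofReal (hGle _)
    · have hx' : ¬ (|u x| < δ ∨ M < |u x|) := hx
      push Not at hx'
      rw [hGH _ hx'.1 hx'.2, sub_self, abs_zero, ENNReal.ofReal_zero]
      exact zero_le
  have hwm : AEMeasurable (fun x => |w n x|) := (hw n).memLp.aestronglyMeasurable.norm.aemeasurable
  have hUm : AEMeasurable (fun x => |U x|) := hU.memLp.aestronglyMeasurable.norm.aemeasurable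
  have hmain : ∫⁻ x, ENNReal.ofReal |G (w n x + U x) - G (w n x) - G (U x)| ≤
      ENNReal.ofReal (3 * (ε / 8)) := by
    have hpt : ∀ x, ENNReal.ofReal |G (w n x + U x) - G (w n x) - G (U x)| ≤
        {x | δ / 4 ≤ |w n x|}.indicator (fun _ => ENNReal.ofReal (ε / (8 * (A + 1)))) x +
          (P.indicator (fun _ => ENNReal.ofReal (ε / (8 * (p + 1)))) x +
            (P ∩ {x | η' ≤ |w n x|}).indicator (fun _ => ENNReal.ofReal (3 * C)) x) := by
      intro x
      have h1 := brezisLieb_pointwise (δ := δ / 4) (η := η) (η' := η') (τ := ε / (8 * (A + 1)))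
        (τ' := ε / (8 * (p + 1))) hC (fun t ht => hG0 t (by linarith)) (min_le_right _ _)
        ((min_le_right _ _).trans (by linarith)) (by positivity) (by positivity)
        (fun t s hs => by
          have := hτη (a := t + s) (b := t) (by
            rw [Real.dist_eq, add_sub_cancel_left]; exact hs.trans_le (min_le_left _ _))
          rw [Real.dist_eq] at this
          exact this.le)
        (fun t s hs => by
          have := hτη' (a := t + s) (b := t) (by
            rw [Real.dist_eq, add_sub_cancel_left]; exact hs.trans_le (min_le_left _ _))
          rw [Real.dist_eq] at this
          exact this.le) (w n x) (U x)
      refine (ENNReal.ofReal_le_ofReal h1).trans (le_of_eq ?_)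
      rw [ENNReal.ofReal_add (by split_ifs <;> positivity)
          (add_nonneg (by split_ifs <;> positivity) (by split_ifs <;> positivity)),
        ENNReal.ofReal_add (by split_ifs <;> positivity) (by split_ifs <;> positivity)]
      simp only [Set.indicator, hP, Set.mem_ofPred_eq, Set.mem_inter_iff]
      split_ifs <;> simp
    refine (lintegral_mono hpt).trans ?_
    rw [lintegral_add_left' (aemeasurable_const.indicator₀
        (nullMeasurableSet_le aemeasurable_const hwm)),
      lintegral_add_left' (aemeasurable_const.indicator₀
        (nullMeasurableSet_le aemeasurable_const hUm))]
    refine (add_le_add (lintegral_indicator_const_le _ _) (add_le_add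
      (lintegral_indicator_const_le _ _) (lintegral_indicator_const_le _ _))).trans ?_
    have hvolA : volume {x | δ / 4 ≤ |w n x|} ≤ ENNReal.ofReal A := by
      refine (measure_le_abs_le (hw n).memLp (by positivity)).trans ?_
      rw [hA, ENNReal.ofReal_mul (by positivity)]
      exact mul_le_mul_right (ENNReal.ofReal_le_ofReal (pow_le_pow_left₀ (norm_nonneg _)
        ((norm_ft_le_norm_toModel m μ _).trans hn) 2)) _
    refine (add_le_add (mul_le_mul_right hvolA _) (add_le_add
      (mul_le_mul_right hPp.le _) (mul_le_mul_right hvol _))).trans ?_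
    rw [← ENNReal.ofReal_mul (by positivity), ← ENNReal.ofReal_mul (by positivity),
      ← ENNReal.ofReal_mul (by positivity), ← ENNReal.ofReal_add (by positivity) (by positivity),
      ← ENNReal.ofReal_add (by positivity) (by positivity)]
    refine ENNReal.ofReal_le_ofReal ?_
    have key : ∀ q : ℝ, 0 ≤ q → ε / (8 * (q + 1)) * q ≤ ε / 8 := by
      intro q hq
      rw [div_mul_eq_mul_div, div_le_div_iff₀ (by positivity) (by positivity)]
      nlinarith
    have h3 := key (3 * C) (by positivity)
    linarith [key A hA0, key p hp0]
  have hIs := integrable_comp hm hK hH hH0 hHinf hsum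
  have hIw := integrable_comp hm hK hH hH0 hHinf (hw n)
  have hIU := integrable_comp hm hK hH hH0 hHinf hU
  have hint : (∫ x, H ((w n + U) x)) - (∫ x, H (w n x)) - ∫ x, H (U x) =
      ∫ x, (H ((w n + U) x) - H (w n x) - H (U x)) := by
    rw [← integral_sub hIs hIw]
    exact (integral_sub (hIs.sub hIw) hIU).symm
  rw [Real.dist_eq, hint]
  -- Three truncation errors, replacing `H` by `G`, and three splitting errors for `G`, each at most
  -- `ε / 8`.
  have hle : ENNReal.ofReal |∫ x, (H ((w n + U) x) - H (w n x) - H (U x))| ≤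
      ENNReal.ofReal (6 * (ε / 8)) := by
    have h1 : ENNReal.ofReal |∫ x, (H ((w n + U) x) - H (w n x) - H (U x))| ≤
        ∫⁻ x, ENNReal.ofReal |H ((w n + U) x) - H (w n x) - H (U x)| := by
      rw [← Real.norm_eq_abs, ofReal_norm]
      refine (enorm_integral_le_lintegral_enorm _).trans (le_of_eq (lintegral_congr fun x => ?_))
      rw [← ofReal_norm, Real.norm_eq_abs]
    have hGc : Continuous G := hGu.continuous
    have hm1 : ∀ u : Space K L → ℝ, MemX m μ u →
        AEMeasurable fun x => ENNReal.ofReal |H (u x) - G (u x)| := by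
      intro u hu
      have h2 := (hH.sub hGc).comp_aestronglyMeasurable hu.memLp.aestronglyMeasurable
      exact h2.norm.aemeasurable.ennreal_ofReal
    refine h1.trans ?_
    calc ∫⁻ x, ENNReal.ofReal |H ((w n + U) x) - H (w n x) - H (U x)|
        ≤ ∫⁻ x, (ENNReal.ofReal |H ((w n + U) x) - G ((w n + U) x)| +
          (ENNReal.ofReal |H (w n x) - G (w n x)| + (ENNReal.ofReal |H (U x) - G (U x)| +
            ENNReal.ofReal |G (w n x + U x) - G (w n x) - G (U x)|))) := by
          refine lintegral_mono fun x => ?_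
          rw [← ENNReal.ofReal_add (by positivity) (by positivity),
            ← ENNReal.ofReal_add (by positivity) (by positivity),
            ← ENNReal.ofReal_add (by positivity) (by positivity)]
          refine ENNReal.ofReal_le_ofReal ?_
          rw [Pi.add_apply]
          generalize w n x + U x = c
          rw [show H c - H (w n x) - H (U x) = (H c - G c) + (-(H (w n x) - G (w n x)) +
            (-(H (U x) - G (U x)) + (G c - G (w n x) - G (U x)))) by ring]
          refine (abs_add_le _ _).trans (add_le_add_right ((abs_add_le _ _).trans ?_) _)
          rw [abs_neg]
          refine add_le_add_right ((abs_add_le _ _).trans ?_) _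
          rw [abs_neg]
      _ ≤ ENNReal.ofReal (ε / 8) + (ENNReal.ofReal (ε / 8) + (ENNReal.ofReal (ε / 8) +
            ENNReal.ofReal (3 * (ε / 8)))) := by
          rw [lintegral_add_left' (hm1 _ hsum), lintegral_add_left' (hm1 _ (hw n)),
            lintegral_add_left' (hm1 _ hU)]
          exact add_le_add (htrunc _ hsum hnsum) (add_le_add
            (htrunc _ (hw n) (hn.trans (le_add_of_nonneg_right (norm_nonneg _))))
            (add_le_add (htrunc _ hU (le_add_of_nonneg_left hB0)) hmain))
      _ = ENNReal.ofReal (6 * (ε / 8)) := by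
          rw [← ENNReal.ofReal_add (by positivity) (by positivity),
            ← ENNReal.ofReal_add (by positivity) (by positivity),
            ← ENNReal.ofReal_add (by positivity) (by positivity)]
          congr 1
          ring
  have := (ENNReal.ofReal_le_ofReal_iff (by positivity)).1 hle
  linarith

end BrezisLieb

end SingularPolyharmonic

namespace SingularPolyharmonic

open FourierTransform RealInnerProductSpace

/-! ### The profile decomposition for functions, and passage to subsequences. -/

section Decomposition

variable {K L : ℕ}

theorem SuperquadraticAtZero.abs {H : ℝ → ℝ} (h : SuperquadraticAtZero H) :
    SuperquadraticAtZero fun t => |H t| := by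
  have h1 := Tendsto.abs h
  rw [abs_zero] at h1
  refine h1.congr fun t => ?_
  rw [abs_div, abs_of_nonneg (sq_nonneg t)]

theorem SubcriticalAtInfinity.abs {N m : ℕ} {H : ℝ → ℝ} (h : SubcriticalAtInfinity N m H) :
    SubcriticalAtInfinity N m fun t => |H t| := by
  refine ⟨fun hN => ?_, fun hN α hα => ?_⟩
  · have h1 := (h.1 hN).abs
    rw [abs_zero] at h1
    refine h1.congr fun t => ?_
    rw [abs_div, abs_of_nonneg (a := |t| ^ _) (by positivity)]
  · have h1 := (h.2 hN α hα).abs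
    rw [abs_zero] at h1
    refine h1.congr fun t => ?_
    rw [abs_div, Real.abs_exp]

theorem integral_comp_shift (H : ℝ → ℝ) (u : Space K L → ℝ) (z : EuclideanSpace ℝ (Fin L)) :
    ∫ x, H (shift z u x) = ∫ x, H (u x) :=
  integral_add_right_eq_self (fun x => H (u x)) (pair 0 z)

theorem shift_shift_neg (u : Space K L → ℝ) (z : EuclideanSpace ℝ (Fin L)) :
    shift z (shift (-z) u) = u := by
  funext x
  rw [shift, shift, add_assoc, ← pair_zero_add, add_neg_cancel, pair_zero_zero, add_zero]

theorem shift_add_fun (u v : Space K L → ℝ) (z : EuclideanSpace ℝ (Fin L)) :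
    shift z (u + v) = shift z u + shift z v := rfl

/-- The functions `u n - ∑ j < i, U j (· - z j n)`. -/
def functionRemainder (u U : ℕ → Space K L → ℝ) (z : ℕ → ℕ → EuclideanSpace ℝ (Fin L))
    (i n : ℕ) : Space K L → ℝ :=
  u n - ∑ j ∈ Finset.range i, shift (-z j n) (U j)

section Profiles

variable {m : ℕ} {μ : ℝ} {u U : ℕ → Space K L → ℝ} {z : ℕ → ℕ → EuclideanSpace ℝ (Fin L)}

theorem memX_functionRemainder (hu : ∀ n, MemX m μ (u n)) (hU : ∀ n, MemX m μ (U n)) (i n : ℕ) :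
    MemX m μ (functionRemainder u U z i n) :=
  (hu n).sub (MemX.sum _ fun j => (hU j).shift _)

theorem toModel_functionRemainder (hu : ∀ n, MemX m μ (u n)) (hU : ∀ n, MemX m μ (U n)) (i n : ℕ) :
    toModel m μ (functionRemainder u U z i n) =
      remainder (fun n => toModel m μ (u n)) (fun j => toModel m μ (U j)) z i n := by
  rw [functionRemainder, toModel_sub (hu n) (MemX.sum _ fun j => (hU j).shift _),
    toModel_sum _ fun j => (hU j).shift _, remainder]
  simp_rw [toModel_shift (hU _)]

theorem shift_functionRemainder_succ (i n : ℕ) :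
    shift (z i n) (functionRemainder u U z i n) =
      shift (z i n) (functionRemainder u U z (i + 1) n) + U i := by
  have h : functionRemainder u U z i n =
      functionRemainder u U z (i + 1) n + shift (-z i n) (U i) := by
    rw [functionRemainder, functionRemainder, Finset.sum_range_succ]
    abel
  rw [h, shift_add_fun, shift_shift_neg]

/-- Iterated Brezis–Lieb: recentred at `z i`, the next remainder is weakly null and the previous one
equals it plus `U i`, while `∫ H` ignores translations. -/
theorem tendsto_integral_sub_remainder (hm : 1 ≤ m) (hK : 2 * m ≤ K) {H : ℝ → ℝ}
    (hH : Continuous H) (hH0 : SuperquadraticAtZero H) (hHinf : SubcriticalAtInfinity (K + L) m H)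
    {𝒰 : Ultrafilter ℕ} (hu : ∀ n, MemX m μ (u n)) (hU : ∀ n, MemX m μ (U n)) {C : ℝ}
    (hC : ∀ n, ‖toModel m μ (u n)‖ ≤ C)
    (hP : IsProfileSystem 𝒰 (fun n => toModel m μ (u n)) (fun j => toModel m μ (U j)) z) (i : ℕ) :
    Tendsto (fun n => (∫ x, H (u n x)) - ∫ x, H (functionRemainder u U z i n x)) 𝒰
      (𝓝 (∑ j ∈ Finset.range i, ∫ x, H (U j x))) := by
  induction i with
  | zero => simp [functionRemainder]
  | succ i ih =>
    rw [Finset.sum_range_succ]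
    have hw : ∀ n, MemX m μ (shift (z i n) (functionRemainder u U z (i + 1) n)) := fun n =>
      (memX_functionRemainder hu hU (i + 1) n).shift _
    have hmod : ∀ n, toModel m μ (shift (z i n) (functionRemainder u U z (i + 1) n)) =
        modelShift (z i n) (remainder (fun n => toModel m μ (u n)) (fun j => toModel m μ (U j)) z
          (i + 1) n) := fun n => by
      rw [toModel_shift (memX_functionRemainder hu hU (i + 1) n), toModel_functionRemainder hu hU]
    have h1 := tendsto_integral_add_sub hm hK hH hH0 hHinf 𝒰 hw (B := C + 1)
      (by
        filter_upwards [hP.eventually_norm_remainder_le hC (i + 1)] with n hn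
        rwa [hmod, LinearIsometry.norm_map])
      (by
        simp_rw [hmod]
        exact hP.weakLim_remainder (Nat.lt_succ_self i)) (hU i)
    refine (ih.add h1).congr fun n => ?_
    rw [← shift_functionRemainder_succ, integral_comp_shift, integral_comp_shift]
    ring

theorem abs_integral_le_of_lintegral_le {f : Space K L → ℝ} {ε : ℝ} (hε : 0 ≤ ε)
    (h : ∫⁻ x, ENNReal.ofReal |f x| ≤ ENNReal.ofReal ε) : |∫ x, f x| ≤ ε := by
  rw [← Real.norm_eq_abs]
  refine (norm_integral_le_lintegral_norm f).trans ?_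
  exact ENNReal.toReal_le_of_le_ofReal hε h

/-- Applied to `|H|`, the splitting bounds the partial sums of `∫ |H(U j)|` by the supremum of `∫
|H(u n)|`, which gives absolute convergence. Applied to `H`, with so many profiles removed that the
vanishing lemma covers the remainder, it identifies the limit. -/
theorem exists_profiles (hm : 1 ≤ m) (hK : 2 * m ≤ K) (hL : 0 < L) {H : ℝ → ℝ}
    (hH : Continuous H) (hH0 : SuperquadraticAtZero H) (hHinf : SubcriticalAtInfinity (K + L) m H)
    (𝒰 : Ultrafilter ℕ) (h𝒰 : (𝒰 : Filter ℕ) ≤ atTop) (hu : ∀ n, MemX m μ (u n)) {C : ℝ}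
    (hC : ∀ n, ‖toModel m μ (u n)‖ ≤ C) :
    ∃ (U : ℕ → Space K L → ℝ) (z : ℕ → ℕ → EuclideanSpace ℝ (Fin L)) (S : ℝ),
      (∀ i, MemX m μ (U i)) ∧ (∀ n, z 0 n = 0) ∧
      IsProfileSystem 𝒰 (fun n => toModel m μ (u n)) (fun j => toModel m μ (U j)) z ∧
      HasSum (fun j => ∫ x, H (U j x)) S ∧ Tendsto (fun n => ∫ x, H (u n x)) 𝒰 (𝓝 S) := by
  obtain ⟨V, z, hz0, hP, hV⟩ := exists_profileSystem hL 𝒰 h𝒰 hC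
  have hex : ∀ i, ∃ v, MemX m μ v ∧ toModel m μ v = V i := by
    intro i
    refine exists_toModel_eq_of_weakLimit (F := 𝒰) (w := fun n => shift (z i n) (u n))
      (fun n => (hu n).shift _) fun g => ?_
    simp_rw [toModel_shift (hu _)]
    exact hP.weakLim i g
  choose U hU hUV using hex
  obtain rfl : V = fun i => toModel m μ (U i) := funext fun i => (hUV i).symm
  have hnorm := hP.tendsto_norm_profile hC
  have hsummable : Summable fun j => ∫ x, H (U j x) := by
    obtain ⟨T, hT0, hT⟩ := exists_lintegral_abs_comp_le (L := L) hm hK μ hH hH0 hHinf C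
    have hnn : ∀ v : Space K L → ℝ, 0 ≤ ∫ x, |H (v x)| := fun v =>
      integral_nonneg fun x => abs_nonneg _
    have h1 : Summable fun j => ∫ x, |H (U j x)| := by
      refine summable_of_sum_range_le (c := T) (fun j => hnn _) fun i => ?_
      refine le_of_tendsto' (tendsto_integral_sub_remainder hm hK hH.abs hH0.abs hHinf.abs hu hU hC
        hP i) fun n => ?_
      have h2 : abs (∫ x, |H (u n x)|) ≤ T := abs_integral_le_of_lintegral_le hT0 (by
        simp_rw [abs_abs]
        exact hT (u n) (hu n) (hC n))
      linarith [le_abs_self (∫ x, |H (u n x)|), hnn (functionRemainder u U z i n)]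
    refine Summable.of_norm_bounded h1 fun j => ?_
    exact norm_integral_le_integral_norm _
  refine ⟨U, z, _, hU, hz0, hP, hsummable.hasSum, ?_⟩
  rw [Metric.tendsto_nhds]
  intro ε hε
  obtain ⟨ν, hν, hvan⟩ := exists_eventually_lintegral_le (L := L) hm hK μ hH hH0 hHinf (C + 1)
    (show 0 < ε / 3 by positivity) 𝒰
  have hpart := (hsummable.hasSum.tendsto_sum_nat.comp (tendsto_add_atTop_nat 1))
  have hn2 : ∀ᶠ i in atTop, 2 * ‖toModel m μ (U (i + 1))‖ < ν := by
    have h1 := ((hnorm.comp (tendsto_add_atTop_nat 1)).const_mul 2)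
    rw [mul_zero] at h1
    exact h1.eventually (gt_mem_nhds hν)
  obtain ⟨i, hi1, hi2⟩ := (hn2.and ((Metric.tendsto_nhds.1 hpart) (ε / 3) (by positivity))).exists
  have hrem := hvan (fun n => functionRemainder u U z (i + 1) n)
    (fun n => memX_functionRemainder hu hU (i + 1) n) (by
      filter_upwards [hP.eventually_norm_remainder_le hC (i + 1)] with n hn
      rwa [toModel_functionRemainder hu hU]) (fun ζ g hg => by
      simp_rw [toModel_functionRemainder hu hU] at hg
      exact (hV i ζ g hg).trans hi1.le)
  have hlim := Metric.tendsto_nhds.1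
    (tendsto_integral_sub_remainder hm hK hH hH0 hHinf hu hU hC hP (i + 1)) (ε / 3) (by positivity)
  filter_upwards [hrem, hlim] with n h1 h2
  have h3 := abs_integral_le_of_lintegral_le (by positivity) h1
  rw [Real.dist_eq] at h2 ⊢
  simp only [Function.comp_apply, Real.dist_eq] at hi2
  rw [abs_lt] at h2 hi2 ⊢
  rw [abs_le] at h3
  constructor <;> linarith

theorem tendsto_formSq_sub_remainder {F : Filter ℕ} (hu : ∀ n, MemX m μ (u n))
    (hU : ∀ n, MemX m μ (U n))
    (hP : IsProfileSystem F (fun n => toModel m μ (u n)) (fun j => toModel m μ (U j)) z) (i : ℕ) :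
    Tendsto (fun n => formSq m μ (u n) - formSq m μ (functionRemainder u U z i n)) F
      (𝓝 (∑ j ∈ Finset.range i, formSq m μ (U j))) := by
  have h1 := (hP.tendsto_energy i 1).add ((hP.tendsto_energy i 2).const_mul (SignType.sign μ : ℝ))
  rw [Finset.mul_sum, ← Finset.sum_add_distrib] at h1
  simp_rw [← formSq_eq (hU _)] at h1
  refine h1.congr fun n => ?_
  rw [formSq_eq (hu n), formSq_eq (memX_functionRemainder hu hU i n),
    toModel_functionRemainder hu hU]
  ring

end Profiles

theorem abs_formSq_le {m : ℕ} {μ : ℝ} {u : Space K L → ℝ} (hu : MemX m μ u) :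
    |formSq m μ u| ≤ ‖toModel m μ u‖ ^ 2 := by
  rw [formSq_eq hu, Model.norm_sq]
  have h1 : |(SignType.sign μ : ℝ)| ≤ 1 := by
    rcases SignType.sign μ with _ | _ | _ <;> norm_num
  rw [abs_le] at h1 ⊢
  constructor <;> nlinarith [sq_nonneg ‖toModel m μ u 0‖, sq_nonneg ‖toModel m μ u 1‖,
    sq_nonneg ‖toModel m μ u 2‖]

theorem exists_tendsto_of_abs_le (𝒰 : Ultrafilter ℕ) {f : ℕ → ℝ} {C : ℝ} (h : ∀ n, |f n| ≤ C) :
    ∃ a, Tendsto f 𝒰 (𝓝 a) := by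
  obtain ⟨a, -, ha⟩ := (isCompact_closedBall (0 : ℝ) C).ultrafilter_le_nhds (𝒰.map f) (by
    rw [le_principal_iff]
    exact Filter.Eventually.of_forall (p := fun n => f n ∈ Metric.closedBall (0 : ℝ) C)
      fun n => by rw [mem_closedBall_zero_iff]; exact h n)
  exact ⟨a, ha⟩

/-- A diagonal argument in filter form: countably many limits that hold along an ultrafilter hold
simultaneously along one subsequence. -/
theorem exists_strictMono_tendsto {F G : Filter ℕ} [F.NeBot] [G.IsCountablyGenerated]
    (hF : F ≤ atTop) (hG : F ≤ G) : ∃ s : ℕ → ℕ, StrictMono s ∧ Tendsto s atTop G := by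
  have hne : (atTop ⊓ G : Filter ℕ).NeBot := neBot_of_le (le_inf hF hG)
  obtain ⟨x, hx⟩ := exists_seq_tendsto (atTop ⊓ G)
  rw [tendsto_inf] at hx
  obtain ⟨φ, hφ, hxφ⟩ := strictMono_subseq_of_tendsto_atTop hx.1
  exact ⟨x ∘ φ, hxφ, hx.2.comp hφ.tendsto_atTop⟩

theorem WeakLim.of_denseSeq {V : Type*} [NormedAddCommGroup V] [InnerProductSpace ℝ V]
    [TopologicalSpace.SeparableSpace V] {F : Filter ℕ} {h : ℕ → V} {g : V} {C : ℝ}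
    (hC : ∀ n, ‖h n‖ ≤ C)
    (hd : ∀ d, Tendsto (fun n => ⟪h n, TopologicalSpace.denseSeq V d⟫) F
      (𝓝 ⟪g, TopologicalSpace.denseSeq V d⟫)) : WeakLim F h g := by
  intro v
  rw [Metric.tendsto_nhds]
  intro ε hε
  set D := |C| + ‖g‖ + 1
  have hD : 0 < D := by positivity
  obtain ⟨d, hdist⟩ := (TopologicalSpace.denseRange_denseSeq V).exists_dist_lt v
    (show 0 < ε / (3 * D) by positivity)
  rw [dist_eq_norm, lt_div_iff₀ (by positivity)] at hdist
  set p := TopologicalSpace.denseSeq V d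
  filter_upwards [Metric.tendsto_nhds.1 (hd d) (ε / 3) (by positivity)] with n hn
  rw [Real.dist_eq] at hn ⊢
  have h1 : ⟪h n, v⟫ - ⟪g, v⟫ = ⟪h n, v - p⟫ + (⟪h n, p⟫ - ⟪g, p⟫) - ⟪g, v - p⟫ := by
    rw [inner_sub_right, inner_sub_right]
    ring
  have h2 : |⟪h n, v - p⟫| ≤ D * ‖v - p‖ := (abs_real_inner_le_norm _ _).trans
    (mul_le_mul_of_nonneg_right ((hC n).trans (by
      linarith [le_abs_self C, norm_nonneg g])) (norm_nonneg _))
  have h3 : |⟪g, v - p⟫| ≤ D * ‖v - p‖ := (abs_real_inner_le_norm _ _).trans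
    (mul_le_mul_of_nonneg_right (by linarith [abs_nonneg C]) (norm_nonneg _))
  rw [h1]
  rw [abs_lt] at hn ⊢
  rw [abs_le] at h2 h3
  constructor <;> nlinarith

/-- The positions drift apart only along the subsequence, but separation is claimed for the full
sequence. Precomposing them with `s ∘ τ` repairs this and changes nothing at the indices `s n`. -/
theorem exists_reindex {s : ℕ → ℕ} (hs : StrictMono s) :
    ∃ τ : ℕ → ℕ, (∀ n, τ (s n) = n) ∧ Tendsto τ atTop atTop := by
  classical
  have hex : ∀ k, ∃ n, k ≤ s n := fun k => ⟨k, hs.id_le k⟩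
  refine ⟨fun k => Nat.find (hex k), fun n => le_antisymm (Nat.find_min' _ le_rfl)
    (hs.le_iff_le.1 (Nat.find_spec (hex (s n)))), tendsto_atTop.2 fun b => ?_⟩
  filter_upwards [eventually_ge_atTop (s b)] with k hk
  exact hs.le_iff_le.1 (hk.trans (Nat.find_spec (hex k)))

/-- Without `z`-variables the only translation is trivial, so after subtracting the weak limit the
vanishing lemma applies at once. -/
theorem exists_weak_limit_of_finrank_zero {m : ℕ} {μ : ℝ} (hm : 1 ≤ m) (hK : 2 * m ≤ K)
    (hL : L = 0) {H : ℝ → ℝ} (hH : Continuous H) (hH0 : SuperquadraticAtZero H)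
    (hHinf : SubcriticalAtInfinity (K + L) m H) (𝒰 : Ultrafilter ℕ) {u : ℕ → Space K L → ℝ}
    (hu : ∀ n, MemX m μ (u n)) {C : ℝ} (hC : ∀ n, ‖toModel m μ (u n)‖ ≤ C) :
    ∃ U : Space K L → ℝ, MemX m μ U ∧ WeakLim 𝒰 (fun n => toModel m μ (u n)) (toModel m μ U) ∧
      Tendsto (fun n => ∫ x, H (u n x)) 𝒰 (𝓝 (∫ x, H (U x))) := by
  obtain ⟨g, hg⟩ := exists_weakLim 𝒰 (.of_forall hC)
  obtain ⟨U, hU, rfl⟩ := exists_toModel_eq_of_weakLimit hu hg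
  refine ⟨U, hU, hg, ?_⟩
  have hw : ∀ n, MemX m μ (u n - U) := fun n => (hu n).sub hU
  have hwC : ∀ᶠ n in (𝒰 : Filter ℕ), ‖toModel m μ (u n - U)‖ ≤ C + ‖toModel m μ U‖ :=
    .of_forall fun n => by
      rw [toModel_sub (hu n) hU]
      exact (norm_sub_le _ _).trans (add_le_add_left (hC n) _)
  have hw0 : WeakLim 𝒰 (fun n => toModel m μ (u n - U)) 0 := by
    simp_rw [toModel_sub (hu _) hU]
    simpa using hg.sub (WeakLim.const _ (toModel m μ U))
  have hsub : Tendsto (fun n => ∫ x, H ((u n - U) x)) 𝒰 (𝓝 0) := by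
    rw [Metric.tendsto_nhds]
    intro ε hε
    obtain ⟨ν, hν, hvan⟩ := exists_eventually_lintegral_le (L := L) hm hK μ hH hH0 hHinf
      (C + ‖toModel m μ U‖) (half_pos hε) 𝒰
    filter_upwards [hvan (fun n => u n - U) hw hwC fun ζ g hg' => by
      have : g = 0 := by
        refine hg'.unique ?_
        subst hL
        have hζ : ∀ n, ζ n = 0 := fun n => Subsingleton.elim _ _
        simp_rw [hζ, modelShift_zero]
        exact hw0
      rw [this, norm_zero]
      exact hν.le] with n hn
    rw [Real.dist_eq, sub_zero]
    exact (abs_integral_le_of_lintegral_le (half_pos hε).le hn).trans_lt (half_lt_self hε)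
  have h1 := (tendsto_integral_add_sub hm hK hH hH0 hHinf 𝒰 hw hwC hw0 hU).add hsub
  rw [add_zero] at h1
  refine h1.congr fun n => ?_
  rw [sub_add_cancel (u n) U]
  ring

theorem tendsto_formSq_sub {m : ℕ} {μ : ℝ} {F : Filter ℕ} {u : ℕ → Space K L → ℝ}
    {U : Space K L → ℝ} (hu : ∀ n, MemX m μ (u n)) (hU : MemX m μ U)
    (h : WeakLim F (fun n => toModel m μ (u n)) (toModel m μ U)) :
    Tendsto (fun n => formSq m μ (u n) - formSq m μ (u n - U)) F (𝓝 (formSq m μ U)) := by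
  have key : ∀ k : Fin 3, Tendsto (fun n => ‖toModel m μ (u n) k‖ ^ 2 -
      ‖toModel m μ (u n - U) k‖ ^ 2) F (𝓝 (‖toModel m μ U k‖ ^ 2)) := by
    intro k
    have h1 := ((h.comp_apply k (toModel m μ U k)).const_mul 2).sub_const (‖toModel m μ U k‖ ^ 2)
    rw [real_inner_self_eq_norm_sq] at h1
    refine (h1.congr fun n => ?_).trans (le_of_eq ?_)
    · rw [toModel_sub (hu n) hU, PiLp.sub_apply, norm_sub_sq_real]
      ring
    · congr 1
      ring
  rw [formSq_eq hU]
  refine ((key 1).add ((key 2).const_mul (SignType.sign μ : ℝ))).congr fun n => ?_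
  rw [formSq_eq (hu n), formSq_eq ((hu n).sub hU)]
  ring

end Decomposition

end SingularPolyharmonic

/-! ### The theorem. -/

open SingularPolyharmonic
theorem theorem4p1 (K L m : ℕ) (hm : 1 ≤ m) (hK : 2 * m ≤ K)
    (μ : ℝ) (hμ : AdmissiblePotential K m μ)
    (H : ℝ → ℝ) (hH : Continuous H) (hH0 : SuperquadraticAtZero H)
    (hHinf : SubcriticalAtInfinity (K + L) m H)
    (u : ℕ → Space K L → ℝ) (hu : ∀ n, MemX m μ (u n))
    (hbdd : ∃ C : ℝ, ∀ n, normX m μ (u n) ≤ C) :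
    (∀ n, Integrable (fun x => H (u n x)) volume) ∧
    (0 < L →
      ∃ (U : ℕ → Space K L → ℝ) (z : ℕ → ℕ → EuclideanSpace ℝ (Fin L)),
        (∀ i, MemX m μ (U i)) ∧
        (∀ n, z 0 n = 0) ∧
        (∀ i j, i ≠ j → Tendsto (fun n => ‖z i n - z j n‖) atTop atTop) ∧
        ∃ s : ℕ → ℕ, StrictMono s ∧
          (∀ i, WeakConvX m μ (fun n => shift (z i (s n)) (u (s n))) (U i)) ∧
          (∀ i, ∃ r : ℝ,
            Tendsto (fun n => formSq m μ
              (u (s n) - ∑ j ∈ Finset.range (i + 1), shift (-z j (s n)) (U j))) atTop (𝓝 r) ∧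
            Tendsto (fun n => formSq m μ (u (s n))) atTop
              (𝓝 (∑ j ∈ Finset.range (i + 1), formSq m μ (U j) + r))) ∧
          (∀ j, Integrable (fun x => H (U j x)) volume) ∧
          ∃ S : ℝ, HasSum (fun j => ∫ x, H (U j x)) S ∧
            limsup (fun n => ((∫ x, H (u (s n) x) : ℝ) : EReal)) atTop = (S : EReal)) ∧
    (L = 0 →
      ∃ U : Space K L → ℝ, MemX m μ U ∧
        ∃ s : ℕ → ℕ, StrictMono s ∧
          WeakConvX m μ (fun n => u (s n)) U ∧
          (∃ r : ℝ,
            Tendsto (fun n => formSq m μ (u (s n) - U)) atTop (𝓝 r) ∧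
            Tendsto (fun n => formSq m μ (u (s n))) atTop (𝓝 (formSq m μ U + r))) ∧
          Integrable (fun x => H (U x)) volume ∧
          limsup (fun n => ((∫ x, H (u (s n) x) : ℝ) : EReal)) atTop =
            ((∫ x, H (U x) : ℝ) : EReal)) := by
  obtain ⟨C, hC⟩ : ∃ C, ∀ n, ‖toModel m μ (u n)‖ ≤ C := by
    obtain ⟨C₀, hC₀⟩ := hbdd
    obtain ⟨⟨D, hD⟩, -⟩ := exists_norm_toModel_le (L := L) hm hμ
    refine ⟨|D| * C₀, fun n => (hD _ (hu n)).trans ?_⟩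
    exact (mul_le_mul_of_nonneg_right (le_abs_self D) (Real.sqrt_nonneg _)).trans
      (mul_le_mul_of_nonneg_left (hC₀ n) (abs_nonneg D))
  -- Provides separability of `L²`, hence `denseSeq` on `Model`.
  have hfact : Fact ((2 : ENNReal) ≠ ⊤) := ⟨by simp⟩
  let 𝒰 : Ultrafilter ℕ := hyperfilter ℕ
  have h𝒰 : (𝒰 : Filter ℕ) ≤ atTop := Nat.hyperfilter_le_atTop
  have hE : ∀ n, |formSq m μ (u n)| ≤ C ^ 2 := fun n =>
    (abs_formSq_le (hu n)).trans (pow_le_pow_left₀ (norm_nonneg _) (hC n) 2)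
  obtain ⟨e, he⟩ := exists_tendsto_of_abs_le 𝒰 hE
  have hlimsup : ∀ (f : ℕ → ℝ) (S : ℝ), Tendsto f atTop (𝓝 S) →
      limsup (fun n => (f n : EReal)) atTop = (S : EReal) := fun f S h =>
    Tendsto.limsup_eq ((continuous_coe_real_ereal.tendsto S).comp h)
  refine ⟨fun n => integrable_comp hm hK hH hH0 hHinf (hu n), fun hL => ?_, fun hL => ?_⟩
  · obtain ⟨U, z, S, hU, hz0, hP, hsum, hlim⟩ := exists_profiles hm hK hL hH hH0 hHinf 𝒰 h𝒰 hu hC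
    -- This filter encodes every limit to be realised: separation of positions, total energy, energy
    -- splittings, `∫ H`, and weak convergence tested on a dense sequence. It is countably generated
    -- because all infima are countable.
    let G : Filter ℕ :=
      (⨅ p : {p : ℕ × ℕ // p.1 ≠ p.2}, comap (fun n => ‖z p.1.1 n - z p.1.2 n‖) atTop) ⊓
        (comap (fun n => formSq m μ (u n)) (𝓝 e) ⊓
          ((⨅ i : ℕ, comap (fun n => formSq m μ (u n) - formSq m μ (functionRemainder u U z i n))
            (𝓝 (∑ j ∈ Finset.range i, formSq m μ (U j)))) ⊓
            (comap (fun n => ∫ x, H (u n x)) (𝓝 S) ⊓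
              ⨅ p : ℕ × ℕ, comap (fun n => inner ℝ (modelShift (z p.1 n) (toModel m μ (u n)))
                (TopologicalSpace.denseSeq (Model K L) p.2))
                (𝓝 (inner ℝ (toModel m μ (U p.1)) (TopologicalSpace.denseSeq (Model K L) p.2))))))
    have hG : (𝒰 : Filter ℕ) ≤ G :=
      le_inf (le_iInf fun p => tendsto_iff_comap.1 (hP.separated _ _ p.2))
        (le_inf (tendsto_iff_comap.1 he)
          (le_inf (le_iInf fun i => tendsto_iff_comap.1 (tendsto_formSq_sub_remainder hu hU hP i))
            (le_inf (tendsto_iff_comap.1 hlim)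
              (le_iInf fun p => tendsto_iff_comap.1 (hP.weakLim p.1 _)))))
    have hGc : G.IsCountablyGenerated := inferInstance
    obtain ⟨s, hs, hsG⟩ := exists_strictMono_tendsto h𝒰 hG
    simp only [G, tendsto_inf, tendsto_iInf, tendsto_comap_iff] at hsG
    obtain ⟨h1, h2, h3, h4, h5⟩ := hsG
    obtain ⟨τ, hτs, hτ⟩ := exists_reindex hs
    refine ⟨U, fun i k => z i (s (τ k)), hU, fun n => hz0 _, fun i j hij =>
      (h1 ⟨(i, j), hij⟩).comp hτ, s, hs, fun i => ?_, fun i => ?_,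
      fun j => integrable_comp hm hK hH hH0 hHinf (hU j), S, hsum, hlimsup _ _ h4⟩
    · simp only [hτs]
      refine weakConvX_of_toModel hm hμ (fun n => (hu _).shift _) (hU i) ?_
      simp_rw [toModel_shift (hu _)]
      exact WeakLim.of_denseSeq (C := C) (fun n => by rw [LinearIsometry.norm_map]; exact hC _)
        fun d => h5 (i, d)
    · simp only [hτs]
      -- The remainder's energy converges because the total energy `e` was included among the
      -- limits.
      refine ⟨e - ∑ j ∈ Finset.range (i + 1), formSq m μ (U j), ?_, ?_⟩
      · refine (h2.sub (h3 (i + 1))).congr fun n => ?_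
        simp only [Function.comp_apply, functionRemainder]
        ring
      · rw [add_sub_cancel]
        exact h2
  · obtain ⟨U, hU, hw, hlim⟩ := exists_weak_limit_of_finrank_zero hm hK hL hH hH0 hHinf 𝒰 hu hC
    let G : Filter ℕ :=
      comap (fun n => formSq m μ (u n)) (𝓝 e) ⊓
        (comap (fun n => formSq m μ (u n) - formSq m μ (u n - U)) (𝓝 (formSq m μ U)) ⊓
          (comap (fun n => ∫ x, H (u n x)) (𝓝 (∫ x, H (U x))) ⊓
            ⨅ d : ℕ, comap (fun n => inner ℝ (toModel m μ (u n))
              (TopologicalSpace.denseSeq (Model K L) d))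
              (𝓝 (inner ℝ (toModel m μ U) (TopologicalSpace.denseSeq (Model K L) d)))))
    have hG : (𝒰 : Filter ℕ) ≤ G :=
      le_inf (tendsto_iff_comap.1 he)
        (le_inf (tendsto_iff_comap.1 (tendsto_formSq_sub hu hU hw))
          (le_inf (tendsto_iff_comap.1 hlim)
            (le_iInf fun d => tendsto_iff_comap.1 (hw _))))
    have hGc : G.IsCountablyGenerated := inferInstance
    obtain ⟨s, hs, hsG⟩ := exists_strictMono_tendsto h𝒰 hG
    simp only [G, tendsto_inf, tendsto_iInf, tendsto_comap_iff] at hsG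
    obtain ⟨h2, h3, h4, h5⟩ := hsG
    refine ⟨U, hU, s, hs, weakConvX_of_toModel hm hμ (fun n => hu _) hU
      (WeakLim.of_denseSeq (C := C) (fun n => hC _) h5), ⟨e - formSq m μ U, ?_, ?_⟩,
      integrable_comp hm hK hH hH0 hHinf hU, hlimsup _ _ h4⟩
    · refine (h2.sub h3).congr fun n => ?_
      simp only [Function.comp_apply]
      ring
    · rw [add_sub_cancel]
      exact h2
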